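/- **Theorem (random product states for optimizing $k$-local Hamiltonians; alternative).** For an $n$-qubit Hamiltonian $H=\sum_{P\in\{I,X,Y,Z\}^{\otimes n}}\alpha_P P$ with real coefficients, let $|P|$ be the number of non-identity tensor factors of $P$ and let $\mathsf{nnz}(H)=|\{P:\alpha_P\neq 0\}|$. $H$ is $k$-local if $\alpha_P=0$ whenever $|P|>k$. There are a randomized algorithm, a universal constant $C$, and constants $D_k>0$ depending only on $k$, such that the following holds for all $n,k\ge 1$ and every $n$-qubit $k$-local Hamiltonian $H=\sum_{P:|P|\le k}\alpha_P P$. Given $n$, $k$ and a list (in any order) of the nonzero terms of $H$, each as its coefficient $\alpha_P$ and its non-identity Pauli factors, the algorithm always halts after at most $C\,(nk+\mathsf{nnz}(H)2^k)$ steps and outputs a random product state $|\psi\rangle=|\psi_1\rangle\otimes\cdots\otimes|\psi_n\rangle$ of $n$ single-qubit pure states (unit vectors in $\mathbb{C}^2$) with $$\left|\,\mathbb{E}_{|\psi\rangle}\big[\langle\psi|H|\psi\rangle\big]-\mathbb{E}_{|\phi\rangle:\mathrm{Haar}}\big[\langle\phi|H|\phi\rangle\big]\,\right|\;\ge\; D_k\sum_{i=1}^{n}\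 \sum_{p\in\{X,Y,Z\}}\sqrt{\sum_{P:\,P_i=p}\alpha_P^2}\,,$$ where $|\phi\rangle$ is a Haar-random pure state of $n$ qubits, for which $\mathbb{E}_{|\phi\rangle:\mathrm{Haar}}[\langle\phi|H|\phi\rangle]=\alpha_I$. Here an algorithm is one fixed program, the same for all $n$, $k$, $H$, for a real random access machine: zero-initialized one- and two-dimensional arrays of natural and of real numbers; addition, (truncated) subtraction and comparison of natural numbers, which also serve as indices; conversion of natural numbers to real numbers; addition, subtraction, multiplication, division, square root and comparison of real numbers; rational constants; and independent random draws of standard Gaussian reals. Every operation takes one step. -/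

import Mathlib

open MeasureTheory
open scoped Matrix

namespace ProductStates

noncomputable section

/-! ### Pauli observables and local Hamiltonians -/

/-- The labels of the four single-qubit Pauli matrices. -/
inductive Pauli
  | I
  | X
  | Y
  | Z
  deriving DecidableEq

instance : Fintype Pauli where
  elems := {Pauli.I, Pauli.X, Pauli.Y, Pauli.Z}
  complete p := by cases p <;> simp

/-- The Pauli matrices. -/
def Pauli.mat : Pauli → Matrix (Fin 2) (Fin 2) ℂ
  | .I => !![1, 0; 0, 1]
  | .X => !![0, 1; 1, 0]
  | .Y => !![0, -Complex.I; Complex.I, 0]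
  | .Z => !![1, 0; 0, -1]

/-- The number by which a Pauli label is presented to an algorithm. -/
def Pauli.code : Pauli → ℕ
  | .I => 0
  | .X => 1
  | .Y => 2
  | .Z => 3

/-- An `n`-fold tensor product of Pauli labels. -/
abbrev PauliString (n : ℕ) := Fin n → Pauli

namespace PauliString

/-- The qubits on which a Pauli string acts nontrivially. -/
def dom {n : ℕ} (P : PauliString n) : Finset (Fin n) :=
  Finset.univ.filter fun i => P i ≠ Pauli.I

/-- The weight `|P|`. -/
def weight {n : ℕ} (P : PauliString n) : ℕ := P.dom.card

/-- The matrix of `P₁ ⊗ ⋯ ⊗ Pₙ` in the computational basis, whose elements are indexed by bit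
strings. -/
def mat {n : ℕ} (P : PauliString n) : Matrix (Fin n → Fin 2) (Fin n → Fin 2) ℂ :=
  Matrix.of fun x y => ∏ i, (P i).mat (x i) (y i)

/-- The qubits on which a Pauli string acts nontrivially, in increasing order. -/
def domList {n : ℕ} (P : PauliString n) : List (Fin n) :=
  (List.finRange n).filter fun i => P i ≠ Pauli.I

end PauliString

/-- The `n`-qubit Hamiltonian `∑ P, α P • P`. -/
def hamiltonian {n : ℕ} (α : PauliString n → ℝ) :
    Matrix (Fin n → Fin 2) (Fin n → Fin 2) ℂ :=
  ∑ P, (α P : ℂ) • P.mat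

/-- The Hamiltonian with Pauli coefficients `α` is `k`-local. -/
def IsLocal {n : ℕ} (k : ℕ) (α : PauliString n → ℝ) : Prop :=
  ∀ P, k < P.weight → α P = 0

/-- The number of nonzero Pauli coefficients. -/
def nnz {n : ℕ} (α : PauliString n → ℝ) : ℕ := Nat.card {P // α P ≠ 0}

/-- The influence of the Pauli matrix `p` at qubit `i`. -/
def influence {n : ℕ} (α : PauliString n → ℝ) (i : Fin n) (p : Pauli) : ℝ :=
  ∑ P : PauliString n with P i = p, α P ^ 2

/-! ### States -/

/-- State vectors of `n` qubits. -/
abbrev QState (n : ℕ) := EuclideanSpace ℂ (Fin n → Fin 2)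

/-- The product vector `ψ₁ ⊗ ⋯ ⊗ ψₙ`. -/
def productState {n : ℕ} (ψ : Fin n → EuclideanSpace ℂ (Fin 2)) : QState n :=
  WithLp.toLp 2 fun x => ∏ i, ψ i (x i)

/-- The expectation value `⟨ψ|H|ψ⟩`, which is real for Hermitian `H`. -/
def energy {n : ℕ} (H : Matrix (Fin n → Fin 2) (Fin n → Fin 2) ℂ) (ψ : QState n) : ℝ :=
  (star ψ.ofLp ⬝ᵥ H *ᵥ ψ.ofLp).re

/-- The law of a Haar-random pure state of `n` qubits: the normalized surface measure on the unit
sphere of the state space. -/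
def haarState (n : ℕ) : Measure (Metric.sphere (0 : QState n) 1) :=
  ((volume : Measure (QState n)).toSphere Set.univ)⁻¹ • (volume : Measure (QState n)).toSphere

/-- The average energy of a Haar-random pure state. -/
def haarEnergy {n : ℕ} (H : Matrix (Fin n → Fin 2) (Fin n → Fin 2) ℂ) : ℝ :=
  ∫ φ, energy H (φ : QState n) ∂haarState n

/-! ### Randomized real random access machine

Programs of a small imperative language. The memory consists of two-dimensional arrays of
natural numbers and two-dimensional arrays of real numbers, numbered by `0, 1, 2, …`; a program
mentions finitely many of them. Natural numbers can be added, subtracted and compared and used as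
indices. Real numbers can be added, subtracted, multiplied, divided and compared, and square roots
can be taken; only rational constants occur in programs, and reals cannot be rounded.
Randomness is a sequence of independent standard Gaussian numbers that a program draws one by
one; for example, a draw has a uniformly random sign, three of them normalized are the Bloch
vector of a Haar-random qubit, and any of the coordinates of the latter is uniform in `[-1, 1]`.
Every operation, memory access, test and draw has unit cost. -/

/-- Expressions with values in the natural numbers; `get a i j` reads the entry `(i, j)` of the
array `a`. -/
inductive NatExp
  | const (c : ℕ)
  | get (a : ℕ) (i j : NatExp)
  | add (e f : NatExp)
  | sub (e f : NatExp)

/-- Expressions with values in the real numbers. -/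
inductive RealExp
  | const (q : ℚ)
  | ofNat (e : NatExp)
  | get (a : ℕ) (i j : NatExp)
  | add (e f : RealExp)
  | sub (e f : RealExp)
  | mul (e f : RealExp)
  | div (e f : RealExp)
  | sqrt (e : RealExp)

/-- Tests. -/
inductive Test
  | natLe (e f : NatExp)
  | realLe (e f : RealExp)

/-- Programs. -/
inductive Program
  | skip
  | setNat (a : ℕ) (i j : NatExp) (e : NatExp)
  | setReal (a : ℕ) (i j : NatExp) (e : RealExp)
  | draw (a : ℕ) (i j : NatExp)
  | seq (p q : Program)
  | ite (b : Test) (p q : Program)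
  | loop (b : Test) (p : Program)

/-- The memory, and the number of random numbers drawn so far. -/
structure Store where
  nats : ℕ → ℕ → ℕ → ℕ
  reals : ℕ → ℕ → ℕ → ℝ
  drawn : ℕ

/-- The memory after the assignment of `v` to the entry `(i, j)` of the array `a`. -/
def assign {β : Type} (m : ℕ → ℕ → ℕ → β) (a i j : ℕ) (v : β) : ℕ → ℕ → ℕ → β :=
  fun a' i' j' => if a' = a ∧ i' = i ∧ j' = j then v else m a' i' j'

namespace NatExp

/-- The value of an expression; subtraction is truncated at zero. -/
def eval (s : Store) : NatExp → ℕ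
  | const c => c
  | get a i j => s.nats a (i.eval s) (j.eval s)
  | add e f => e.eval s + f.eval s
  | sub e f => e.eval s - f.eval s

/-- The number of operations in an expression. -/
def cost : NatExp → ℕ
  | const _ => 1
  | get _ i j => i.cost + j.cost + 1
  | add e f => e.cost + f.cost + 1
  | sub e f => e.cost + f.cost + 1

end NatExp

namespace RealExp

/-- The value of an expression; a division by zero and the root of a negative number give zero. -/
def eval (s : Store) : RealExp → ℝ
  | const q => q
  | ofNat e => e.eval s
  | get a i j => s.reals a (i.eval s) (j.eval s)
  | add e f => e.eval s + f.eval s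
  | sub e f => e.eval s - f.eval s
  | mul e f => e.eval s * f.eval s
  | div e f => e.eval s / f.eval s
  | sqrt e => Real.sqrt (e.eval s)

/-- The number of operations in an expression. -/
def cost : RealExp → ℕ
  | const _ => 1
  | ofNat e => e.cost + 1
  | get _ i j => i.cost + j.cost + 1
  | add e f => e.cost + f.cost + 1
  | sub e f => e.cost + f.cost + 1
  | mul e f => e.cost + f.cost + 1
  | div e f => e.cost + f.cost + 1
  | sqrt e => e.cost + 1

end RealExp

namespace Test

/-- The outcome of a test. -/
def Holds (s : Store) : Test → Prop
  | natLe e f => e.eval s ≤ f.eval s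
  | realLe e f => e.eval s ≤ f.eval s

/-- The number of operations in a test. -/
def cost : Test → ℕ
  | natLe e f => e.cost + f.cost + 1
  | realLe e f => e.cost + f.cost + 1

end Test

/-- `Runs ω p s s' t`: started in the memory `s` with the sequence `ω` of random numbers, the
program `p` halts in the memory `s'` after `t` steps. -/
inductive Runs (ω : ℕ → ℝ) : Program → Store → Store → ℕ → Prop
  | skip (s : Store) : Runs ω .skip s s 1
  | setNat (a : ℕ) (i j e : NatExp) (s : Store) :
      Runs ω (.setNat a i j e) s
        { s with nats := assign s.nats a (i.eval s) (j.eval s) (e.eval s) }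
        (i.cost + j.cost + e.cost + 1)
  | setReal (a : ℕ) (i j : NatExp) (e : RealExp) (s : Store) :
      Runs ω (.setReal a i j e) s
        { s with reals := assign s.reals a (i.eval s) (j.eval s) (e.eval s) }
        (i.cost + j.cost + e.cost + 1)
  | draw (a : ℕ) (i j : NatExp) (s : Store) :
      Runs ω (.draw a i j) s
        { s with
          reals := assign s.reals a (i.eval s) (j.eval s) (ω s.drawn)
          drawn := s.drawn + 1 }
        (i.cost + j.cost + 1)
  | seq {p q : Program} {s s' s'' : Store} {t t' : ℕ} :
      Runs ω p s s' t → Runs ω q s' s'' t' → Runs ω (.seq p q) s s'' (t + t')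
  | iteTrue {b : Test} {p q : Program} {s s' : Store} {t : ℕ} :
      b.Holds s → Runs ω p s s' t → Runs ω (.ite b p q) s s' (b.cost + t)
  | iteFalse {b : Test} {p q : Program} {s s' : Store} {t : ℕ} :
      ¬ b.Holds s → Runs ω q s s' t → Runs ω (.ite b p q) s s' (b.cost + t)
  | loopDone {b : Test} {p : Program} {s : Store} :
      ¬ b.Holds s → Runs ω (.loop b p) s s b.cost
  | loopStep {b : Test} {p : Program} {s s' s'' : Store} {t t' : ℕ} :
      b.Holds s → Runs ω p s s' t → Runs ω (.loop b p) s' s'' t' →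
        Runs ω (.loop b p) s s'' (b.cost + t + t')

/-- The law of the sequence of random numbers. -/
def tapeLaw : Measure (ℕ → ℝ) :=
  Measure.infinitePi fun _ => ProbabilityTheory.gaussianReal 0 1

/-! ### Input and output -/

/-- The input memory for a `k`-local Hamiltonian with coefficients `α`, whose nonzero terms are
listed in the order `e`. Among the arrays of natural numbers, array `0` has the first row
`n, k, nnz`, array `1` holds the weight of the term `t` at `(t, 0)`, row `t` of array `2` lists the
qubits on which the term `t` acts nontrivially, in increasing order, and row `t` of array `3` lists
the codes of the Pauli matrices at these qubits. Array `0` of real numbers holds the coefficient of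
the term `t` at `(t, 0)`. All other entries are zero. -/
def inputStore {n : ℕ} (k : ℕ) (α : PauliString n → ℝ) (e : Fin (nnz α) ≃ {P // α P ≠ 0}) :
    Store where
  nats a t j :=
    if a = 0 then
      if t = 0 then [n, k, nnz α].getD j 0 else 0
    else if h : t < nnz α then
      let P : PauliString n := (e ⟨t, h⟩).1
      if a = 1 then (if j = 0 then P.weight else 0)
      else if a = 2 then (P.domList.map fun i => (i : ℕ)).getD j 0
      else if a = 3 then (P.domList.map fun i => (P i).code).getD j 0
      else 0
    else 0
  reals a t j :=
    if h : t < nnz α then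
      if a = 0 ∧ j = 0 then α (e ⟨t, h⟩).1 else 0
    else 0
  drawn := 0

/-- The output: row `i` of the array `1` of real numbers holds the real and imaginary parts of the
two amplitudes of the state of qubit `i`. -/
def outputState (n : ℕ) (s : Store) : Fin n → EuclideanSpace ℂ (Fin 2) := fun i =>
  !₂[(⟨s.reals 1 i 0, s.reals 1 i 1⟩ : ℂ), (⟨s.reals 1 i 2, s.reals 1 i 3⟩ : ℂ)]

end

end ProductStates

open ProductStates

namespace ProductStates

noncomputable section

/-! ### Energies -/

/-! The energy of a product state is a multilinear polynomial in the 3n Bloch coordinates of its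
qubits: a Pauli string contributes its coefficient times the product of the coordinates it names,
and different strings give different monomials. A Haar-random state has energy α_I, because every
other Pauli string is negated by some isometry of the state space. Let f be the polynomial without
its constant term, and let Inf_v be the sum of the squared coefficients of the terms containing the
variable v. The task is to find Bloch vectors with |f| at least D_k times the sum of the √Inf_v. The
algorithm is deterministic: it draws no random number, so the expectation is over a constant.

Base point. At uniformly random y in {±1/4}^(3n), the second moment of ∂_v f(y) is at least a
constant depending on k times Inf_v, and hypercontractivity bounds its fourth moment by Inf_v².
Hence E|∂_v f(y)| is of order √Inf_v. The signs are fixed one by one by conditional expectations.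
With h = 1/√Inf_v and β = 16^(-k), the number |g| is at least β(h g² - β h³ g⁴) whenever β ≤ 1. The
estimator `potential` sums the bracket over v, with the exact conditional second moment of g = ∂_v f
and an upper bound for its fourth moment. By `sq_wnorm_subst_le` and `potential_le_subst`, one of
the two values of each variable does not decrease it. Its initial size (`le_potential_coef`) and its
final meaning (`Stage.sum_abs_deriv`) give Σ|∂_v f(y)| ≥ 16^(-2k) Σ√Inf_v.

Segment. Moving from y in the direction z_v = sign(∂_v f(y))/8 gives the polynomial p(ε) = f(y + εz)
of degree at most k, whose linear coefficient is Σ|∂_v f(y)|/8. By Lagrange interpolation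
(`exists_abs_coeff_one_le`) one of the values p(e/k), e = 0, …, k, is comparable to it. All
coordinates of such a point have absolute value between 1/8 and 3/8.

Rounding. As f is affine in each variable, each coordinate can be moved to ±1/√3 in turn without
decreasing |f|. Three coordinates ±1/√3 form a unit vector, so every qubit is pure.

Running time. The derivatives are kept as a sparse table. Eliminating u touches only the entries
listed for u in a schedule computed beforehand, and the schedule has at most nnz · k² entries in all
(`progSchedule_does`, `EliminateInv.does`). Every phase costs at most a multiple of n + k + nnz ·
(k+1)², and (k+1)² ≤ 8 · 2^k. -/

/-- The quadratic form `⟨φ|A|φ⟩` of a matrix. -/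
def quadForm {ι : Type*} [Fintype ι] (A : Matrix ι ι ℂ) (φ : ι → ℂ) : ℂ :=
  ∑ x, ∑ y, star (φ x) * A x y * φ y

lemma energy_eq_quadForm {n : ℕ} (H : Matrix (Fin n → Fin 2) (Fin n → Fin 2) ℂ) (φ : QState n) :
    energy H φ = (quadForm H φ.ofLp).re := by
  simp only [energy, quadForm, dotProduct, Matrix.mulVec, Finset.mul_sum, Pi.star_apply, mul_assoc]

lemma energy_hamiltonian {n : ℕ} (α : PauliString n → ℝ) (φ : QState n) :
    energy (hamiltonian α) φ = ∑ P, α P * energy P.mat φ := by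
  have h : quadForm (hamiltonian α) φ.ofLp = ∑ P, (α P : ℂ) * quadForm P.mat φ.ofLp := by
    simp only [quadForm, hamiltonian, Matrix.sum_apply, Matrix.smul_apply, smul_eq_mul,
      Finset.mul_sum, Finset.sum_mul]
    conv_lhs => enter [2, x]; rw [Finset.sum_comm]
    rw [Finset.sum_comm]
    refine Finset.sum_congr rfl fun P _ => ?_
    refine Finset.sum_congr rfl fun x _ => Finset.sum_congr rfl fun y _ => ?_
    ring
  simp only [energy_eq_quadForm, h, Complex.re_sum, Complex.re_ofReal_mul]

/-- Amplitudes and matrix entries both factor over the qubits, so distributing the product of the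
one-qubit double sums yields the double sum over bit strings. -/
lemma quadForm_productState {n : ℕ} (P : PauliString n)
    (ψ : Fin n → EuclideanSpace ℂ (Fin 2)) :
    quadForm P.mat (productState ψ).ofLp = ∏ i, quadForm (P i).mat (ψ i).ofLp := by
  simp only [quadForm, productState, PauliString.mat, Matrix.of_apply]
  simp only [Finset.prod_univ_sum, Fintype.piFinset_univ]
  refine Finset.sum_congr rfl fun x _ => Finset.sum_congr rfl fun y _ => ?_
  simp only [Finset.prod_mul_distrib, star_prod]

/-! ### The average energy of a Haar-random state -/

section Haar

open scoped Pointwise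

/-- The surface measure of a set is a multiple of the volume of the cone over it. A linear isometry
maps cones to cones and preserves volume. -/
lemma toSphere_measurePreserving {E : Type*} [NormedAddCommGroup E] [InnerProductSpace ℝ E]
    [MeasurableSpace E] [BorelSpace E] [FiniteDimensional ℝ E] (g : E ≃ₗᵢ[ℝ] E)
    (G : Metric.sphere (0 : E) 1 → Metric.sphere (0 : E) 1) (hG : ∀ φ, (G φ : E) = g φ) :
    MeasurePreserving G (volume : Measure E).toSphere (volume : Measure E).toSphere := by
  have hGc : Continuous G := by
    rw [continuous_induced_rng]
    have : (Subtype.val ∘ G) = fun φ : Metric.sphere (0 : E) 1 => g φ := funext hG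
    rw [this]
    exact g.continuous.comp continuous_subtype_val
  refine ⟨hGc.measurable, ?_⟩
  ext s hs
  rw [Measure.map_apply hGc.measurable hs, Measure.toSphere_apply' _ hs,
    Measure.toSphere_apply' _ (hGc.measurable hs)]
  congr 1
  rw [← (show MeasurePreserving g.toMeasurableEquiv volume volume from
    g.measurePreserving).measure_preimage_equiv (Set.Ioo (0 : ℝ) 1 • (Subtype.val '' s))]
  congr 1
  ext φ
  simp only [Set.mem_smul, Set.mem_image, Set.mem_preimage]
  constructor
  · rintro ⟨r, hr, _, ⟨χ, hχ, rfl⟩, rfl⟩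
    exact ⟨r, hr, _, ⟨G χ, hχ, rfl⟩, by rw [hG]; exact (g.map_smul r (χ : E)).symm⟩
  · rintro ⟨r, hr, _, ⟨χ, hχ, rfl⟩, h⟩
    change r • (χ : E) = g φ at h
    have h1 : g.symm (χ : E) ∈ Metric.sphere (0 : E) 1 := by
      simp
    refine ⟨r, hr, _, ⟨⟨g.symm χ, h1⟩, ?_, rfl⟩, ?_⟩
    · have : G ⟨g.symm χ, h1⟩ = χ := Subtype.ext (by rw [hG]; simp)
      rw [this]; exact hχ
    · apply g.injective
      have h2 : g (r • g.symm (χ : E)) = r • (χ : E) := by rw [g.map_smul]; simp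
      rw [h2]; exact h

/-- Some Pauli matrix on a qubit where `P` acts nontrivially anticommutes with `P`, and applying it
to the state reverses the sign of the energy. -/
lemma exists_isometry_energy_neg {n : ℕ} (P : PauliString n) (hP : P ≠ fun _ => Pauli.I) :
    ∃ g : QState n ≃ₗᵢ[ℝ] QState n, ∀ φ, energy P.mat (g φ) = -energy P.mat φ := by
  obtain ⟨i, hi⟩ : ∃ i, P i ≠ Pauli.I := by
    by_contra h
    push Not at h
    exact hP (funext h)
  by_cases hZ : P i = Pauli.Z
  -- A factor Z is negated by flipping the bit `i`.
  · let σ : (Fin n → Fin 2) ≃ (Fin n → Fin 2) :=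
      { toFun := fun x => Function.update x i (1 - x i)
        invFun := fun x => Function.update x i (1 - x i)
        left_inv := fun x => by simp
        right_inv := fun x => by simp }
    refine ⟨LinearIsometryEquiv.piLpCongrLeft 2 ℝ ℂ σ, fun φ => ?_⟩
    have hmat : ∀ x y, P.mat (σ x) (σ y) = -P.mat x y := by
      intro x y
      simp only [PauliString.mat, Matrix.of_apply]
      rw [← Finset.mul_prod_erase _ _ (Finset.mem_univ i),
        ← Finset.mul_prod_erase Finset.univ (fun j => (P j).mat (x j) (y j)) (Finset.mem_univ i),
        ← neg_mul]
      congr 1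
      · simp only [σ, Equiv.coe_fn_mk, Function.update_self, hZ, Pauli.mat]
        generalize x i = a
        generalize y i = b
        fin_cases a <;> fin_cases b <;> simp
      · refine Finset.prod_congr rfl fun j hj => ?_
        have := Finset.ne_of_mem_erase hj
        simp [σ, this]
    have hσ : ∀ x, (LinearIsometryEquiv.piLpCongrLeft 2 ℝ ℂ σ φ).ofLp x = φ.ofLp (σ.symm x) := by
      intro x
      simp [LinearIsometryEquiv.piLpCongrLeft_apply, Equiv.piCongrLeft']
    simp only [energy_eq_quadForm, quadForm, hσ]
    rw [← Complex.neg_re, ← σ.sum_comp, ← Finset.sum_neg_distrib]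
    congr 1
    refine Finset.sum_congr rfl fun x _ => ?_
    rw [← σ.sum_comp, ← Finset.sum_neg_distrib]
    refine Finset.sum_congr rfl fun y _ => ?_
    rw [hmat]; simp
  -- A factor X or Y is off-diagonal, so only pairs with different bits `i` contribute; negating the
  -- amplitudes with bit 1 changes the sign of each of them.
  · let g : ∀ x : Fin n → Fin 2, ℂ ≃ₗᵢ[ℝ] ℂ := fun x =>
      if x i = 0 then LinearIsometryEquiv.refl ℝ ℂ else LinearIsometryEquiv.neg ℝ
    have hg : ∀ x a, g x a = (if x i = 0 then 1 else -1) * a := by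
      intro x a
      by_cases h : x i = 0 <;> simp [g, h]
    refine ⟨LinearIsometryEquiv.piLpCongrRight 2 g, fun φ => ?_⟩
    simp only [energy_eq_quadForm, quadForm, LinearIsometryEquiv.piLpCongrRight_apply]
    rw [← Complex.neg_re, ← Finset.sum_neg_distrib]
    congr 1
    refine Finset.sum_congr rfl fun x _ => ?_
    rw [← Finset.sum_neg_distrib]
    refine Finset.sum_congr rfl fun y _ => ?_
    simp only [hg]
    by_cases hxy : x i = y i
    · have : P.mat x y = 0 := by
        simp only [PauliString.mat, Matrix.of_apply]
        refine Finset.prod_eq_zero (Finset.mem_univ i) ?_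
        rw [hxy]
        generalize y i = b
        rcases h : P i with _ | _ | _ | _
        · exact absurd h hi
        · fin_cases b <;> simp [Pauli.mat]
        · fin_cases b <;> simp [Pauli.mat]
        · exact absurd h hZ
      simp [this]
    · by_cases hx : x i = 0
      · have hy : y i ≠ 0 := fun h => hxy (hx.trans h.symm)
        simp [hx, hy]
      · have hy : y i = 0 := by omega
        simp [hx, hy]

lemma continuous_energy {n : ℕ} (H : Matrix (Fin n → Fin 2) (Fin n → Fin 2) ℂ) :
    Continuous fun φ : QState n => energy H φ := by
  simp only [energy_eq_quadForm, quadForm]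
  fun_prop

instance haarState_isProbabilityMeasure (n : ℕ) : IsProbabilityMeasure (haarState n) := by
  refine ⟨?_⟩
  have hne : (volume : Measure (QState n)).toSphere Set.univ ≠ 0 := by
    rw [Measure.measure_univ_ne_zero]
    exact Measure.toSphere_ne_zero _
  rw [haarState, Measure.smul_apply, smul_eq_mul]
  exact ENNReal.inv_mul_cancel hne (measure_ne_top _ _)

lemma integrable_energy_haarState {n : ℕ} (H : Matrix (Fin n → Fin 2) (Fin n → Fin 2) ℂ) :
    Integrable (fun φ : Metric.sphere (0 : QState n) 1 => energy H (φ : QState n))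
      (haarState n) := by
  have hc : Continuous fun φ : Metric.sphere (0 : QState n) 1 => energy H (φ : QState n) :=
    (continuous_energy H).comp continuous_subtype_val
  have := hc.integrable_of_hasCompactSupport (μ := haarState n)
    (HasCompactSupport.of_compactSpace _)
  exact this

/-- For a nontrivial string the average equals its own negative, by invariance of the Haar measure
under the isometry from `exists_isometry_energy_neg`. -/
lemma haarEnergy_pauliString {n : ℕ} (P : PauliString n) :
    haarEnergy P.mat = if P = fun _ => Pauli.I then 1 else 0 := by
  split_ifs with h
  · have h1 : P.mat = 1 := by
      ext x y
      have h2 : ∀ a b, Pauli.I.mat a b = if a = b then 1 else 0 := by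
        intro a b
        fin_cases a <;> fin_cases b <;> simp [Pauli.mat]
      simp only [PauliString.mat, Matrix.of_apply, h, h2, Matrix.one_apply, Finset.prod_ite_zero,
        Finset.prod_const_one, funext_iff, Finset.mem_univ, true_implies]
    have h3 : ∀ φ : Metric.sphere (0 : QState n) 1, energy P.mat (φ : QState n) = 1 := by
      intro φ
      have hn : ‖(φ : QState n)‖ = 1 := by simp
      have := EuclideanSpace.norm_sq_eq (φ : QState n)
      rw [hn] at this
      rw [energy, h1, Matrix.one_mulVec, dotProduct, Complex.re_sum]
      rw [one_pow] at this
      refine Eq.trans ?_ this.symm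
      refine Finset.sum_congr rfl fun x _ => ?_
      rw [Pi.star_apply, RCLike.star_def, ← Complex.normSq_eq_conj_mul_self, Complex.ofReal_re,
        Complex.normSq_eq_norm_sq]
    simp [haarEnergy, h3]
  · obtain ⟨g, hg⟩ := exists_isometry_energy_neg P h
    let G : Metric.sphere (0 : QState n) 1 → Metric.sphere (0 : QState n) 1 :=
      fun φ => ⟨g φ, by simp⟩
    have hG : MeasurePreserving G (haarState n) (haarState n) := by
      have := toSphere_measurePreserving g G fun _ => rfl
      exact this.smul_measure _
    have hEG : MeasurableEmbedding G := by
      refine MeasurableEquiv.measurableEmbedding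
        (⟨⟨G, fun φ => ⟨g.symm φ, by simp⟩, fun φ => ?_, fun φ => ?_⟩,
          hG.measurable, ?_⟩ : Metric.sphere (0 : QState n) 1 ≃ᵐ Metric.sphere (0 : QState n) 1)
      · exact Subtype.ext (by simp [G])
      · exact Subtype.ext (by simp [G])
      · refine Continuous.measurable ?_
        exact (g.symm.continuous.comp continuous_subtype_val).subtype_mk _
    have h1 := hG.integral_comp hEG (fun φ => energy P.mat (φ : QState n))
    have h2 : ∀ φ, energy P.mat ((G φ : Metric.sphere (0 : QState n) 1) : QState n)
        = -energy P.mat (φ : QState n) := fun φ => hg φ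
    simp only [h2, integral_neg] at h1
    rw [haarEnergy]
    linarith

theorem haarEnergy_hamiltonian {n : ℕ} (α : PauliString n → ℝ) :
    haarEnergy (hamiltonian α) = α fun _ => Pauli.I := by
  have h : haarEnergy (hamiltonian α) = ∑ P, α P * haarEnergy P.mat := by
    simp only [haarEnergy, energy_hamiltonian]
    rw [integral_finsetSum _ fun P _ => (integrable_energy_haarState P.mat).const_mul _]
    simp only [integral_const_mul]
  simp [h, haarEnergy_pauliString]

end Haar

/-! ### Reasoning about programs that draw no random numbers -/

/-- `Does p s T Q`: started in the memory `s`, the program `p` halts after at most `T` steps in a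
memory satisfying `Q`, whatever the random numbers are. -/
def Does (p : Program) (s : Store) (T : ℕ) (Q : Store → Prop) : Prop :=
  ∃ s' t, (∀ ω, Runs ω p s s' t) ∧ t ≤ T ∧ Q s'

lemma Does.mono {p : Program} {s : Store} {T T' : ℕ} {Q Q' : Store → Prop} (h : Does p s T Q)
    (hT : T ≤ T') (hQ : ∀ s', Q s' → Q' s') : Does p s T' Q' := by
  obtain ⟨s', t, hr, ht, hq⟩ := h
  exact ⟨s', t, hr, ht.trans hT, hQ _ hq⟩

lemma Does.le {p : Program} {s : Store} {T T' : ℕ} {Q : Store → Prop} (h : Does p s T Q)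
    (hT : T ≤ T') : Does p s T' Q := h.mono hT fun _ h => h

lemma Does.seq {p q : Program} {s : Store} {T T' : ℕ} {Q Q' : Store → Prop} (h : Does p s T Q)
    (h' : ∀ s', Q s' → Does q s' T' Q') : Does (.seq p q) s (T + T') Q' := by
  obtain ⟨s', t, hr, ht, hq⟩ := h
  obtain ⟨s'', t', hr', ht', hq'⟩ := h' s' hq
  exact ⟨s'', t + t', fun ω => .seq (hr ω) (hr' ω), by omega, hq'⟩

/-- Whether a program has neither loops nor random numbers. -/
def Program.straight : Program → Bool
  | .skip => true
  | .setNat .. => true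
  | .setReal .. => true
  | .draw .. => false
  | .seq p q => p.straight && q.straight
  | .ite _ p q => p.straight && q.straight
  | .loop .. => false

open Classical in
/-- The final memory of a program without loops and random numbers. -/
def Program.exec : Program → Store → Store
  | .setNat a i j e, s => { s with nats := assign s.nats a (i.eval s) (j.eval s) (e.eval s) }
  | .setReal a i j e, s => { s with reals := assign s.reals a (i.eval s) (j.eval s) (e.eval s) }
  | .seq p q, s => q.exec (p.exec s)
  | .ite b p q, s => if b.Holds s then p.exec s else q.exec s
  | _, s => s

/-- A bound for the number of steps of a program without loops. -/
def Program.length : Program → ℕ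
  | .skip => 1
  | .setNat _ i j e => i.cost + j.cost + e.cost + 1
  | .setReal _ i j e => i.cost + j.cost + e.cost + 1
  | .draw _ i j => i.cost + j.cost + 1
  | .seq p q => p.length + q.length
  | .ite b p q => b.cost + (p.length + q.length)
  | .loop .. => 0

lemma Program.exists_runs_exec {p : Program} (hp : p.straight) (s : Store) :
    ∃ t, (∀ ω, Runs ω p s (p.exec s) t) ∧ t ≤ p.length := by
  induction p generalizing s with
  | skip => exact ⟨_, fun ω => .skip s, le_rfl⟩
  | setNat a i j e => exact ⟨_, fun ω => .setNat a i j e s, le_rfl⟩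
  | setReal a i j e => exact ⟨_, fun ω => .setReal a i j e s, le_rfl⟩
  | draw a i j => exact absurd hp (by simp [straight])
  | seq p q ihp ihq =>
    simp only [straight, Bool.and_eq_true] at hp
    obtain ⟨t, h, ht⟩ := ihp hp.1 s
    obtain ⟨t', h', ht'⟩ := ihq hp.2 (p.exec s)
    exact ⟨t + t', fun ω => .seq (h ω) (h' ω), Nat.add_le_add ht ht'⟩
  | ite b p q ihp ihq =>
    simp only [straight, Bool.and_eq_true] at hp
    obtain ⟨t, h, ht⟩ := ihp hp.1 s
    obtain ⟨t', h', ht'⟩ := ihq hp.2 s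
    by_cases hb : b.Holds s
    · refine ⟨b.cost + t, fun ω => ?_, ?_⟩
      · rw [Program.exec, if_pos hb]; exact .iteTrue hb (h ω)
      · rw [Program.length]; omega
    · refine ⟨b.cost + t', fun ω => ?_, ?_⟩
      · rw [Program.exec, if_neg hb]; exact .iteFalse hb (h' ω)
      · rw [Program.length]; omega
  | loop b p => exact absurd hp (by simp [straight])

/-- Loop-free code is verified by evaluation: `decide` settles that it is straight and bounds its
length, and only a computation of the final memory is left. -/
lemma Does.exec {p : Program} (hp : p.straight) {s : Store} {T : ℕ}
    {Q : Store → Prop} (hT : p.length ≤ T) (hQ : Q (p.exec s)) : Does p s T Q := by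
  obtain ⟨t, h, ht⟩ := p.exists_runs_exec hp s
  exact ⟨_, t, h, ht.trans hT, hQ⟩

/-! ### Variables and counting loops. -/

/-- The natural number variable stored at the entry `(0, 0)` of an array. -/
abbrev nvar (a : ℕ) : NatExp := .get a (.const 0) (.const 0)

/-- The real variable stored at the entry `(0, 0)` of an array. -/
abbrev rvar (a : ℕ) : RealExp := .get a (.const 0) (.const 0)

/-- The entry `i` of a one-dimensional array of natural numbers. -/
abbrev nvec (a : ℕ) (i : NatExp) : NatExp := .get a i (.const 0)

/-- The entry `i` of a one-dimensional array of real numbers. -/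
abbrev rvec (a : ℕ) (i : NatExp) : RealExp := .get a i (.const 0)

/-- The memory after the assignment of `i` to the variable `c`. -/
def Store.setVar (s : Store) (c i : ℕ) : Store := { s with nats := assign s.nats c 0 0 i }

/-- The loop in which the variable `c` runs through the numbers below `B`. -/
def forTo (c : ℕ) (B : NatExp) (p : Program) : Program :=
  .seq (.setNat c (.const 0) (.const 0) (.const 0))
    (.loop (.natLe (.add (nvar c) (.const 1)) B)
      (.seq p (.setNat c (.const 0) (.const 0) (.add (nvar c) (.const 1)))))

/-- The two-dimensional array `f` after the assignment of `v` to the entry `(i, j)`. -/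
def upd {β : Type} (f : ℕ → ℕ → β) (i j : ℕ) (v : β) : ℕ → ℕ → β :=
  fun i' j' => if i' = i ∧ j' = j then v else f i' j'

lemma assign_self {β : Type} (m : ℕ → ℕ → ℕ → β) (a i j : ℕ) (v : β) :
    assign m a i j v a = upd (m a) i j v := by
  funext i' j'
  simp [assign, upd]

lemma assign_ne {β : Type} (m : ℕ → ℕ → ℕ → β) {a a' : ℕ} (h : a' ≠ a) (i j : ℕ) (v : β) :
    assign m a i j v a' = m a' := by
  funext i' j'
  simp [assign, h]

lemma upd_self {β : Type} (f : ℕ → ℕ → β) (i j : ℕ) (v : β) : upd f i j v i j = v := by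
  simp [upd]

/-- The rule for loop invariants. The bound is an expression re-evaluated at every test, so `hB`
asks that the invariant fixes its value. The invariant at `i + 1` is required after the counter has
been increased. -/
lemma Does.forTo {c : ℕ} {B : NatExp} {p : Program} (N : ℕ) (Inv : ℕ → Store → Prop)
    (T : ℕ → ℕ) {s₀ : Store} (h₀ : Inv 0 (s₀.setVar c 0))
    (hB : ∀ i s, s.nats c 0 0 = i → Inv i s → B.eval s = N)
    (hstep : ∀ i < N, ∀ s, s.nats c 0 0 = i → Inv i s →
      Does p s (T i) fun s' => s'.nats c 0 0 = i ∧ Inv (i + 1) (s'.setVar c (i + 1))) :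
    Does (forTo c B p) s₀ (∑ i ∈ Finset.range N, T i + (N + 1) * (B.cost + 18)) (Inv N) := by
  -- Each round adds `B.cost + 6` steps for the test and 8 for the increment; the 4 steps that
  -- initialize the counter are absorbed by replacing 14 with 18.
  have main : ∀ d i s, i + d = N → s.nats c 0 0 = i → Inv i s →
      Does (.loop (.natLe (.add (nvar c) (.const 1)) B)
        (.seq p (.setNat c (.const 0) (.const 0) (.add (nvar c) (.const 1))))) s
        (∑ i ∈ Finset.Ico i N, T i + (d + 1) * (B.cost + 14)) (Inv N) := by
    intro d
    induction d with
    | zero =>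
      intro i s hi hc hI
      have hi' : i = N := by omega
      refine ⟨s, _, fun ω => .loopDone ?_, ?_, by rw [← hi']; exact hI⟩
      · simp only [Test.Holds, NatExp.eval, hB i s hc hI, hc]
        omega
      · simp [Test.cost, NatExp.cost]; omega
    | succ d ih =>
      intro i s hi hc hI
      obtain ⟨s', t, hr, ht, hc', hI'⟩ := hstep i (by omega) s hc hI
      obtain ⟨s'', t', hr', ht', hI''⟩ := ih (i + 1) (s'.setVar c (i + 1)) (by omega)
        (by simp [Store.setVar, assign]) hI'
      have hset : ∀ ω, Runs ω (.setNat c (.const 0) (.const 0) (.add (nvar c) (.const 1))) s'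
          (s'.setVar c (i + 1)) 8 := by
        intro ω
        have := Runs.setNat (ω := ω) c (.const 0) (.const 0) (.add (nvar c) (.const 1)) s'
        simp only [NatExp.eval, hc', NatExp.cost] at this
        exact this
      refine ⟨s'', _, fun ω => .loopStep ?_ (.seq (hr ω) (hset ω)) (hr' ω), ?_, hI''⟩
      · simp only [Test.Holds, NatExp.eval, hB i s hc hI, hc]
        omega
      · rw [Finset.sum_eq_sum_Ico_succ_bot (by omega : i < N)]
        simp only [Test.cost, NatExp.cost]
        have : (d + 1 + 1) * (B.cost + 14) = (d + 1) * (B.cost + 14) + (B.cost + 14) := by ring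
        omega
  obtain ⟨s', t, hr, ht, hI⟩ := main N 0 (s₀.setVar c 0) (by omega)
    (by simp [Store.setVar, assign]) h₀
  refine ⟨s', 4 + t, fun ω => .seq ?_ (hr ω), ?_, hI⟩
  · exact Runs.setNat (ω := ω) c (.const 0) (.const 0) (.const 0) s₀
  · rw [Finset.range_eq_Ico]
    have : (N + 1) * (B.cost + 18) = (N + 1) * (B.cost + 14) + (N + 1) * 4 := by ring
    omega

/-! ### Frame conditions: which arrays a program can change. -/

/-- The memories `s` and `s'` differ at most in the arrays `N` of natural numbers and the arrays
`R` of real numbers. -/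
structure Frame (N R : List ℕ) (s s' : Store) : Prop where
  nats : ∀ a, a ∉ N → s'.nats a = s.nats a
  reals : ∀ a, a ∉ R → s'.reals a = s.reals a

lemma Frame.refl (N R : List ℕ) (s : Store) : Frame N R s s := ⟨fun _ _ => rfl, fun _ _ => rfl⟩

lemma Frame.trans {N R : List ℕ} {s s' s'' : Store} (h : Frame N R s s') (h' : Frame N R s' s'') :
    Frame N R s s'' :=
  ⟨fun a ha => (h'.nats a ha).trans (h.nats a ha), fun a ha => (h'.reals a ha).trans (h.reals a ha)⟩

lemma Frame.mono {N R N' R' : List ℕ} {s s' : Store} (h : Frame N R s s')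
    (hN : N ⊆ N') (hR : R ⊆ R') : Frame N' R' s s' :=
  ⟨fun a ha => h.nats a fun h => ha (hN h), fun a ha => h.reals a fun h => ha (hR h)⟩

lemma Frame.setVar {N R : List ℕ} {s s' : Store} (h : Frame N R s s') {c : ℕ} (hc : c ∈ N)
    (i : ℕ) : Frame N R s (s'.setVar c i) := by
  refine ⟨fun a ha => ?_, h.reals⟩
  have : a ≠ c := fun h => ha (h ▸ hc)
  rw [← h.nats a ha]
  exact assign_ne _ this _ _ _

/-- The arrays assigned to by a program. -/
def Program.natArrays : Program → List ℕ
  | .setNat a .. => [a]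
  | .seq p q => p.natArrays ++ q.natArrays
  | .ite _ p q => p.natArrays ++ q.natArrays
  | _ => []

/-- The arrays of real numbers assigned to by a program. -/
def Program.realArrays : Program → List ℕ
  | .setReal a .. => [a]
  | .seq p q => p.realArrays ++ q.realArrays
  | .ite _ p q => p.realArrays ++ q.realArrays
  | _ => []

/-- No hypothesis on the program is needed: `exec` ignores loops and draws, just as the syntactic
lists of assigned arrays do. -/
lemma Program.frame_exec (p : Program) (s : Store) :
    Frame p.natArrays p.realArrays s (p.exec s) := by
  induction p generalizing s with
  | skip => exact .refl _ _ _
  | setNat a i j e =>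
    refine ⟨fun b hb => ?_, fun b _ => rfl⟩
    simp only [natArrays, List.mem_singleton] at hb
    simp [exec, assign_ne _ hb]
  | setReal a i j e =>
    refine ⟨fun b _ => rfl, fun b hb => ?_⟩
    simp only [realArrays, List.mem_singleton] at hb
    simp [exec, assign_ne _ hb]
  | draw a i j => exact .refl _ _ _
  | seq p q ihp ihq =>
    exact ((ihp s).mono (List.subset_append_left _ _) (List.subset_append_left _ _)).trans
      ((ihq _).mono (List.subset_append_right _ _) (List.subset_append_right _ _))
  | ite b p q ihp ihq =>
    rw [exec]
    split_ifs
    · exact (ihp s).mono (List.subset_append_left _ _) (List.subset_append_left _ _)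
    · exact (ihq s).mono (List.subset_append_right _ _) (List.subset_append_right _ _)
  | loop b p => exact .refl _ _ _

lemma Frame.exec {N R : List ℕ} {s s' : Store} (h : Frame N R s s') (p : Program)
    (hN : p.natArrays ⊆ N) (hR : p.realArrays ⊆ R) : Frame N R s (p.exec s') :=
  h.trans ((p.frame_exec s').mono hN hR)

@[simp] lemma Store.setVar_reals (s : Store) (c i : ℕ) : (s.setVar c i).reals = s.reals := rfl

@[simp] lemma Store.setVar_nats (s : Store) (c i a : ℕ) (h : a ≠ c) :
    (s.setVar c i).nats a = s.nats a := by
  exact assign_ne _ h _ _ _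

/-! ### Sparse multilinear polynomials -/

/-- A multilinear polynomial with `T` terms of degree at most `k` in the variables `0, …, m - 1`:
the term `t` has the coefficient `a t` and the variables `var t 0 < var t 1 < ⋯` up to
`var t (w t - 1)`. -/
structure Terms where
  m : ℕ
  k : ℕ
  T : ℕ
  w : ℕ → ℕ
  var : ℕ → ℕ → ℕ
  a : ℕ → ℝ
  w_le : ∀ t < T, w t ≤ k
  var_mono : ∀ t < T, ∀ j j', j < j' → j' < w t → var t j < var t j'
  var_lt : ∀ t < T, ∀ j < w t, var t j < m
  supp_inj : ∀ t < T, ∀ t' < T,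
    (Finset.range (w t)).image (var t) = (Finset.range (w t')).image (var t') → t = t'

namespace Terms

variable (I : Terms)

/-- The set of variables of a term. -/
def supp (t : ℕ) : Finset ℕ := (Finset.range (I.w t)).image (I.var t)

/-- The sum of the squares of the coefficients of the terms containing a variable. -/
def infl (v : ℕ) : ℝ := ∑ t ∈ Finset.range I.T, if v ∈ I.supp t then I.a t ^ 2 else 0

/-- The partial derivative with respect to a variable. -/
def deriv (v : ℕ) (x : ℕ → ℝ) : ℝ :=
  ∑ t ∈ Finset.range I.T, if v ∈ I.supp t then I.a t * ∏ u ∈ (I.supp t).erase v, x u else 0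

/-- The value of the polynomial without its constant term. -/
def value (x : ℕ → ℝ) : ℝ :=
  ∑ t ∈ Finset.range I.T, if I.w t ≠ 0 then I.a t * ∏ u ∈ I.supp t, x u else 0

/-- The coefficients of the partial derivatives. -/
def coef (v : ℕ) (Q : Finset ℕ) : ℝ :=
  ∑ t ∈ Finset.range I.T, if v ∈ I.supp t ∧ (I.supp t).erase v = Q then I.a t else 0

variable {I}

lemma supp_subset {t : ℕ} (ht : t < I.T) : I.supp t ⊆ Finset.range I.m := by
  intro v hv
  obtain ⟨j, hj, rfl⟩ := Finset.mem_image.1 hv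
  exact Finset.mem_range.2 (I.var_lt t ht j (Finset.mem_range.1 hj))

lemma var_injOn {t : ℕ} (ht : t < I.T) : Set.InjOn (I.var t) (Finset.range (I.w t)) := by
  intro i hi j hj hij
  simp only [Finset.coe_range, Set.mem_Iio] at hi hj
  rcases lt_trichotomy i j with h | h | h
  · exact absurd hij (I.var_mono t ht i j h hj).ne
  · exact h
  · exact absurd hij (I.var_mono t ht j i h hi).ne'

lemma card_supp {t : ℕ} (ht : t < I.T) : (I.supp t).card = I.w t := by
  rw [supp, Finset.card_image_of_injOn (var_injOn ht), Finset.card_range]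

lemma prod_supp {t : ℕ} (ht : t < I.T) (x : ℕ → ℝ) :
    ∏ u ∈ I.supp t, x u = ∏ j ∈ Finset.range (I.w t), x (I.var t j) := by
  rw [supp, Finset.prod_image (var_injOn ht)]

lemma var_mem_supp {t j : ℕ} (hj : j < I.w t) : I.var t j ∈ I.supp t :=
  Finset.mem_image_of_mem _ (Finset.mem_range.2 hj)

lemma infl_nonneg (v : ℕ) : 0 ≤ I.infl v :=
  Finset.sum_nonneg fun t _ => by split_ifs <;> positivity

end Terms

/-! ### Substitution of signs into the derivatives -/

/-- The weighted sum of squares of the coefficients of a multilinear polynomial. -/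
def wnorm (θ : ℝ) (m : ℕ) (c : Finset ℕ → ℝ) : ℝ :=
  ∑ Q ∈ (Finset.range m).powerset, θ ^ Q.card * c Q ^ 2

/-- The weighted inner product of the two parts of a multilinear polynomial which contain a
variable and which do not. -/
def cross (θ : ℝ) (m u : ℕ) (c : Finset ℕ → ℝ) : ℝ :=
  ∑ Q ∈ ((Finset.range m).erase u).powerset, θ ^ Q.card * (c Q * c (insert u Q))

/-- The coefficients after the substitution of `y` for the variable `u`. -/
def subst (u : ℕ) (y : ℝ) (c : Finset ℕ → ℝ) : Finset ℕ → ℝ :=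
  fun Q => if u ∈ Q then 0 else c Q + y * c (insert u Q)

lemma sum_powerset_range {m u : ℕ} (hu : u < m) (F : Finset ℕ → ℝ) :
    ∑ Q ∈ (Finset.range m).powerset, F Q =
      ∑ Q ∈ ((Finset.range m).erase u).powerset, (F Q + F (insert u Q)) := by
  conv_lhs => rw [← Finset.insert_erase (Finset.mem_range.2 hu)]
  rw [Finset.sum_powerset_insert (Finset.notMem_erase _ _), Finset.sum_add_distrib]

lemma notMem_of_mem_powerset_erase {m u : ℕ} {Q : Finset ℕ}
    (hQ : Q ∈ ((Finset.range m).erase u).powerset) : u ∉ Q := fun h =>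
  Finset.notMem_erase u _ (Finset.mem_powerset.1 hQ h)

lemma wnorm_nonneg {θ : ℝ} (hθ : 0 ≤ θ) (m : ℕ) (c : Finset ℕ → ℝ) : 0 ≤ wnorm θ m c :=
  Finset.sum_nonneg fun _ _ => by positivity

lemma wnorm_subst {m u : ℕ} (hu : u < m) (θ y : ℝ) (c : Finset ℕ → ℝ) :
    wnorm θ m (subst u y c) = ∑ Q ∈ ((Finset.range m).erase u).powerset, θ ^ Q.card * c Q ^ 2
      + y ^ 2 * (∑ Q ∈ ((Finset.range m).erase u).powerset, θ ^ Q.card * c (insert u Q) ^ 2)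
      + 2 * y * cross θ m u c := by
  rw [wnorm, sum_powerset_range hu, cross, Finset.mul_sum, Finset.mul_sum,
    ← Finset.sum_add_distrib, ← Finset.sum_add_distrib]
  refine Finset.sum_congr rfl fun Q hQ => ?_
  simp only [subst, notMem_of_mem_powerset_erase hQ, Finset.mem_insert_self, if_true, if_false]
  ring

lemma wnorm_eq {m u : ℕ} (hu : u < m) (θ : ℝ) (c : Finset ℕ → ℝ) :
    wnorm θ m c = ∑ Q ∈ ((Finset.range m).erase u).powerset, θ ^ Q.card * c Q ^ 2
      + θ * ∑ Q ∈ ((Finset.range m).erase u).powerset, θ ^ Q.card * c (insert u Q) ^ 2 := by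
  rw [wnorm, sum_powerset_range hu, Finset.mul_sum, ← Finset.sum_add_distrib]
  refine Finset.sum_congr rfl fun Q hQ => ?_
  rw [Finset.card_insert_of_notMem (notMem_of_mem_powerset_erase hQ)]
  ring

lemma cross_sq_le {θ : ℝ} (hθ : 0 ≤ θ) (m u : ℕ) (c : Finset ℕ → ℝ) :
    cross θ m u c ^ 2 ≤ (∑ Q ∈ ((Finset.range m).erase u).powerset, θ ^ Q.card * c Q ^ 2) *
      ∑ Q ∈ ((Finset.range m).erase u).powerset, θ ^ Q.card * c (insert u Q) ^ 2 := by
  refine Finset.sum_sq_le_sum_mul_sum_of_sq_le_mul _ (fun _ _ => by positivity)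
    (fun _ _ => by positivity) fun Q _ => le_of_eq (by ring)

/-- The fourth-moment bound behind the two-point inequality of Bonami. -/
lemma sq_wnorm_subst_le {m u : ℕ} (hu : u < m) (y : ℝ) (c : Finset ℕ → ℝ) :
    wnorm (5 * y ^ 2) m (subst u y c) ^ 2 ≤ wnorm (5 * y ^ 2) m c ^ 2
      + 4 * y * cross (5 * y ^ 2) m u c * wnorm (5 * y ^ 2) m c := by
  have hC := cross_sq_le (θ := 5 * y ^ 2) (by positivity) m u c
  rw [wnorm_subst hu, wnorm_eq hu]
  set A := ∑ Q ∈ ((Finset.range m).erase u).powerset, (5 * y ^ 2) ^ Q.card * c Q ^ 2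
  set B := ∑ Q ∈ ((Finset.range m).erase u).powerset, (5 * y ^ 2) ^ Q.card * c (insert u Q) ^ 2
  set C := cross (5 * y ^ 2) m u c
  have hA : 0 ≤ A := Finset.sum_nonneg fun _ _ => by positivity
  have hB : 0 ≤ B := Finset.sum_nonneg fun _ _ => by positivity
  have hy : 0 ≤ y ^ 2 := sq_nonneg y
  -- By `cross_sq_le`, 16 y² C² ≤ 16 y² A B, which is at most (A + 4 y² B)².
  have h1 : |-(4 * y * C)| ≤ A + 4 * y ^ 2 * B := by
    apply abs_le_of_sq_le_sq _ (by positivity)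
    nlinarith [sq_nonneg (A - 4 * y ^ 2 * B), mul_le_mul_of_nonneg_left hC hy]
  have h2 : -(4 * y * C) ≤ A + 4 * y ^ 2 * B := (le_abs_self _).trans h1
  have h3 := mul_le_mul_of_nonneg_left h2 (mul_nonneg hy hB)
  have h4 := mul_le_mul_of_nonneg_left hC hy
  have h5 : 0 ≤ (y ^ 2 * B) ^ 2 := sq_nonneg _
  -- Expanded, the claim is 4y²C² ≤ 8y²AB + 24y⁴B² + 16y³BC. The left side is at most 4y²AB by `h4`,
  -- and `h3` controls the last term. The constant 3 in place of 5 suffices on average over the sign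
  -- of y; 5 gives the inequality for each sign, with an error linear in `cross`.
  nlinarith

/-! ### Choosing signs by the method of conditional expectations. -/

/-- A lower bound for the sum of the absolute values of polynomials with the coefficients `c v`,
averaged over random signs. -/
def potential (h : ℕ → ℝ) (β θ : ℝ) (m : ℕ) (c : ℕ → Finset ℕ → ℝ) : ℝ :=
  ∑ v ∈ Finset.range m,
    (h v * wnorm θ m (c v) - β * h v ^ 3 * wnorm (5 * θ) m (c v) ^ 2)

/-- The gain in the potential by a positive value of the variable `u`. -/
def gain (h : ℕ → ℝ) (β θ : ℝ) (m u : ℕ) (c : ℕ → Finset ℕ → ℝ) : ℝ :=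
  ∑ v ∈ Finset.range m, (h v * cross θ m u (c v)
    - 2 * β * h v ^ 3 * wnorm (5 * θ) m (c v) * cross (5 * θ) m u (c v))

/-- The substitution raises the potential by at least 2y times `gain`: the second moments change by
exactly a linear term, and the fourth-moment bounds grow by at most one. Thus the sign of the gain
is a safe choice for the sign of y. -/
lemma potential_le_subst {h : ℕ → ℝ} (hh : ∀ v, 0 ≤ h v) {β : ℝ} (hβ : 0 ≤ β) {m u : ℕ}
    (hu : u < m) {y : ℝ} (c : ℕ → Finset ℕ → ℝ) (hy : 0 ≤ y * gain h β (y ^ 2) m u c) :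
    potential h β (y ^ 2) m c ≤ potential h β (y ^ 2) m fun v => subst u y (c v) := by
  have key : potential h β (y ^ 2) m c + 2 * (y * gain h β (y ^ 2) m u c) ≤
      potential h β (y ^ 2) m fun v => subst u y (c v) := by
    rw [potential, potential, gain, Finset.mul_sum, Finset.mul_sum, ← Finset.sum_add_distrib]
    refine Finset.sum_le_sum fun v _ => ?_
    have h1 := sq_wnorm_subst_le hu y (c v)
    -- This is an equality because the weight θ is y²: the square of the substituted value replaces
    -- the weight of the variable.
    have h2 : wnorm (y ^ 2) m (subst u y (c v)) =
        wnorm (y ^ 2) m (c v) + 2 * y * cross (y ^ 2) m u (c v) := by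
      rw [wnorm_subst hu, wnorm_eq hu]
    have h3 := mul_le_mul_of_nonneg_left h1 (mul_nonneg hβ (pow_nonneg (hh v) 3))
    rw [h2]
    nlinarith
  linarith

lemma sum_mul_prod_subst {m u : ℕ} (hu : u < m) (c : Finset ℕ → ℝ) (x : ℕ → ℝ) :
    ∑ Q ∈ (Finset.range m).powerset, subst u (x u) c Q * ∏ i ∈ Q, x i =
      ∑ Q ∈ (Finset.range m).powerset, c Q * ∏ i ∈ Q, x i := by
  rw [sum_powerset_range hu, sum_powerset_range hu]
  refine Finset.sum_congr rfl fun Q hQ => ?_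
  have hn := notMem_of_mem_powerset_erase hQ
  simp only [subst, hn, Finset.mem_insert_self, if_true, if_false, Finset.prod_insert hn]
  ring

/-- The coefficients `c` of the derivatives after a successful choice `y` of the variables
below `u`. -/
structure Stage (I : Terms) (h : ℕ → ℝ) (β : ℝ) (u : ℕ) (y : ℕ → ℝ) (c : ℕ → Finset ℕ → ℝ) :
    Prop where
  le_potential : potential h β (1 / 16) I.m I.coef ≤ potential h β (1 / 16) I.m c
  sum_eq : ∀ v x, (∀ i < u, x i = y i) →
    ∑ Q ∈ (Finset.range I.m).powerset, c v Q * ∏ i ∈ Q, x i = I.deriv v x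
  support : ∀ v Q, c v Q ≠ 0 →
    ∃ t < I.T, v ∈ I.supp t ∧ Q = ((I.supp t).erase v).filter (u ≤ ·)
  abs_eq : ∀ i < u, |y i| = 1 / 4

lemma Stage.zero (I : Terms) (h : ℕ → ℝ) (β : ℝ) (y : ℕ → ℝ) : Stage I h β 0 y I.coef where
  le_potential := le_rfl
  sum_eq v x _ := by
    simp only [Terms.coef, Terms.deriv, Finset.sum_mul]
    rw [Finset.sum_comm]
    refine Finset.sum_congr rfl fun t ht => ?_
    have ht' := Finset.mem_range.1 ht
    by_cases hv : v ∈ I.supp t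
    · simp only [hv, true_and, ite_mul, zero_mul, if_true]
      rw [Finset.sum_ite_eq, if_pos]
      exact Finset.mem_powerset.2 ((Finset.erase_subset _ _).trans (Terms.supp_subset ht'))
    · simp [hv]
  support v Q hQ := by
    obtain ⟨t, ht, hne⟩ := Finset.exists_ne_zero_of_sum_ne_zero hQ
    obtain ⟨h1, -⟩ := ite_ne_right_iff.1 hne
    exact ⟨t, Finset.mem_range.1 ht, h1.1, by simp [h1.2]⟩
  abs_eq := by simp

/-- A monomial surviving the substitution comes from itself or from itself with `u` adjoined. In
both cases it is again a tail of a term without `v`, so the nonzero entries stay among those that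
can be scheduled in advance. -/
lemma Stage.step {I : Terms} {h : ℕ → ℝ} (hh : ∀ v, 0 ≤ h v) {β : ℝ} (hβ : 0 ≤ β) {u : ℕ}
    (hu : u < I.m) {y : ℕ → ℝ} {c : ℕ → Finset ℕ → ℝ} (hs : Stage I h β u y c) {r : ℝ}
    (hr : r = if 0 ≤ gain h β (1 / 16) I.m u c then 1 / 4 else -1 / 4) :
    Stage I h β (u + 1) (Function.update y u r) fun v => subst u r (c v) where
  le_potential := by
    refine hs.le_potential.trans ?_
    -- Both admissible values ±1/4 have the square 1/16 used as the weight.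
    have hr2 : (1 / 16 : ℝ) = r ^ 2 := by
      rw [hr]; split_ifs <;> norm_num
    rw [hr2]
    refine potential_le_subst hh hβ hu c ?_
    rw [← hr2, hr]
    split_ifs with h0
    · positivity
    · nlinarith
  sum_eq v x hx := by
    have hxu : x u = r := by simp [hx u (by omega)]
    rw [← hs.sum_eq v x fun i hi => ?_]
    · rw [← hxu]; exact sum_mul_prod_subst hu (c v) x
    · rw [hx i (by omega), Function.update_of_ne (by omega)]
  support v Q hQ := by
    have huQ : u ∉ Q := fun hm => hQ (by simp [subst, hm])
    have hor : c v Q ≠ 0 ∨ c v (insert u Q) ≠ 0 := by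
      by_contra hcon
      push Not at hcon
      exact hQ (by simp [subst, hcon.1, hcon.2])
    rcases hor with hc | hc
    · obtain ⟨t, ht, hv, rfl⟩ := hs.support v Q hc
      refine ⟨t, ht, hv, ?_⟩
      ext i
      simp only [Finset.mem_filter, Finset.mem_erase] at huQ ⊢
      constructor
      · rintro ⟨hi, hui⟩
        refine ⟨hi, lt_of_le_of_ne hui ?_⟩
        rintro rfl
        exact huQ ⟨hi, le_rfl⟩
      · rintro ⟨hi, hui⟩
        exact ⟨hi, by omega⟩
    · obtain ⟨t, ht, hv, he⟩ := hs.support v _ hc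
      refine ⟨t, ht, hv, ?_⟩
      ext i
      have hi := congrArg (i ∈ ·) he
      simp only [Finset.mem_insert, Finset.mem_filter, eq_iff_iff] at hi ⊢
      constructor
      · intro hiQ
        obtain ⟨h1, h2⟩ := hi.1 (Or.inr hiQ)
        refine ⟨h1, lt_of_le_of_ne h2 ?_⟩
        rintro rfl
        exact huQ hiQ
      · rintro ⟨h1, h2⟩
        rcases hi.2 ⟨h1, by omega⟩ with h3 | h3
        · omega
        · exact h3
  abs_eq i hi := by
    by_cases hiu : i = u
    · subst hiu
      rw [Function.update_self, hr]
      split_ifs <;> norm_num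
    · rw [Function.update_of_ne hiu]
      exact hs.abs_eq i (by omega)

/-- Different terms have different supports, so each coefficient of a derivative comes from one term
only and its square has no mixed products. -/
lemma wnorm_coef (I : Terms) (θ : ℝ) (v : ℕ) :
    wnorm θ I.m (I.coef v) = ∑ t ∈ Finset.range I.T,
      if v ∈ I.supp t then θ ^ ((I.supp t).erase v).card * I.a t ^ 2 else 0 := by
  have hsq : ∀ Q, I.coef v Q ^ 2 = ∑ t ∈ Finset.range I.T,
      if v ∈ I.supp t ∧ (I.supp t).erase v = Q then I.a t ^ 2 else 0 := by
    intro Q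
    rw [Terms.coef, sq, Finset.sum_mul_sum]
    refine Finset.sum_congr rfl fun t ht => ?_
    rw [Finset.sum_eq_single_of_mem t ht]
    · split_ifs <;> ring
    · intro t' ht' hne
      by_cases h1 : v ∈ I.supp t ∧ (I.supp t).erase v = Q
      · by_cases h2 : v ∈ I.supp t' ∧ (I.supp t').erase v = Q
        · refine absurd (I.supp_inj t' (Finset.mem_range.1 ht') t (Finset.mem_range.1 ht) ?_) hne
          change I.supp t' = I.supp t
          rw [← Finset.insert_erase h1.1, ← Finset.insert_erase h2.1, h1.2, h2.2]
        · simp [h2]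
      · simp [h1]
  simp only [wnorm, hsq, Finset.mul_sum]
  rw [Finset.sum_comm]
  refine Finset.sum_congr rfl fun t ht => ?_
  by_cases hv : v ∈ I.supp t
  · simp only [hv, true_and, mul_ite, mul_zero, if_true]
    rw [Finset.sum_ite_eq, if_pos]
    exact Finset.mem_powerset.2
      ((Finset.erase_subset _ _).trans (Terms.supp_subset (Finset.mem_range.1 ht)))
  · simp [hv]

/-- Let q = √Inf_v. The monomials of the derivative have degree at most k - 1, so its second moment
is at least 16βq² with β = 16^(-k); as 5/16 ≤ 1, the fourth-moment bound is at most q⁴. After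
multiplication by h = 1/q and βh³ this leaves at least 16βq - βq ≥ βq. -/
lemma le_potential_coef (I : Terms) :
    (1 / 16) ^ I.k * ∑ v ∈ Finset.range I.m, √(I.infl v) ≤
      potential (fun v => 1 / √(I.infl v)) ((1 / 16) ^ I.k) (1 / 16) I.m I.coef := by
  rw [potential, Finset.mul_sum]
  refine Finset.sum_le_sum fun v _ => ?_
  have hN : 16 * (1 / 16) ^ I.k * I.infl v ≤ wnorm (1 / 16) I.m (I.coef v) := by
    rw [wnorm_coef, Terms.infl, Finset.mul_sum]
    refine Finset.sum_le_sum fun t ht => ?_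
    by_cases hv : v ∈ I.supp t
    · simp only [hv, if_true]
      have hcard : ((I.supp t).erase v).card + 1 ≤ I.k := by
        rw [Finset.card_erase_add_one hv, Terms.card_supp (Finset.mem_range.1 ht)]
        exact I.w_le t (Finset.mem_range.1 ht)
      have := pow_le_pow_of_le_one (a := (1 / 16 : ℝ)) (by norm_num) (by norm_num) hcard
      rw [pow_succ] at this
      exact mul_le_mul_of_nonneg_right (by linarith) (sq_nonneg _)
    · simp [hv]
  have hM : wnorm (5 * (1 / 16)) I.m (I.coef v) ≤ I.infl v := by
    rw [wnorm_coef, Terms.infl]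
    refine Finset.sum_le_sum fun t ht => ?_
    by_cases hv : v ∈ I.supp t
    · simp only [hv, if_true]
      exact mul_le_of_le_one_left (sq_nonneg _) (pow_le_one₀ (by norm_num) (by norm_num))
    · simp [hv]
  have hM0 : 0 ≤ wnorm (5 * (1 / 16)) I.m (I.coef v) := wnorm_nonneg (by norm_num) _ _
  have hq := Real.sq_sqrt (Terms.infl_nonneg (I := I) v)
  have hq0 := Real.sqrt_nonneg (I.infl v)
  set q := √(I.infl v)
  rcases hq0.eq_or_lt with h0 | hpos
  -- A vanishing influence makes `1 / √(I.infl v)` zero by convention, and both sides vanish.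
  · rw [← h0]; simp
  · rw [← hq] at hN hM
    have hM2 : wnorm (5 * (1 / 16)) I.m (I.coef v) ^ 2 ≤ (q ^ 2) ^ 2 := pow_le_pow_left₀ hM0 hM 2
    set N := wnorm (1 / 16) I.m (I.coef v)
    set M := wnorm (5 * (1 / 16)) I.m (I.coef v)
    have hβ : (0 : ℝ) < (1 / 16) ^ I.k := by positivity
    set β : ℝ := (1 / 16) ^ I.k
    have e1 : 16 * β * q ≤ 1 / q * N := by
      rw [one_div, inv_mul_eq_div, le_div_iff₀ hpos]
      linarith
    have e2 : β * (1 / q) ^ 3 * M ^ 2 ≤ β * q := by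
      calc β * (1 / q) ^ 3 * M ^ 2 ≤ β * (1 / q) ^ 3 * (q ^ 2) ^ 2 :=
            mul_le_mul_of_nonneg_left hM2 (by positivity)
        _ = β * q := by field_simp
    nlinarith [mul_pos hβ hpos]

lemma wnorm_of_forall_ne_empty {θ : ℝ} {m : ℕ} {c : Finset ℕ → ℝ} (hc : ∀ Q, Q ≠ ∅ → c Q = 0) :
    wnorm θ m c = c ∅ ^ 2 := by
  rw [wnorm, Finset.sum_eq_single_of_mem ∅ (Finset.empty_mem_powerset _)]
  · simp
  · intro Q _ hQ
    simp [hc Q hQ]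

/-- When all variables are substituted only the constant monomials are left, and both norms of row v
equal the squared derivative g². The potential is then the sum of h g² - β h³ g⁴, and β times such a
summand is at most |g|. One factor β is lost here and one in `le_potential_coef`, whence the
exponent 2k. -/
theorem Stage.sum_abs_deriv {I : Terms} {y : ℕ → ℝ} {c : ℕ → Finset ℕ → ℝ}
    (hs : Stage I (fun v => 1 / √(I.infl v)) ((1 / 16) ^ I.k) I.m y c) :
    (∀ v, c v ∅ = I.deriv v y) ∧ (1 / 16) ^ (2 * I.k) * ∑ v ∈ Finset.range I.m, √(I.infl v) ≤
      ∑ v ∈ Finset.range I.m, |I.deriv v y| := by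
  have hz : ∀ v Q, Q ≠ ∅ → c v Q = 0 := by
    intro v Q hQ
    by_contra hne
    obtain ⟨t, ht, hv, rfl⟩ := hs.support v Q hne
    refine hQ (Finset.filter_eq_empty_iff.2 fun i hi => ?_)
    have := Finset.mem_range.1 (Terms.supp_subset ht (Finset.mem_of_mem_erase hi))
    omega
  have hG : ∀ v, c v ∅ = I.deriv v y := by
    intro v
    rw [← hs.sum_eq v y fun _ _ => rfl,
      Finset.sum_eq_single_of_mem ∅ (Finset.empty_mem_powerset _)]
    · simp
    · intro Q _ hQ
      simp [hz v Q hQ]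
  refine ⟨hG, ?_⟩
  have hβ : (0 : ℝ) < (1 / 16) ^ I.k := by positivity
  have hβ1 : ((1 : ℝ) / 16) ^ I.k ≤ 1 := pow_le_one₀ (by norm_num) (by norm_num)
  have h1 := (le_potential_coef I).trans hs.le_potential
  rw [two_mul, pow_add, mul_assoc]
  refine (mul_le_mul_of_nonneg_left h1 hβ.le).trans ?_
  rw [potential, Finset.mul_sum]
  refine Finset.sum_le_sum fun v _ => ?_
  rw [wnorm_of_forall_ne_empty (hz v), wnorm_of_forall_ne_empty (hz v), hG]
  generalize I.deriv v y = G
  have hh : 0 ≤ 1 / √(I.infl v) := by positivity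
  generalize 1 / √(I.infl v) = h at hh
  generalize ((1 : ℝ) / 16) ^ I.k = β at hβ hβ1
  rw [← sq_abs G]
  have hg := abs_nonneg G
  generalize |G| = g at hg
  have hs : 0 ≤ h * g := mul_nonneg hh hg
  -- Put s = h g. If βs ≤ 1 the cubic term can be dropped. Otherwise s > 1 because β ≤ 1, so βs² ≥ 1
  -- and the bracket is not positive.
  have : β * (h * g - β * (h * g) ^ 3) ≤ 1 := by
    by_cases h2 : β * (h * g) ≤ 1
    · nlinarith [pow_nonneg hs 3, mul_nonneg (mul_nonneg hβ.le hβ.le) (pow_nonneg hs 3)]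
    · push Not at h2
      have h3 : 1 ≤ β * (h * g) ^ 2 := by nlinarith
      have h4 : h * g ≤ β * (h * g) ^ 3 := by nlinarith
      nlinarith
  calc β * (h * g ^ 2 - β * h ^ 3 * (g ^ 2) ^ 2) = g * (β * (h * g - β * (h * g) ^ 3)) := by ring
    _ ≤ g * 1 := mul_le_mul_of_nonneg_left this hg
    _ = g := mul_one g

/-! ### Values of a polynomial on a segment -/

open Polynomial in
-- By Lagrange interpolation the linear coefficient is a fixed linear functional of the values at
-- the k + 1 nodes e/k, so it is small if all these values are.
lemma exists_abs_coeff_one_le (k : ℕ) : ∃ c : ℝ, 0 < c ∧ ∀ p : ℝ[X], p.natDegree ≤ k →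
    ∃ e ≤ k, c * |p.coeff 1| ≤ |p.eval ((e : ℝ) / k)| := by
  rcases Nat.eq_zero_or_pos k with rfl | hk
  · refine ⟨1, one_pos, fun p hp => ⟨0, le_rfl, ?_⟩⟩
    rw [coeff_eq_zero_of_natDegree_lt (by omega)]
    simp
  let v : ℕ → ℝ := fun e => (e : ℝ) / k
  have hk' : (k : ℝ) ≠ 0 := by positivity
  have hv : Set.InjOn v (Finset.range (k + 1)) := by
    intro i _ j _ hij
    have := (div_left_inj' hk').1 hij
    exact_mod_cast this
  set B := ∑ e ∈ Finset.range (k + 1), |(Lagrange.basis (Finset.range (k + 1)) v e).coeff 1|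
    with hB
  have hB0 : 0 ≤ B := Finset.sum_nonneg fun _ _ => abs_nonneg _
  -- The summand 1 makes B/(1 + B) < 1, which contradicts a coefficient bounded by that fraction of
  -- itself.
  refine ⟨1 / (1 + B), by positivity, fun p hp => ?_⟩
  by_contra hcon
  push Not at hcon
  have hdeg : p.degree < (Finset.range (k + 1)).card := by
    rw [Finset.card_range]
    exact lt_of_le_of_lt (natDegree_le_iff_degree_le.1 hp) (by exact_mod_cast Nat.lt_succ_self k)
  have hL := congrArg (fun q => coeff q 1) (Lagrange.eq_interpolate hv hdeg)
  simp only [Lagrange.interpolate_apply, finsetSum_coeff, coeff_C_mul] at hL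
  have h1 : |p.coeff 1| ≤ 1 / (1 + B) * |p.coeff 1| * B := by
    conv_lhs => rw [hL]
    rw [hB, Finset.mul_sum]
    refine (Finset.abs_sum_le_sum_abs _ _).trans (Finset.sum_le_sum fun e he => ?_)
    rw [abs_mul]
    exact mul_le_mul_of_nonneg_right
      (hcon e (Nat.lt_succ_iff.1 (Finset.mem_range.1 he))).le (abs_nonneg _)
  have hpos : 0 < |p.coeff 1| := by
    have := (abs_nonneg _).trans_lt (hcon 0 (Nat.zero_le k))
    exact pos_of_mul_pos_right this (by positivity)
  have : 1 / (1 + B) * |p.coeff 1| * B = |p.coeff 1| * (B / (1 + B)) := by ring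
  rw [this] at h1
  have h2 : B / (1 + B) < 1 := (div_lt_one (by positivity)).2 (by linarith)
  nlinarith

namespace Terms

variable {I : Terms}

open Polynomial in
-- The polynomial restricted to a line; the product rule in each term identifies its linear
-- coefficient with the directional derivative.
lemma exists_polynomial_value (I : Terms) (y z : ℕ → ℝ) : ∃ p : ℝ[X], p.natDegree ≤ I.k ∧
    (∀ ε, p.eval ε = I.value fun v => y v + ε * z v) ∧
    p.coeff 1 = ∑ v ∈ Finset.range I.m, z v * I.deriv v y := by
  refine ⟨∑ t ∈ Finset.range I.T, if I.w t ≠ 0 then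
    C (I.a t) * ∏ u ∈ I.supp t, (C (y u) + X * C (z u)) else 0, ?_, fun ε => ?_, ?_⟩
  · refine natDegree_sum_le_of_forall_le _ _ fun t ht => ?_
    split_ifs
    · refine (natDegree_C_mul_le _ _).trans ((natDegree_prod_le _ _).trans ?_)
      have ht' := Finset.mem_range.1 ht
      refine le_trans ?_ (I.w_le t ht')
      rw [← card_supp ht', Finset.card_eq_sum_ones]
      refine Finset.sum_le_sum fun u _ => ?_
      compute_degree
    · simp
  · rw [eval_finsetSum, value]
    refine Finset.sum_congr rfl fun t _ => ?_
    split_ifs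
    · simp [eval_prod, -X_mul_C]
    · simp
  · have hprod : ∀ S : Finset ℕ, (∏ u ∈ S, (C (y u) + X * C (z u))).coeff 1 =
        ∑ v ∈ S, z v * ∏ u ∈ S.erase v, y u := by
      intro S
      have h1 := coeff_derivative (∏ u ∈ S, (C (y u) + X * C (z u))) 0
      rw [coeff_zero_eq_eval_zero, derivative_prod_finset] at h1
      simp only [eval_finsetSum, eval_mul, eval_prod] at h1
      simp [-X_mul_C] at h1
      rw [← h1]
      exact Finset.sum_congr rfl fun v _ => by ring
    simp only [finsetSum_coeff, deriv, Finset.mul_sum]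
    rw [Finset.sum_comm]
    refine Finset.sum_congr rfl fun t ht => ?_
    have ht' := Finset.mem_range.1 ht
    by_cases hw : I.w t = 0
    · have : I.supp t = ∅ := by simp [supp, hw]
      simp [hw, this]
    · rw [if_pos hw, coeff_C_mul, hprod, Finset.mul_sum]
      simp only [mul_ite, mul_zero]
      rw [← Finset.sum_filter, Finset.filter_mem_eq_inter,
        Finset.inter_eq_right.2 (supp_subset ht')]
      exact Finset.sum_congr rfl fun v _ => by ring

/-- The value of a term. -/
def term (I : Terms) (x : ℕ → ℝ) (t : ℕ) : ℝ := I.a t * ∏ u ∈ I.supp t, x u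

lemma term_update {t u : ℕ} {x : ℕ → ℝ} {φ : ℝ} :
    I.term (Function.update x u (φ * x u)) t =
      if u ∈ I.supp t then φ * I.term x t else I.term x t := by
  split_ifs with h
  · rw [term, term, ← Finset.mul_prod_erase _ _ h, ← Finset.mul_prod_erase _ x h,
      Function.update_self, Finset.prod_congr rfl fun v hv => Function.update_of_ne
        (Finset.ne_of_mem_erase hv) _ _]
    ring
  · rw [term, term, Finset.prod_congr rfl fun v (hv : v ∈ I.supp t) =>
      Function.update_of_ne (fun hvu : v = u => h (hvu ▸ hv)) _ _]

/-- Scaling one variable scales exactly the terms containing it. Rounding therefore needs only the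
sum of these terms in order to choose a sign. -/
lemma value_update {u : ℕ} {x : ℕ → ℝ} {φ : ℝ} :
    I.value (Function.update x u (φ * x u)) = I.value x +
      (φ - 1) * ∑ t ∈ Finset.range I.T, if u ∈ I.supp t then I.term x t else 0 := by
  rw [value, value, Finset.mul_sum, ← Finset.sum_add_distrib]
  refine Finset.sum_congr rfl fun t _ => ?_
  have h := term_update (I := I) (t := t) (u := u) (x := x) (φ := φ)
  rw [term] at h
  rw [h]
  by_cases hw : I.w t = 0
  · have : I.supp t = ∅ := by simp [supp, hw]
    simp [hw, this]
  · simp only [hw, ne_eq, not_false_eq_true, if_true]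
    split_ifs
    · rw [term]; ring
    · rw [term]; ring

end Terms

/-! ### The algorithm: reading the input -/

/-- Computes `3 * n` and the powers of two. -/
def progSize : Program :=
  .seq
    (.seq (.setNat 16 (.const 0) (.const 0) (.add (nvar 0) (.add (nvar 0) (nvar 0))))
      (.setNat 6 (.const 0) (.const 0) (.const 1)))
    (forTo 13 (nvar 16)
      (.setNat 6 (.add (nvar 13) (.const 1)) (.const 0)
        (.add (nvec 6 (nvar 13)) (nvec 6 (nvar 13)))))

/-- Computes the powers of `1 / 16` and `5 / 16`. -/
def progPowers : Program :=
  .seq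
    (.seq (.setReal 3 (.const 0) (.const 0) (.const 1))
      (.setReal 4 (.const 0) (.const 0) (.const 1)))
    (forTo 11 (.get 0 (.const 0) (.const 1))
      (.seq
        (.setReal 3 (.add (nvar 11) (.const 1)) (.const 0)
          (.mul (rvec 3 (nvar 11)) (.const (1 / 16))))
        (.setReal 4 (.add (nvar 11) (.const 1)) (.const 0)
          (.mul (rvec 4 (nvar 11)) (.const (5 / 16))))))

/-- Reads one factor of a term. -/
def progReadFactor : Program :=
  .seq (.setNat 22 (.const 0) (.const 0)
    (.sub (.add (.get 2 (nvar 10) (nvar 11)) (.add (.get 2 (nvar 10) (nvar 11))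
      (.add (.get 2 (nvar 10) (nvar 11)) (.get 3 (nvar 10) (nvar 11))))) (.const 1)))
  (.seq (.setNat 4 (nvar 10) (nvar 11) (nvar 22))
  (.seq (.setNat 5 (nvar 10) (.const 0) (.add (nvec 5 (nvar 10)) (nvec 6 (nvar 22))))
  (.seq (.setReal 2 (nvar 22) (.const 0)
    (.add (rvec 2 (nvar 22)) (.mul (rvec 0 (nvar 10)) (rvec 0 (nvar 10)))))
  (.seq (.setNat 19 (nvar 22) (nvec 20 (nvar 22)) (nvar 10))
  (.setNat 20 (nvar 22) (.const 0) (.add (nvec 20 (nvar 22)) (.const 1)))))))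

/-- Computes the variables, keys, influences and the lists of the terms containing a variable. -/
def progRead : Program :=
  forTo 10 (.get 0 (.const 0) (.const 2)) (forTo 11 (nvec 1 (nvar 10)) progReadFactor)

/-- The number by which a set of variables is represented. -/
def setKey (Q : Finset ℕ) : ℕ := ∑ i ∈ Q, 2 ^ i

/-- Uniqueness of binary expansions: a natural number can serve as the column of a monomial, and
adjoining or removing a variable is one addition or subtraction. -/
lemma setKey_injective : Function.Injective setKey := Finset.geomSum_injective le_rfl

/-- The memory contains the input. -/
structure HasInput (I : Terms) (s : Store) : Prop where
  size : 3 * s.nats 0 0 0 = I.m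
  k : s.nats 0 0 1 = I.k
  T : s.nats 0 0 2 = I.T
  w : ∀ t < I.T, s.nats 1 t 0 = I.w t
  a : ∀ t < I.T, s.reals 0 t 0 = I.a t
  var : ∀ t < I.T, ∀ j < I.w t,
    s.nats 2 t j + (s.nats 2 t j + (s.nats 2 t j + s.nats 3 t j)) - 1 = I.var t j

/-- The memory contains the polynomial and auxiliary tables. -/
structure Loaded (I : Terms) (s : Store) : Prop extends HasInput I s where
  m : s.nats 16 0 0 = I.m
  pow : ∀ u ≤ I.m, s.nats 6 u 0 = 2 ^ u
  p : ∀ l ≤ I.k, s.reals 3 l 0 = (1 / 16) ^ l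
  p' : ∀ l ≤ I.k, s.reals 4 l 0 = (5 * (1 / 16)) ^ l

lemma HasInput.of_frame {I : Terms} {s s' : Store} {N R : List ℕ} (h : HasInput I s)
    (hf : Frame N R s s') (hN : ∀ a ∈ [0, 1, 2, 3], a ∉ N) (hR : 0 ∉ R) : HasInput I s' := by
  have h0 := hf.nats 0 (hN _ (by simp))
  have h1 := hf.nats 1 (hN _ (by simp))
  have h2 := hf.nats 2 (hN _ (by simp))
  have h3 := hf.nats 3 (hN _ (by simp))
  have r0 := hf.reals 0 hR
  exact ⟨h0 ▸ h.size, h0 ▸ h.k, h0 ▸ h.T, h1 ▸ h.w, r0 ▸ h.a, by rw [h2, h3]; exact h.var⟩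

lemma Loaded.of_frame {I : Terms} {s s' : Store} {N R : List ℕ} (h : Loaded I s)
    (hf : Frame N R s s') (hN : ∀ a ∈ [0, 1, 2, 3, 6, 16], a ∉ N) (hR : ∀ a ∈ [0, 3, 4], a ∉ R) :
    Loaded I s' := by
  have h6 := hf.nats 6 (hN _ (by simp))
  have h16 := hf.nats 16 (hN _ (by simp))
  have r3 := hf.reals 3 (hR _ (by simp))
  have r4 := hf.reals 4 (hR _ (by simp))
  exact ⟨h.toHasInput.of_frame hf (fun a ha => hN a (by simp at ha ⊢; tauto)) (hR 0 (by simp)),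
    h16 ▸ h.m, h6 ▸ h.pow, r3 ▸ h.p, r4 ▸ h.p'⟩

/-- Natural numbers cannot be multiplied by the machine, so 3n and the powers of two are built by
addition. Array 16 holds the number of variables and array 6 the powers. -/
lemma progSize_does {I : Terms} {s : Store} (h : HasInput I s) :
    Does progSize s (100 * (I.m + 1)) fun s' => Frame [16, 6, 13] [] s s' ∧
      s'.nats 16 0 0 = I.m ∧ ∀ u ≤ I.m, s'.nats 6 u 0 = 2 ^ u := by
  refine Does.le (T := 50 + (∑ i ∈ Finset.range I.m, 30 + (I.m + 1) * 21)) (Does.seq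
    (Q := fun s' => Frame [16, 6, 13] [] s s' ∧ s'.nats 16 0 0 = I.m ∧ s'.nats 6 0 0 = 1)
    (Does.exec (by decide) (by decide) ⟨?_, ?_, ?_⟩)
    fun s₁ ⟨hf₁, hm, h6⟩ => Does.mono (Does.forTo I.m (fun i s' => Frame [16, 6, 13] [] s s' ∧
      s'.nats 16 0 0 = I.m ∧ ∀ u ≤ i, s'.nats 6 u 0 = 2 ^ u) (fun _ => 30) ?_ ?_ ?_) le_rfl ?_) ?_
  · exact (Frame.refl _ _ s).exec _ (by decide) (by decide)
  · simp [Program.exec, NatExp.eval, assign_self, assign_ne, upd_self, ← h.size]; ring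
  · simp [Program.exec, NatExp.eval, assign_self, assign_ne, upd_self]
  · exact ⟨hf₁.setVar (by decide) _, by simpa using hm, fun u hu => by
      obtain rfl : u = 0 := by omega
      simpa using h6⟩
  · exact fun i s' _ hI => hI.2.1
  · intro i hi s' hc ⟨hf, hm, hp⟩
    refine Does.exec (by decide) (by decide) ⟨?_, ?_, ?_, fun u hu => ?_⟩
    · simpa [Program.exec, NatExp.eval, assign_self, assign_ne] using hc
    · exact (hf.exec _ (by decide) (by decide)).setVar (by decide) _
    · simpa [Program.exec, NatExp.eval, assign_self, assign_ne] using hm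
    · have := hp i le_rfl
      simp [Program.exec, NatExp.eval, assign_self, hc, upd, this]
      split_ifs with h0
      · rw [h0]; ring
      · exact hp u (by omega)
  · exact fun _ h => h
  · simp; omega

lemma progPowers_does {I : Terms} {s : Store} (h : HasInput I s) :
    Does progPowers s (100 * (I.k + 1)) fun s' => Frame [11] [3, 4] s s' ∧
      (∀ l ≤ I.k, s'.reals 3 l 0 = (1 / 16) ^ l) ∧
      ∀ l ≤ I.k, s'.reals 4 l 0 = (5 * (1 / 16)) ^ l := by
  refine Does.le (T := 50 + (∑ i ∈ Finset.range I.k, 50 + (I.k + 1) * 21)) (Does.seq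
    (Q := fun s' => Frame [11] [3, 4] s s' ∧ s'.reals 3 0 0 = 1 ∧ s'.reals 4 0 0 = 1)
    (Does.exec (by decide) (by decide) ⟨?_, ?_, ?_⟩)
    fun s₁ ⟨hf₁, h3, h4⟩ => Does.mono (Does.forTo I.k (fun i s' => Frame [11] [3, 4] s s' ∧
      (∀ l ≤ i, s'.reals 3 l 0 = (1 / 16) ^ l) ∧ ∀ l ≤ i, s'.reals 4 l 0 = (5 * (1 / 16)) ^ l)
      (fun _ => 50) ?_ ?_ ?_) le_rfl ?_) ?_
  · exact (Frame.refl _ _ s).exec _ (by decide) (by decide)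
  · simp [Program.exec, NatExp.eval, RealExp.eval, assign_self, assign_ne, upd_self]
  · simp [Program.exec, NatExp.eval, RealExp.eval, assign_self, upd_self]
  · refine ⟨hf₁.setVar (by decide) _, fun u hu => ?_, fun u hu => ?_⟩
    · obtain rfl : u = 0 := by omega
      simpa using h3
    · obtain rfl : u = 0 := by omega
      simpa using h4
  · intro i s' _ hI
    simp [NatExp.eval, hI.1.nats 0 (by decide), h.k]
  · intro i hi s' hc ⟨hf, h3, h4⟩
    have h3' := h3 i le_rfl
    have h4' := h4 i le_rfl
    refine Does.exec (by decide) (by decide)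
      ⟨?_, ?_, fun l hl => ?_, fun l hl => ?_⟩
    · simpa [Program.exec] using hc
    · exact (hf.exec _ (by decide) (by decide)).setVar (by decide) _
    · simp [Program.exec, NatExp.eval, RealExp.eval, assign_self, assign_ne, hc, upd, h3']
      split_ifs with h0
      · rw [h0]; ring
      · simpa using h3 l (by omega)
    · simp [Program.exec, NatExp.eval, RealExp.eval, assign_self, assign_ne, hc, upd, h4']
      split_ifs with h0
      · rw [h0]; ring
      · simpa using h4 l (by omega)
  · exact fun _ h => h
  · simp; omega

/-! ### Progress of a nested loop through the factors of all terms. -/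

namespace Terms

variable (I : Terms)

/-- The number of factors of the term `t'` which come before the factor `j` of the term `t`. -/
def progress (t j t' : ℕ) : ℕ := if t' < t then I.w t' else if t' = t then j else 0

variable {I}

lemma progress_zero : I.progress 0 0 = fun _ => 0 := by
  funext t'
  simp [progress]

lemma progress_self (t j : ℕ) : I.progress t j t = j := by simp [progress]

lemma progress_succ (t j : ℕ) :
    I.progress t (j + 1) = Function.update (I.progress t j) t (j + 1) := by
  funext t'
  by_cases h : t' = t
  · subst h; simp [progress]
  · simp [progress, h]

lemma progress_next (t : ℕ) : I.progress t (I.w t) = I.progress (t + 1) 0 := by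
  funext t'
  rcases lt_trichotomy t' t with h | rfl | h
  · simp [progress, h, h.trans (Nat.lt_succ_self t)]
  · simp [progress]
  · simp [progress, h.not_gt, h.ne', show ¬ t' < t + 1 by omega]

lemma progress_end {t : ℕ} (ht : t < I.T) : I.progress I.T 0 t = I.w t := by simp [progress, ht]

variable (I) in
/-- The set of the first `g t` variables of the term `t`. -/
def part (g : ℕ → ℕ) (t : ℕ) : Finset ℕ := (Finset.range (g t)).image (I.var t)

lemma part_zero (t : ℕ) : I.part (fun _ => 0) t = ∅ := by simp [part]

lemma part_update_self (g : ℕ → ℕ) {t j : ℕ} (hg : g t = j) :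
    I.part (Function.update g t (j + 1)) t = insert (I.var t j) (I.part g t) := by
  simp [part, Finset.range_add_one, hg]

lemma part_update_of_ne (g : ℕ → ℕ) {t t' j : ℕ} (h : t' ≠ t) :
    I.part (Function.update g t j) t' = I.part g t' := by simp [part, h]

lemma var_notMem_part {g : ℕ → ℕ} {t j : ℕ} (ht : t < I.T) (hj : j < I.w t) (hg : g t = j) :
    I.var t j ∉ I.part g t := by
  simp only [part, Finset.mem_image, Finset.mem_range, not_exists, not_and]
  intro i hi
  exact (I.var_mono t ht i j (hg ▸ hi) hj).ne

lemma part_end {t : ℕ} (ht : t < I.T) : I.part (I.progress I.T 0) t = I.supp t := by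
  simp [part, supp, progress_end ht]

end Terms

/-- The state of reading the input after `g t` factors of each term `t`. -/
structure ReadInv (I : Terms) (s₀ : Store) (g : ℕ → ℕ) (s : Store) : Prop where
  frame : Frame [10, 11, 22, 4, 5, 19, 20] [2] s₀ s
  var : ∀ t, ∀ i < g t, s.nats 4 t i = I.var t i
  key : ∀ t, s.nats 5 t 0 = setKey (I.part g t)
  infl : ∀ v, s.reals 2 v 0 =
    ∑ t ∈ Finset.range I.T, if v ∈ I.part g t then I.a t ^ 2 else 0
  mem : ∀ u, ∀ a < s.nats 20 u 0, s.nats 19 u a < I.T ∧ u ∈ I.part g (s.nats 19 u a)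
  surj : ∀ u, ∀ t < I.T, u ∈ I.part g t → ∃ a < s.nats 20 u 0, s.nats 19 u a = t
  inj : ∀ u a a', a < a' → a' < s.nats 20 u 0 → s.nats 19 u a ≠ s.nats 19 u a'
  deg : ∑ u ∈ Finset.range I.m, s.nats 20 u 0 = ∑ t ∈ Finset.range I.T, g t

lemma sum_update_add_one {S : Finset ℕ} {t : ℕ} (ht : t ∈ S) (g : ℕ → ℕ) :
    ∑ i ∈ S, Function.update g t (g t + 1) i = ∑ i ∈ S, g i + 1 := by
  rw [Finset.sum_update_of_mem ht, Finset.sum_eq_sum_sdiff_singleton_add ht]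
  ring

lemma ReadInv.setVar {I : Terms} {s₀ s : Store} {g : ℕ → ℕ} (h : ReadInv I s₀ g s) {c : ℕ}
    (hc : c ∈ [10, 11]) (i : ℕ) : ReadInv I s₀ g (s.setVar c i) := by
  have hc' : c = 10 ∨ c = 11 := by simpa using hc
  have h4 : (s.setVar c i).nats 4 = s.nats 4 := Store.setVar_nats _ _ _ _ (by omega)
  have h5 : (s.setVar c i).nats 5 = s.nats 5 := Store.setVar_nats _ _ _ _ (by omega)
  have h19 : (s.setVar c i).nats 19 = s.nats 19 := Store.setVar_nats _ _ _ _ (by omega)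
  have h20 : (s.setVar c i).nats 20 = s.nats 20 := Store.setVar_nats _ _ _ _ (by omega)
  refine ⟨h.frame.setVar (by simp; tauto) _, ?_, ?_, ?_, ?_, ?_, ?_, ?_⟩
  · rw [h4]; exact h.var
  · rw [h5]; exact h.key
  · exact h.infl
  · rw [h19, h20]; exact h.mem
  · rw [h19, h20]; exact h.surj
  · rw [h19, h20]; exact h.inj
  · rw [h20]; exact h.deg

/-- The variables of a term are distinct, so one factor adds one new element everywhere: to the key
of its term (array 5), to the influence of its variable (real array 2), and to the list of terms
containing that variable (row of array 19, length in array 20). -/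
lemma ReadInv.step {I : Terms} {s₀ s : Store} {g : ℕ → ℕ} (h : ReadInv I s₀ g s)
    (h₀ : Loaded I s₀) {t j : ℕ} (ht : t < I.T) (hj : j < I.w t) (hg : g t = j)
    (h10 : s.nats 10 0 0 = t) (h11 : s.nats 11 0 0 = j) :
    ReadInv I s₀ (Function.update g t (j + 1)) (progReadFactor.exec s) := by
  have hs : Loaded I s := h₀.of_frame h.frame (by decide) (by decide)
  have hv := hs.var t ht j hj
  have ha := hs.a t ht
  have hvm := I.var_lt t ht j hj
  have hpow := hs.pow _ hvm.le
  have hnot := Terms.var_notMem_part ht hj hg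
  set v := I.var t j with hvdef
  clear_value v
  have e4 : (progReadFactor.exec s).nats 4 = upd (s.nats 4) t j v := by
    simp [progReadFactor, Program.exec, NatExp.eval, assign_self, assign_ne, upd_self, h10, h11, hv]
  have e5 : (progReadFactor.exec s).nats 5 = upd (s.nats 5) t 0 (s.nats 5 t 0 + 2 ^ v) := by
    simp [progReadFactor, Program.exec, NatExp.eval, assign_self, assign_ne, upd_self, h10, h11, hv,
      hpow]
  have e19 : (progReadFactor.exec s).nats 19 = upd (s.nats 19) v (s.nats 20 v 0) t := by
    simp [progReadFactor, Program.exec, NatExp.eval, assign_self, assign_ne, upd_self, h10, h11, hv]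
  have e20 : (progReadFactor.exec s).nats 20 = upd (s.nats 20) v 0 (s.nats 20 v 0 + 1) := by
    simp [progReadFactor, Program.exec, NatExp.eval, assign_self, assign_ne, upd_self, h10, h11, hv]
  have e2 : (progReadFactor.exec s).reals 2 =
      upd (s.reals 2) v 0 (s.reals 2 v 0 + I.a t * I.a t) := by
    simp [progReadFactor, Program.exec, NatExp.eval, RealExp.eval, assign_self, assign_ne, upd_self,
      h10, h11, hv, ha]
  have d20 : ∀ u, (progReadFactor.exec s).nats 20 u 0 =
      Function.update (fun u => s.nats 20 u 0) v (s.nats 20 v 0 + 1) u := by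
    intro u
    by_cases hu : u = v <;> simp [e20, upd, hu]
  have hmono : ∀ t' u, u ∈ I.part g t' → u ∈ I.part (Function.update g t (j + 1)) t' := by
    intro t' u hu
    by_cases h' : t' = t
    · subst h'
      rw [Terms.part_update_self g hg, ← hvdef]
      exact Finset.mem_insert_of_mem hu
    · rwa [Terms.part_update_of_ne g h']
  refine ⟨h.frame.exec _ (by decide) (by decide), ?_, ?_, ?_, ?_, ?_, ?_, ?_⟩
  · intro t' i hi
    rw [e4]
    by_cases h' : t' = t
    · subst h'
      rw [Function.update_self] at hi
      by_cases hij : i = j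
      · simp [upd, hij, hvdef]
      · simpa [upd, hij] using h.var t' i (by omega)
    · rw [Function.update_of_ne h'] at hi
      simpa [upd, h'] using h.var t' i hi
  · intro t'
    rw [e5]
    by_cases h' : t' = t
    · subst h'
      rw [Terms.part_update_self g hg, ← hvdef, setKey, Finset.sum_insert hnot]
      simp [upd, h.key, setKey, add_comm]
    · rw [Terms.part_update_of_ne g h']
      simp [upd, h', h.key]
  · intro u
    have : ∀ t' ∈ Finset.range I.T,
        (if u ∈ I.part (Function.update g t (j + 1)) t' then I.a t' ^ 2 else 0) =
        (if u ∈ I.part g t' then I.a t' ^ 2 else 0) +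
          if t' = t then (if u = v then I.a t ^ 2 else 0) else 0 := by
      intro t' _
      by_cases h' : t' = t
      · subst h'
        rw [Terms.part_update_self g hg, ← hvdef]
        by_cases hu : u = v
        · have : u ∉ I.part g t' := hu ▸ hnot
          simp [hu, hnot]
        · simp [hu]
      · rw [Terms.part_update_of_ne g h']
        simp [h']
    rw [Finset.sum_congr rfl this, Finset.sum_add_distrib, Finset.sum_ite_eq', ← h.infl u, e2,
      if_pos (Finset.mem_range.2 ht)]
    by_cases hu : u = v
    · simp [upd, hu]; ring
    · simp [upd, hu]
  · intro u a hlt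
    rw [d20] at hlt
    rw [e19]
    by_cases hu : u = v
    · subst hu
      rw [Function.update_self] at hlt
      by_cases hav : a = s.nats 20 u 0
      · simp only [upd, hav, and_self, if_true]
        refine ⟨ht, ?_⟩
        rw [Terms.part_update_self g hg, ← hvdef]
        exact Finset.mem_insert_self _ _
      · have := h.mem u a (by omega)
        simp only [upd, hav, and_false, if_false]
        exact ⟨this.1, hmono _ _ this.2⟩
    · rw [Function.update_of_ne hu] at hlt
      have := h.mem u a hlt
      simp only [upd, hu, false_and, if_false]
      exact ⟨this.1, hmono _ _ this.2⟩
  · intro u t' ht' hmem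
    by_cases hold : u ∈ I.part g t'
    · obtain ⟨a, hlt, hat⟩ := h.surj u t' ht' hold
      refine ⟨a, ?_, ?_⟩
      · rw [d20]
        by_cases hu : u = v
        · subst hu; rw [Function.update_self]; omega
        · rwa [Function.update_of_ne hu]
      · have : ¬ (u = v ∧ a = s.nats 20 v 0) := by
          rintro ⟨rfl, rfl⟩
          omega
        rw [e19]
        simp only [upd, this, if_false]
        exact hat
    · have h' : t' = t := by
        by_contra h'
        rw [Terms.part_update_of_ne g h'] at hmem
        exact hold hmem
      subst h'
      rw [Terms.part_update_self g hg, ← hvdef, Finset.mem_insert] at hmem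
      obtain rfl : u = v := hmem.resolve_right hold
      exact ⟨s.nats 20 u 0, by simp [d20], by simp [e19, upd]⟩
  · intro u a a' hlt ha'
    rw [d20] at ha'
    rw [e19]
    by_cases hu : u = v
    · rw [hu, Function.update_self] at ha'
      subst hu
      have hne : a ≠ s.nats 20 u 0 := by omega
      by_cases hav : a' = s.nats 20 u 0
      · simp only [upd, hav, hne, and_false, if_false, and_self, if_true]
        intro heq
        have := (h.mem u a (by omega)).2
        rw [heq] at this
        exact hnot this
      · simpa [upd, hav, hne] using h.inj u a a' hlt (by omega)
    · rw [Function.update_of_ne hu] at ha'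
      simpa [upd, hu] using h.inj u a a' hlt ha'
  · rw [Finset.sum_congr rfl fun u _ => d20 u,
      sum_update_add_one (Finset.mem_range.2 hvm) fun u => s.nats 20 u 0, h.deg, ← hg,
      sum_update_add_one (Finset.mem_range.2 ht) g]

/-- The memory contains the variables, keys, influences and the lists of the terms containing a
variable. -/
structure Listed (I : Terms) (s : Store) : Prop extends Loaded I s where
  vars : ∀ t < I.T, ∀ j < I.w t, s.nats 4 t j = I.var t j
  mem : ∀ u, ∀ a < s.nats 20 u 0, s.nats 19 u a < I.T ∧ u ∈ I.supp (s.nats 19 u a)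
  surj : ∀ u, ∀ t < I.T, u ∈ I.supp t → ∃ a < s.nats 20 u 0, s.nats 19 u a = t
  inj : ∀ u a a', a < a' → a' < s.nats 20 u 0 → s.nats 19 u a ≠ s.nats 19 u a'
  deg : ∑ u ∈ Finset.range I.m, s.nats 20 u 0 = ∑ t ∈ Finset.range I.T, I.w t

lemma Listed.of_frame {I : Terms} {s s' : Store} {N R : List ℕ} (h : Listed I s)
    (hf : Frame N R s s') (hN : ∀ a ∈ [0, 1, 2, 3, 6, 16, 4, 19, 20], a ∉ N)
    (hR : ∀ a ∈ [0, 3, 4], a ∉ R) : Listed I s' := by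
  have h4 := hf.nats 4 (hN _ (by simp))
  have h19 := hf.nats 19 (hN _ (by simp))
  have h20 := hf.nats 20 (hN _ (by simp))
  refine ⟨h.toLoaded.of_frame hf (fun a ha => hN a (by simp at ha ⊢; tauto)) hR,
    h4 ▸ h.vars, ?_, ?_, ?_, h20 ▸ h.deg⟩
  · rw [h19, h20]; exact h.mem
  · rw [h19, h20]; exact h.surj
  · rw [h19, h20]; exact h.inj

lemma sum_w_le (I : Terms) : ∑ t ∈ Finset.range I.T, I.w t ≤ I.T * I.k := by
  refine (Finset.sum_le_card_nsmul _ _ I.k fun t ht => I.w_le t (Finset.mem_range.1 ht)).trans ?_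
  simp

/-- Keys, list lengths and influences are accumulated in place, so their arrays have to be zero
initially. -/
lemma progRead_does {I : Terms} {s : Store} (h : Loaded I s) (h5 : s.nats 5 = fun _ _ => 0)
    (h20 : s.nats 20 = fun _ _ => 0) (h2 : s.reals 2 = fun _ _ => 0) :
    Does progRead s (300 * (I.T * (I.k + 1) + 1)) fun s' =>
      Frame [10, 11, 22, 4, 5, 19, 20] [2] s s' ∧ Listed I s' ∧
      (∀ t < I.T, s'.nats 5 t 0 = setKey (I.supp t)) ∧ ∀ v, s'.reals 2 v 0 = I.infl v := by
  have start : ReadInv I s (I.progress 0 0) s := by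
    rw [Terms.progress_zero]
    exact ⟨.refl _ _ _, by simp, by simp [h5, Terms.part_zero, setKey],
      by simp [h2, Terms.part_zero], by simp [h20], by simp [Terms.part_zero], by simp [h20],
      by simp [h20]⟩
  have hloop := Does.forTo (c := 10) (B := .get 0 (.const 0) (.const 2))
    (p := forTo 11 (nvec 1 (nvar 10)) progReadFactor) (s₀ := s) I.T
    (fun t s' => ReadInv I s (I.progress t 0) s')
    (fun t => ∑ j ∈ Finset.range (I.w t), 150 + (I.w t + 1) * 23)
    (start.setVar (by simp) 0)
    (fun t s' _ hI => by
      have := (h.toHasInput.of_frame hI.frame (by decide) (by decide)).T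
      simpa [NatExp.eval] using this)
    (fun t ht s' hc hI => by
      refine Does.mono (Does.forTo (I.w t)
        (fun j s'' => ReadInv I s (I.progress t j) s'' ∧ s''.nats 10 0 0 = t)
        (fun _ => 150) ?_ ?_ ?_) le_rfl ?_
      · exact ⟨hI.setVar (by simp) 0, by simpa using hc⟩
      · intro j s'' _ ⟨hI', h10⟩
        have := (h.toHasInput.of_frame hI'.frame (by decide) (by decide)).w t ht
        simp [NatExp.eval, h10, this]
      · intro j hj s'' hc' ⟨hI', h10⟩
        refine Does.exec (by decide) (by decide) ⟨?_, ?_, ?_⟩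
        · simpa [progReadFactor, Program.exec, assign_ne] using hc'
        · rw [Terms.progress_succ]
          exact (hI'.step h ht hj (Terms.progress_self t j) h10 hc').setVar (by simp) _
        · simpa [progReadFactor, Program.exec, assign_ne] using h10
      · rintro s'' ⟨hI', h10⟩
        rw [Terms.progress_next] at hI'
        exact ⟨h10, hI'.setVar (by simp) _⟩)
  refine hloop.mono ?_ fun s' hI => ⟨hI.frame, ⟨?_, ?_, ?_, ?_, hI.inj, ?_⟩, ?_, ?_⟩
  · have := sum_w_le I
    simp only [Finset.sum_const, Finset.card_range, smul_eq_mul, Finset.sum_add_distrib,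
      add_mul, ← Finset.sum_mul, NatExp.cost]
    nlinarith
  · exact h.of_frame hI.frame (by decide) (by decide)
  · exact fun t ht j hj => hI.var t j (by rwa [Terms.progress_end ht])
  · intro u a ha
    have := hI.mem u a ha
    exact ⟨this.1, by rw [← Terms.part_end this.1]; exact this.2⟩
  · exact fun u t ht hu => hI.surj u t ht (by rwa [Terms.part_end ht])
  · rw [hI.deg]
    exact Finset.sum_congr rfl fun t ht => Terms.progress_end (Finset.mem_range.1 ht)
  · exact fun t ht => by rw [hI.key, Terms.part_end ht]
  · intro v
    rw [hI.infl, Terms.infl]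
    exact Finset.sum_congr rfl fun t ht => by rw [Terms.part_end (Finset.mem_range.1 ht)]

/-! ### The algorithm: the tables of the partial derivatives -/

/-- Computes the inverse square roots of the influences. -/
def progInverse : Program :=
  forTo 13 (nvar 16) (.setReal 19 (nvar 13) (.const 0) (.div (.const 1) (.sqrt (rvec 2 (nvar 13)))))

/-- A variable occurring in no term needs no test: division by zero gives zero both in the machine
and in the stated formula. -/
lemma progInverse_does {I : Terms} {s : Store} (h : Loaded I s)
    (h2 : ∀ v, s.reals 2 v 0 = I.infl v) :
    Does progInverse s (100 * (I.m + 1)) fun s' => Frame [13] [19] s s' ∧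
      ∀ v < I.m, s'.reals 19 v 0 = 1 / √(I.infl v) := by
  refine (Does.forTo I.m (fun i s' => Frame [13] [19] s s' ∧
    ∀ v < i, s'.reals 19 v 0 = 1 / √(I.infl v)) (fun _ => 50) ?_ ?_ ?_).le ?_
  · exact ⟨(Frame.refl _ _ _).setVar (by decide) _, by simp⟩
  · intro i s' _ hI
    exact (h.of_frame hI.1 (by decide) (by decide)).m
  · intro i hi s' hc ⟨hf, hv⟩
    refine Does.exec (by decide) (by decide) ⟨hc, ?_, fun v hlt => ?_⟩
    · exact (hf.exec _ (by decide) (by decide)).setVar (by decide) _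
    · have : s'.reals 2 = s.reals 2 := hf.reals 2 (by decide)
      simp only [Store.setVar_reals, Program.exec, assign_self, NatExp.eval, RealExp.eval, hc, this,
        h2, upd, and_true, Rat.cast_one]
      split_ifs with hvi
      · rw [hvi]
      · exact hv v (by omega)
  · simp [NatExp.cost]; omega

/-- Enters one term into the coefficients of its derivative with respect to one of its variables. -/
def progEnter : Program :=
  .seq (.setNat 22 (.const 0) (.const 0) (.get 4 (nvar 10) (nvar 11)))
  (.seq (.setNat 17 (.const 0) (.const 0) (.sub (nvec 5 (nvar 10)) (nvec 6 (nvar 22))))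
  (.seq (.setNat 21 (.const 0) (.const 0) (.sub (nvec 1 (nvar 10)) (.const 1)))
  (.seq (.setReal 6 (nvar 22) (.const 0) (.add (rvec 6 (nvar 22)) (.mul (rvec 4 (nvar 21))
    (.sub (.mul (.add (.get 5 (nvar 22) (nvar 17)) (rvec 0 (nvar 10)))
        (.add (.get 5 (nvar 22) (nvar 17)) (rvec 0 (nvar 10))))
      (.mul (.get 5 (nvar 22) (nvar 17)) (.get 5 (nvar 22) (nvar 17)))))))
  (.setReal 5 (nvar 22) (nvar 17) (.add (.get 5 (nvar 22) (nvar 17)) (rvec 0 (nvar 10)))))))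

/-- Schedules the elimination of one variable from a term of a derivative. -/
def progEntry : Program :=
  .ite (.natLe (.const 1) (.add (.sub (nvar 12) (nvar 11)) (.sub (nvar 11) (nvar 12))))
    (.seq (.setNat 23 (.const 0) (.const 0) (.get 4 (nvar 10) (nvar 12)))
    (.seq (.setNat 21 (.const 0) (.const 0) (.sub (nvar 21) (.const 1)))
    (.seq (.setNat 7 (nvar 23) (nvec 18 (nvar 23)) (nvar 22))
    (.seq (.setNat 8 (nvar 23) (nvec 18 (nvar 23)) (nvar 17))
    (.seq (.setNat 9 (nvar 23) (nvec 18 (nvar 23)) (nvar 21))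
    (.seq (.setNat 18 (nvar 23) (.const 0) (.add (nvec 18 (nvar 23)) (.const 1)))
    (.setNat 17 (.const 0) (.const 0) (.sub (nvar 17) (nvec 6 (nvar 23))))))))))
    .skip

/-- Computes the coefficients of the derivatives and the schedule of the elimination. -/
def progSchedule : Program :=
  forTo 10 (.get 0 (.const 0) (.const 2)) (forTo 11 (nvec 1 (nvar 10))
    (.seq progEnter (forTo 12 (nvec 1 (nvar 10)) progEntry)))

/-- This lets the program maintain the norm of each row (real array 6) with constant work per
changed coefficient. -/
lemma wnorm_update {θ : ℝ} {m : ℕ} {Q : Finset ℕ} (hQ : Q ⊆ Finset.range m) (c : Finset ℕ → ℝ)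
    (b : ℝ) : wnorm θ m (Function.update c Q b) =
      wnorm θ m c + θ ^ Q.card * (b ^ 2 - c Q ^ 2) := by
  have hQ' := Finset.mem_powerset.2 hQ
  rw [wnorm, wnorm, ← Finset.add_sum_erase _ _ hQ', ← Finset.add_sum_erase _ (fun Q => _) hQ',
    Function.update_self, Finset.sum_congr rfl fun R hR => by
      rw [Function.update_of_ne (Finset.ne_of_mem_erase hR)]]
  ring

/-- The row `v` of the table of coefficients. -/
def Store.table (s : Store) (v : ℕ) (Q : Finset ℕ) : ℝ := s.reals 5 v (setKey Q)

lemma upd_setKey (f : ℕ → ℕ → ℝ) (v v' : ℕ) (Q : Finset ℕ) (b : ℝ) :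
    (fun R => upd f v (setKey Q) b v' (setKey R)) =
      if v' = v then Function.update (fun R => f v (setKey R)) Q b
      else fun R => f v' (setKey R) := by
  funext R
  split_ifs with hv
  · subst hv
    by_cases hR : R = Q
    · subst hR; simp [upd]
    · have : setKey R ≠ setKey Q := fun h => hR (setKey_injective h)
      simp [upd, hR, this]
  · simp [upd, hv]

namespace Terms

/-- The coefficients of the partial derivatives coming from the first `g t` variables of each
term `t`. -/
def coefPart (I : Terms) (g : ℕ → ℕ) (v : ℕ) (Q : Finset ℕ) : ℝ :=
  ∑ t ∈ Finset.range I.T, if v ∈ I.part g t ∧ (I.supp t).erase v = Q then I.a t else 0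

lemma coefPart_update {I : Terms} {g : ℕ → ℕ} {t j : ℕ} (ht : t < I.T) (hj : j < I.w t)
    (hg : g t = j) (v : ℕ) : I.coefPart (Function.update g t (j + 1)) v =
      if v = I.var t j then Function.update (I.coefPart g v) ((I.supp t).erase v)
        (I.coefPart g v ((I.supp t).erase v) + I.a t)
      else I.coefPart g v := by
  funext Q
  have hnot := var_notMem_part ht hj hg
  have h : I.coefPart (Function.update g t (j + 1)) v Q = I.coefPart g v Q +
      if v = I.var t j ∧ (I.supp t).erase v = Q then I.a t else 0 := by
    rw [coefPart, coefPart, ← Finset.add_sum_erase _ _ (Finset.mem_range.2 ht),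
      ← Finset.add_sum_erase _ (fun t => _) (Finset.mem_range.2 ht), part_update_self g hg,
      Finset.sum_congr rfl fun t' ht' => by
        rw [part_update_of_ne g (Finset.ne_of_mem_erase ht')]]
    by_cases hv : v = I.var t j
    · subst hv
      simp [hnot]; ring
    · simp [hv]
  rw [h]
  by_cases hv : v = I.var t j
  · by_cases hQ : (I.supp t).erase v = Q
    · subst hQ; simp [hv]
    · simp [hv, hv ▸ hQ, Function.update_of_ne (Ne.symm (hv ▸ hQ))]
  · simp [hv]

lemma coefPart_end (I : Terms) : I.coefPart (I.progress I.T 0) = I.coef := by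
  funext v Q
  exact Finset.sum_congr rfl fun t ht => by rw [part_end (Finset.mem_range.1 ht)]

end Terms

/-- The state of the table of coefficients after the entry of the first `g t` factors of each
term `t`. -/
structure TableInv (I : Terms) (s₀ : Store) (g : ℕ → ℕ) (s : Store) : Prop where
  frame : Frame [10, 11, 12, 22, 17, 21, 23, 7, 8, 9, 18] [5, 6] s₀ s
  table : ∀ v, s.table v = I.coefPart g v
  norm : ∀ v, s.reals 6 v 0 = wnorm (5 * (1 / 16)) I.m (s.table v)

/-- The elimination of the factor `i` of the term `t` from the derivative with respect to the
factor `j` is scheduled. -/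
def Scheduled (I : Terms) (s : Store) (t j i : ℕ) : Prop :=
  ∃ a < s.nats 18 (I.var t i) 0, s.nats 7 (I.var t i) a = I.var t j ∧
    s.nats 8 (I.var t i) a =
      setKey (((I.supp t).erase (I.var t j)).filter (I.var t i ≤ ·))

/-- The schedule contains the eliminations in the set `C`, and at most `B` eliminations. -/
structure ScheduleInv (I : Terms) (C : ℕ → ℕ → ℕ → Prop) (B : ℕ) (s : Store) : Prop where
  valid : ∀ u, ∀ a < s.nats 18 u 0, s.nats 7 u a < I.m ∧ ∃ Q, s.nats 8 u a = setKey Q ∧ u ∈ Q ∧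
    Q ⊆ Finset.range I.m ∧ s.nats 9 u a + 1 = Q.card ∧ Q.card ≤ I.k
  cover : ∀ t < I.T, ∀ j < I.w t, ∀ i < I.w t, i ≠ j → C t j i → Scheduled I s t j i
  deg : ∑ u ∈ Finset.range I.m, s.nats 18 u 0 ≤ B

lemma ScheduleInv.congr {I : Terms} {C C' : ℕ → ℕ → ℕ → Prop} {B B' : ℕ} {s s' : Store}
    (h : ScheduleInv I C B s) (hN : ∀ a ∈ [7, 8, 9, 18], s'.nats a = s.nats a)
    (hC : ∀ t j i, t < I.T → i < I.w t → C' t j i → C t j i) (hB : B ≤ B') :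
    ScheduleInv I C' B' s' := by
  have h7 := hN 7 (by simp)
  have h8 := hN 8 (by simp)
  have h9 := hN 9 (by simp)
  have h18 := hN 18 (by simp)
  refine ⟨?_, fun t ht j hj i hi hij hc => ?_, ?_⟩
  · rw [h7, h8, h9, h18]; exact h.valid
  · rw [Scheduled, h7, h8, h18]; exact h.cover t ht j hj i hi hij (hC t j i ht hi hc)
  · rw [h18]; exact h.deg.trans hB

lemma TableInv.congr {I : Terms} {s₀ s s' : Store} {g : ℕ → ℕ} (h : TableInv I s₀ g s)
    (hf : Frame [10, 11, 12, 22, 17, 21, 23, 7, 8, 9, 18] [5, 6] s₀ s')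
    (hR : s'.reals = s.reals) : TableInv I s₀ g s' := by
  have ht : s'.table = s.table := by funext v Q; rw [Store.table, hR]; rfl
  exact ⟨hf, by rw [ht]; exact h.table, by rw [ht, hR]; exact h.norm⟩

/-- One factor of a term creates one entry of one row: the term without that variable. Array 17 is
left with the key of this monomial and array 21 with its degree, from which the scheduling of its
elimination starts. -/
lemma TableInv.step {I : Terms} {s₀ s : Store} {g : ℕ → ℕ} (h : TableInv I s₀ g s)
    (h₀ : Listed I s₀) (h5 : ∀ t < I.T, s₀.nats 5 t 0 = setKey (I.supp t)) {t j : ℕ} (ht : t < I.T)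
    (hj : j < I.w t) (hg : g t = j) (h10 : s.nats 10 0 0 = t) (h11 : s.nats 11 0 0 = j) :
    TableInv I s₀ (Function.update g t (j + 1)) (progEnter.exec s) ∧
    (progEnter.exec s).nats 22 0 0 = I.var t j ∧
    (progEnter.exec s).nats 17 0 0 = setKey ((I.supp t).erase (I.var t j)) ∧
    (progEnter.exec s).nats 21 0 0 = ((I.supp t).erase (I.var t j)).card := by
  have hs : Listed I s := h₀.of_frame h.frame (by decide) (by decide)
  have hv := hs.vars t ht j hj
  have ha := hs.a t ht
  have hvm := I.var_lt t ht j hj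
  have hmem := Terms.var_mem_supp hj
  have hw := hs.w t ht
  -- The truncated subtraction is exact, as 2 to the power of the variable is a summand of the key.
  have h5' : s.nats 5 t 0 - s.nats 6 (I.var t j) 0 = setKey ((I.supp t).erase (I.var t j)) := by
    rw [hs.pow _ hvm.le, h.frame.nats 5 (by decide), h5 t ht, setKey, setKey,
      ← Finset.add_sum_erase _ _ hmem]
    omega
  have hcard : I.w t - 1 = ((I.supp t).erase (I.var t j)).card := by
    rw [Finset.card_erase_of_mem hmem, Terms.card_supp ht]
  have hp : s.reals 4 ((I.supp t).erase (I.var t j)).card 0 =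
      (5 * (1 / 16)) ^ ((I.supp t).erase (I.var t j)).card :=
    hs.p' _ (by rw [← hcard]; have := I.w_le t ht; omega)
  have hsub : (I.supp t).erase (I.var t j) ⊆ Finset.range I.m :=
    (Finset.erase_subset _ _).trans (Terms.supp_subset ht)
  have htab := h.table (I.var t j)
  have hcp := Terms.coefPart_update ht hj hg
  set v := I.var t j with hvdef
  set Q := (I.supp t).erase v with hQdef
  clear_value Q
  clear_value v
  have e5 : (progEnter.exec s).reals 5 = upd (s.reals 5) v (setKey Q)
      (s.reals 5 v (setKey Q) + I.a t) := by
    simp [progEnter, Program.exec, NatExp.eval, RealExp.eval, assign_self, assign_ne, upd_self,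
      h10, h11, hv, h5', ha]
  have e6 : (progEnter.exec s).reals 6 = upd (s.reals 6) v 0 (s.reals 6 v 0 +
      (5 * (1 / 16)) ^ Q.card * ((s.reals 5 v (setKey Q) + I.a t) *
        (s.reals 5 v (setKey Q) + I.a t) - s.reals 5 v (setKey Q) * s.reals 5 v (setKey Q))) := by
    simp [progEnter, Program.exec, NatExp.eval, RealExp.eval, assign_self, assign_ne, upd_self,
      h10, h11, hv, h5', ha, hw, hcard, hp]
  have etab : ∀ v', (progEnter.exec s).table v' = if v' = v then
      Function.update (s.table v) Q (s.table v Q + I.a t) else s.table v' := by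
    intro v'
    have := upd_setKey (s.reals 5) v v' Q (s.reals 5 v (setKey Q) + I.a t)
    rw [← e5] at this
    exact this
  refine ⟨⟨h.frame.exec _ (by decide) (by decide), fun v' => ?_, fun v' => ?_⟩, ?_, ?_, ?_⟩
  · rw [etab, hcp, h.table, h.table]
    by_cases hvv : v' = v
    · subst hvv
      rw [if_pos rfl, if_pos rfl, ← hQdef]
    · rw [if_neg hvv, if_neg hvv]
  · rw [etab, e6]
    by_cases hvv : v' = v
    · subst hvv
      rw [if_pos rfl, wnorm_update hsub, upd_self, h.norm]
      simp only [Store.table]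
      ring
    · rw [if_neg hvv, ← h.norm]
      simp [upd, hvv]
  · simp [progEnter, Program.exec, NatExp.eval, assign_self, assign_ne, upd_self, h10, h11, hv]
  · simp [progEnter, Program.exec, NatExp.eval, assign_self, assign_ne, upd_self, h10, h11, hv, h5']
  · simp [progEnter, Program.exec, NatExp.eval, assign_self, assign_ne, upd_self, h10, hw, hcard]

/-- The indices of the factors from the `i`-th on without the factor `j`. -/
def laterIdx (w j i : ℕ) : Finset ℕ := (Finset.range w).filter fun b => i ≤ b ∧ b ≠ j

lemma laterIdx_eq_insert {w j i : ℕ} (hi : i < w) (hij : i ≠ j) :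
    laterIdx w j i = insert i (laterIdx w j (i + 1)) := by
  ext b
  simp only [laterIdx, Finset.mem_filter, Finset.mem_range, Finset.mem_insert]
  omega

lemma laterIdx_self (w j : ℕ) : laterIdx w j j = laterIdx w j (j + 1) := by
  ext b
  simp only [laterIdx, Finset.mem_filter, Finset.mem_range]
  omega

namespace Terms

variable {I : Terms}

/-- The variables of the term `t` from the `i`-th on without the variable `j`. -/
def later (I : Terms) (t j i : ℕ) : Finset ℕ := (laterIdx (I.w t) j i).image (I.var t)

lemma var_notMem_later {t i : ℕ} (ht : t < I.T) (hi : i < I.w t) (j : ℕ) :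
    I.var t i ∉ I.later t j (i + 1) := by
  simp only [later, laterIdx, Finset.mem_image, Finset.mem_filter, Finset.mem_range]
  rintro ⟨b, hb, hbi⟩
  have := var_injOn ht (by simpa using hb.1) (by simpa using hi) hbi
  omega

lemma later_eq_insert {t j i : ℕ} (hi : i < I.w t) (hij : i ≠ j) :
    I.later t j i = insert (I.var t i) (I.later t j (i + 1)) := by
  rw [later, laterIdx_eq_insert hi hij, Finset.image_insert, later]

lemma later_zero {t j : ℕ} (ht : t < I.T) (hj : j < I.w t) :
    I.later t j 0 = (I.supp t).erase (I.var t j) := by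
  ext v
  simp only [later, laterIdx, supp, Finset.mem_image, Finset.mem_filter, Finset.mem_range,
    Finset.mem_erase]
  constructor
  · rintro ⟨b, ⟨hb, -, hbj⟩, rfl⟩
    exact ⟨fun h => hbj (var_injOn ht (by simpa using hb) (by simpa using hj) h), b, hb, rfl⟩
  · rintro ⟨hne, b, hb, rfl⟩
    exact ⟨b, ⟨hb, Nat.zero_le _, fun h => hne (by rw [h])⟩, rfl⟩

/-- The variables of a term increase, so the tail from the `i`-th factor on is also the part not yet
eliminated when the variable `I.var t i` is reached. This matches the schedule with the `support`
field of `Stage`. -/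
lemma later_eq_filter {t j i : ℕ} (ht : t < I.T) (hj : j < I.w t) (hi : i < I.w t) :
    I.later t j i = ((I.supp t).erase (I.var t j)).filter (I.var t i ≤ ·) := by
  rw [← later_zero ht hj]
  ext v
  simp only [later, laterIdx, Finset.mem_image, Finset.mem_filter, Finset.mem_range]
  constructor
  · rintro ⟨b, ⟨hb, hib, hbj⟩, rfl⟩
    refine ⟨⟨b, ⟨hb, Nat.zero_le _, hbj⟩, rfl⟩, ?_⟩
    rcases hib.eq_or_lt with rfl | h
    · exact le_rfl
    · exact (I.var_mono t ht i b h hb).le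
  · rintro ⟨⟨b, ⟨hb, -, hbj⟩, rfl⟩, hle⟩
    refine ⟨b, ⟨hb, ?_, hbj⟩, rfl⟩
    by_contra h
    have := I.var_mono t ht b i (by omega) hi
    omega

end Terms

/-- The state of scheduling the derivative of the term `t` with respect to its factor `j`. -/
structure EntryInv (I : Terms) (s₀ : Store) (t j i : ℕ) (s : Store) : Prop where
  tables : TableInv I s₀ (I.progress t (j + 1)) s
  schedule : ScheduleInv I
    (fun t' j' i' => j' < I.progress t j t' ∨ (t' = t ∧ j' = j ∧ i' < i))
    (I.k * ∑ t' ∈ Finset.range I.T, I.progress t j t' + i) s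
  h10 : s.nats 10 0 0 = t
  h11 : s.nats 11 0 0 = j
  h22 : s.nats 22 0 0 = I.var t j
  h17 : s.nats 17 0 0 = setKey (I.later t j i)
  h21 : s.nats 21 0 0 = (I.later t j i).card

lemma EntryInv.setVar {I : Terms} {s₀ s : Store} {t j i : ℕ} (h : EntryInv I s₀ t j i s) (b : ℕ) :
    EntryInv I s₀ t j i (s.setVar 12 b) := by
  have hN : ∀ a, a ≠ 12 → (s.setVar 12 b).nats a = s.nats a := fun a ha =>
    Store.setVar_nats _ _ _ _ ha
  refine ⟨h.tables.congr (h.tables.frame.setVar (by decide) _) rfl,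
    h.schedule.congr (fun a ha => hN a ?_) (fun _ _ _ _ _ h => h) le_rfl, ?_, ?_, ?_, ?_, ?_⟩
  · rintro rfl; simp at ha
  all_goals rw [hN _ (by decide)]
  exacts [h.h10, h.h11, h.h22, h.h17, h.h21]

/-- Going through the factors in increasing order, the program records for each variable u the row
(array 7), the key (array 8) and the degree without u (array 9) of the tail that starts at u, and
then drops u from the current key. -/
lemma EntryInv.step {I : Terms} {s₀ s : Store} {t j i : ℕ} (h : EntryInv I s₀ t j i s)
    (h₀ : Listed I s₀) (ht : t < I.T) (hj : j < I.w t) (hi : i < I.w t)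
    (h12 : s.nats 12 0 0 = i) : EntryInv I s₀ t j (i + 1) (progEntry.exec s) := by
  have hs : Listed I s := h₀.of_frame h.tables.frame (by decide) (by decide)
  by_cases hij : i = j
  -- The differentiated variable is absent from the monomial and is skipped; the sum of the two
  -- truncated differences tests whether i and j differ.
  · have hex : progEntry.exec s = s := by
      simp [progEntry, Program.exec, Test.Holds, NatExp.eval, h12, h.h11, hij]
    have hl : I.later t j (i + 1) = I.later t j i := by
      subst hij
      rw [Terms.later, ← laterIdx_self, Terms.later]
    rw [hex]
    refine ⟨h.tables, ?_, h.h10, h.h11, h.h22, hl ▸ h.h17, hl ▸ h.h21⟩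
    refine ⟨h.schedule.valid, fun t' ht' j' hj' i' hi' hne hC => ?_, h.schedule.deg.trans (by omega)⟩
    refine h.schedule.cover t' ht' j' hj' i' hi' hne (hC.imp_right ?_)
    rintro ⟨rfl, rfl, hlt⟩
    exact ⟨rfl, rfl, by omega⟩
  · have hu := hs.vars t ht i hi
    have hum := I.var_lt t ht i hi
    have hvm := I.var_lt t ht j hj
    have hpow := hs.pow _ hum.le
    have hins := Terms.later_eq_insert hi hij
    have hnot := Terms.var_notMem_later ht hi j
    have hfil := Terms.later_eq_filter ht hj hi
    have hcard : (I.later t j i).card = (I.later t j (i + 1)).card + 1 := by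
      rw [hins, Finset.card_insert_of_notMem hnot]
    have hkey : setKey (I.later t j i) - 2 ^ I.var t i = setKey (I.later t j (i + 1)) := by
      rw [hins, setKey, Finset.sum_insert hnot, setKey]
      omega
    have hsub : I.later t j i ⊆ I.supp t := by
      rw [hfil]
      exact (Finset.filter_subset _ _).trans (Finset.erase_subset _ _)
    have hcardk : (I.later t j i).card ≤ I.k :=
      (Finset.card_le_card hsub).trans ((Terms.card_supp ht).le.trans (I.w_le t ht))
    have hmem : I.var t i ∈ I.later t j i := by rw [hins]; exact Finset.mem_insert_self _ _
    have h10 := h.h10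
    have h11 := h.h11
    have h22 := h.h22
    have h17 := h.h17
    have h21 := h.h21
    have hcond : 1 ≤ i - j + (j - i) := by omega
    set u := I.var t i with hudef
    have e7 : (progEntry.exec s).nats 7 = upd (s.nats 7) u (s.nats 18 u 0) (I.var t j) := by
      simp [progEntry, Program.exec, Test.Holds, NatExp.eval, assign_self, assign_ne, upd_self,
        h10, h11, h12, hu, h22, hcond]
    have e8 : (progEntry.exec s).nats 8 =
        upd (s.nats 8) u (s.nats 18 u 0) (setKey (I.later t j i)) := by
      simp [progEntry, Program.exec, Test.Holds, NatExp.eval, assign_self, assign_ne, upd_self,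
        h10, h11, h12, hu, h17, hcond]
    have e9 : (progEntry.exec s).nats 9 =
        upd (s.nats 9) u (s.nats 18 u 0) (I.later t j (i + 1)).card := by
      simp [progEntry, Program.exec, Test.Holds, NatExp.eval, assign_self, assign_ne, upd_self,
        h10, h11, h12, hu, h21, hcond, hcard]
    have e18 : (progEntry.exec s).nats 18 = upd (s.nats 18) u 0 (s.nats 18 u 0 + 1) := by
      simp [progEntry, Program.exec, Test.Holds, NatExp.eval, assign_self, assign_ne, upd_self,
        h10, h11, h12, hu, hcond]
    have d18 : ∀ u', (progEntry.exec s).nats 18 u' 0 =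
        Function.update (fun u => s.nats 18 u 0) u (s.nats 18 u 0 + 1) u' := by
      intro u'
      by_cases h' : u' = u <;> simp [e18, upd, h']
    have keep : ∀ u' a, a < s.nats 18 u' 0 → a < (progEntry.exec s).nats 18 u' 0 ∧
        (progEntry.exec s).nats 7 u' a = s.nats 7 u' a ∧
        (progEntry.exec s).nats 8 u' a = s.nats 8 u' a ∧
        (progEntry.exec s).nats 9 u' a = s.nats 9 u' a := by
      intro u' a ha
      have : ¬ (u' = u ∧ a = s.nats 18 u 0) := by
        rintro ⟨rfl, rfl⟩
        omega
      refine ⟨?_, by simp [e7, upd, this], by simp [e8, upd, this], by simp [e9, upd, this]⟩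
      rw [d18]
      by_cases h' : u' = u
      · rw [h', Function.update_self]
        rw [h'] at ha
        omega
      · rwa [Function.update_of_ne h']
    refine ⟨h.tables.congr (h.tables.frame.exec _ (by decide) (by decide)) ?_, ⟨?_, ?_, ?_⟩,
      ?_, ?_, ?_, ?_, ?_⟩
    · simp only [progEntry, Program.exec]
      split_ifs <;> rfl
    · intro u' a ha
      by_cases hold : a < s.nats 18 u' 0
      · obtain ⟨-, k7, k8, k9⟩ := keep u' a hold
        rw [k7, k8, k9]
        exact h.schedule.valid u' a hold
      · rw [d18] at ha
        have h' : u' = u := by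
          by_contra h'
          rw [Function.update_of_ne h'] at ha
          exact hold ha
        rw [h'] at ha hold ⊢
        rw [Function.update_self] at ha
        have haa : a = s.nats 18 u 0 := by omega
        rw [e7, e8, e9, haa, upd_self, upd_self, upd_self]
        exact ⟨hvm, _, rfl, hmem, hsub.trans (Terms.supp_subset ht), hcard.symm, hcardk⟩
    · intro t' ht' j' hj' i' hi' hne hC
      by_cases hnew : t' = t ∧ j' = j ∧ i' = i
      · obtain ⟨rfl, rfl, rfl⟩ := hnew
        refine ⟨s.nats 18 u 0, ?_, ?_, ?_⟩
        · rw [d18, Function.update_self]; omega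
        · rw [e7, upd_self]
        · rw [e8, upd_self, hfil]
      · obtain ⟨a, ha, ha7, ha8⟩ := h.schedule.cover t' ht' j' hj' i' hi' hne (by
          refine hC.imp_right fun hC => ⟨hC.1, hC.2.1, ?_⟩
          omega)
        obtain ⟨kl, k7, k8, -⟩ := keep _ a ha
        exact ⟨a, kl, k7.trans ha7, k8.trans ha8⟩
    · rw [Finset.sum_congr rfl fun u _ => d18 u,
        sum_update_add_one (Finset.mem_range.2 hum) fun u => s.nats 18 u 0]
      have := h.schedule.deg
      omega
    all_goals simp [progEntry, Program.exec, Test.Holds, NatExp.eval, assign_self, assign_ne,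
      upd_self, h10, h11, h12, hu, h17, h21, h22, hcond, hcard, hpow, hkey]

/-- The memory contains the tables of the partial derivatives and the schedule. -/
structure Scheduling (I : Terms) (s : Store) : Prop where
  valid : ∀ u, ∀ a < s.nats 18 u 0, s.nats 7 u a < I.m ∧ ∃ Q, s.nats 8 u a = setKey Q ∧ u ∈ Q ∧
    Q ⊆ Finset.range I.m ∧ s.nats 9 u a + 1 = Q.card ∧ Q.card ≤ I.k
  cover : ∀ t < I.T, ∀ v ∈ I.supp t, ∀ u ∈ I.supp t, u ≠ v → ∃ a < s.nats 18 u 0,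
    s.nats 7 u a = v ∧ s.nats 8 u a = setKey (((I.supp t).erase v).filter (u ≤ ·))
  length_le : ∑ u ∈ Finset.range I.m, s.nats 18 u 0 ≤ I.T * I.k ^ 2

/-- Every triple of a term and two of its factors makes at most one entry, which bounds both the
running time and the total length of the lists by a multiple of nnz · k² up to lower-order terms. An
entry may repeat when several terms have the same tail. -/
lemma progSchedule_does {I : Terms} {s : Store} (h : Listed I s)
    (h5 : ∀ t < I.T, s.nats 5 t 0 = setKey (I.supp t)) (h18 : s.nats 18 = fun _ _ => 0)
    (r5 : s.reals 5 = fun _ _ => 0) (r6 : s.reals 6 = fun _ _ => 0) :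
    Does progSchedule s (1000 * (I.T * (I.k + 1) ^ 2 + 1)) fun s' =>
      Frame [10, 11, 12, 22, 17, 21, 23, 7, 8, 9, 18] [5, 6] s s' ∧ Scheduling I s' ∧
      (∀ v, s'.table v = I.coef v) ∧
      ∀ v, s'.reals 6 v 0 = wnorm (5 * (1 / 16)) I.m (s'.table v) := by
  let Inv : ℕ → ℕ → Store → Prop := fun t j s' => TableInv I s (I.progress t j) s' ∧
    ScheduleInv I (fun t' j' _ => j' < I.progress t j t')
      (I.k * ∑ t' ∈ Finset.range I.T, I.progress t j t') s'
  have hset : ∀ t j s' c i, c ∈ [10, 11] → Inv t j s' → Inv t j (s'.setVar c i) := by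
    intro t j s' c i hc hI
    have hc' : c = 10 ∨ c = 11 := by simpa using hc
    refine ⟨hI.1.congr (hI.1.frame.setVar (by simp; tauto) _) rfl,
      hI.2.congr (fun a ha => Store.setVar_nats _ _ _ _ ?_) (fun _ _ _ _ _ h => h) le_rfl⟩
    simp at ha
    omega
  have start : Inv 0 0 s := by
    have h0 : s.table = fun _ _ => 0 := by
      funext v Q
      simp [Store.table, r5]
    refine ⟨⟨.refl _ _ _, fun v => ?_, fun v => ?_⟩, ⟨?_, ?_, ?_⟩⟩
    · funext Q
      simp [h0, Terms.coefPart, Terms.progress_zero, Terms.part_zero]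
    · simp [h0, r6, wnorm]
    · simp [h18]
    · simp [Terms.progress_zero]
    · simp [h18]
  have hloop := Does.forTo (c := 10) (B := .get 0 (.const 0) (.const 2))
    (p := forTo 11 (nvec 1 (nvar 10)) (.seq progEnter (forTo 12 (nvec 1 (nvar 10)) progEntry)))
    (s₀ := s) I.T (fun t s' => Inv t 0 s')
    (fun t => ∑ j ∈ Finset.range (I.w t),
      (300 + (∑ i ∈ Finset.range (I.w t), 200 + (I.w t + 1) * 23)) + (I.w t + 1) * 23)
    (hset _ _ _ _ _ (by simp) start)
    (fun t s' _ hI => by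
      have := (h.of_frame hI.1.frame (by decide) (by decide)).T
      simpa [NatExp.eval] using this)
    (fun t ht s' hc hI => by
      refine Does.mono (Does.forTo (I.w t) (fun j s'' => Inv t j s'' ∧ s''.nats 10 0 0 = t)
        (fun _ => 300 + (∑ i ∈ Finset.range (I.w t), 200 + (I.w t + 1) * 23)) ?_ ?_ ?_) le_rfl ?_
      · exact ⟨hset _ _ _ _ _ (by simp) hI, by simpa using hc⟩
      · intro j s'' _ ⟨hI', h10⟩
        have := (h.of_frame hI'.1.frame (by decide) (by decide)).w t ht
        simp [NatExp.eval, h10, this]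
      · intro j hj s'' hc' ⟨hI', h10⟩
        refine Does.seq (Q := fun s₁ => EntryInv I s t j 0 s₁) (Does.exec (by decide) (by decide) ?_)
          fun s₁ h₁ => Does.mono (Does.forTo (I.w t) (fun i s₁ => EntryInv I s t j i s₁)
            (fun _ => 200) (h₁.setVar 0) ?_ ?_) le_rfl ?_
        · obtain ⟨h1, h2, h3, h4⟩ := hI'.1.step h h5 ht hj (Terms.progress_self t j) h10 hc'
          rw [← Terms.progress_succ] at h1
          refine ⟨h1, hI'.2.congr (fun a ha => ?_) ?_ le_rfl, ?_, ?_, h2, ?_, ?_⟩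
          · refine (progEnter.frame_exec s'').nats a ?_
            simp [progEnter, Program.natArrays]
            simp at ha
            omega
          · rintro t' j' i' _ _ (h | h)
            · exact h
            · omega
          · simpa [progEnter, Program.exec, assign_ne] using h10
          · simpa [progEnter, Program.exec, assign_ne] using hc'
          · rw [Terms.later_zero ht hj, h3]
          · rw [Terms.later_zero ht hj, h4]
        · intro i s₂ _ hE
          have := (h.of_frame hE.tables.frame (by decide) (by decide)).w t ht
          simp [NatExp.eval, hE.h10, this]
        · intro i hi s₂ h12 hE
          refine Does.exec (by decide) (by decide) ⟨?_, (hE.step h ht hj hi h12).setVar _⟩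
          rw [(progEntry.frame_exec s₂).nats 12 (by decide)]
          exact h12
        · intro s₂ hE
          refine ⟨hE.h11, hset _ _ _ _ _ (by simp) ⟨hE.tables, hE.schedule.congr
            (fun _ _ => rfl) ?_ ?_⟩, ?_⟩
          · intro t' j' i' _ hi' hlt
            rw [Terms.progress_succ] at hlt
            by_cases htt : t' = t
            · subst htt
              rw [Function.update_self] at hlt
              rw [Terms.progress_self]
              rcases (Nat.lt_succ_iff.1 hlt).lt_or_eq with h' | h'
              · exact Or.inl h'
              · exact Or.inr ⟨rfl, h', hi'⟩
            · rw [Function.update_of_ne htt] at hlt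
              exact Or.inl hlt
          · have := sum_update_add_one (Finset.mem_range.2 ht) (I.progress t j)
            rw [Terms.progress_self, ← Terms.progress_succ] at this
            rw [this, mul_add, mul_one]
            have := I.w_le t ht
            omega
          · simpa using hE.h10
      · rintro s'' ⟨hI', h10⟩
        rw [show Inv t (I.w t) = Inv (t + 1) 0 by simp only [Inv, Terms.progress_next]] at hI'
        exact ⟨h10, hset _ _ _ _ _ (by simp) hI'⟩)
  refine hloop.mono ?_ fun s' hI => ⟨hI.1.frame, ⟨hI.2.valid, ?_, ?_⟩, ?_, hI.1.norm⟩
  · have : ∀ t ∈ Finset.range I.T, ∑ j ∈ Finset.range (I.w t),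
        (300 + (∑ i ∈ Finset.range (I.w t), 200 + (I.w t + 1) * 23)) + (I.w t + 1) * 23 ≤
        400 * (I.k + 1) ^ 2 := by
      intro t ht
      have := I.w_le t (Finset.mem_range.1 ht)
      simp only [Finset.sum_const, Finset.card_range, smul_eq_mul]
      calc _ ≤ I.k * (300 + (I.k * 200 + (I.k + 1) * 23)) + (I.k + 1) * 23 := by gcongr
        _ ≤ 400 * (I.k + 1) ^ 2 := by ring_nf; omega
    have := Finset.sum_le_card_nsmul _ _ _ this
    simp only [Finset.card_range, smul_eq_mul] at this
    have hT : I.T ≤ I.T * (I.k + 1) ^ 2 := Nat.le_mul_of_pos_right _ (by positivity)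
    rw [show I.T * (400 * (I.k + 1) ^ 2) = 400 * (I.T * (I.k + 1) ^ 2) by ring] at this
    simp only [NatExp.cost]
    omega
  · intro t ht v hv u hu huv
    obtain ⟨j, hj, rfl⟩ := Finset.mem_image.1 hv
    obtain ⟨i, hi, rfl⟩ := Finset.mem_image.1 hu
    exact hI.2.cover t ht j (Finset.mem_range.1 hj) i (Finset.mem_range.1 hi)
      (fun h => huv (by rw [h])) (by rw [Terms.progress_end ht]; exact Finset.mem_range.1 hj)
  · refine hI.2.deg.trans ?_
    rw [Finset.sum_congr rfl fun t ht => Terms.progress_end (Finset.mem_range.1 ht)]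
    calc I.k * ∑ t ∈ Finset.range I.T, I.w t ≤ I.k * (I.T * I.k) :=
          Nat.mul_le_mul_left _ (sum_w_le I)
      _ = I.T * I.k ^ 2 := by ring
  · intro v
    rw [hI.1.table, Terms.coefPart_end]

/-! ### The algorithm: the choice of the first point -/

/-- Loads one entry of the schedule. -/
def progLoadEntry : Program :=
  .seq (.setNat 22 (.const 0) (.const 0) (.get 7 (nvar 13) (nvar 14)))
  (.seq (.setNat 17 (.const 0) (.const 0) (.get 8 (nvar 13) (nvar 14)))
  (.setNat 21 (.const 0) (.const 0) (.get 9 (nvar 13) (nvar 14))))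

/-- Takes one coefficient of a monomial containing the current variable out of the table. -/
def progExtract : Program :=
  .seq progLoadEntry
  (.seq (.setReal 7 (nvar 14) (.const 0) (.get 5 (nvar 22) (nvar 17)))
  (.seq (.setReal 8 (.const 0) (.const 0) (.add (rvar 8)
    (.mul (.mul (rvec 7 (nvar 14)) (.get 5 (nvar 22) (.sub (nvar 17) (nvec 6 (nvar 13)))))
      (.sub (.mul (rvec 19 (nvar 22)) (rvec 3 (nvar 21)))
        (.mul (.mul (.mul (.const 2) (rvec 3 (.get 0 (.const 0) (.const 1))))
          (.mul (rvec 19 (nvar 22)) (.mul (rvec 19 (nvar 22)) (rvec 19 (nvar 22)))))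
          (.mul (rvec 6 (nvar 22)) (rvec 4 (nvar 21))))))))
  (.setReal 5 (nvar 22) (nvar 17) (.const 0))))

/-- Chooses the value of the current variable. -/
def progChoose : Program :=
  .seq (.ite (.realLe (.const 0) (rvar 8))
    (.setReal 9 (.const 0) (.const 0) (.const (1 / 4)))
    (.setReal 9 (.const 0) (.const 0) (.const (-1 / 4))))
  (.setReal 10 (nvar 13) (.const 0) (rvar 9))

/-- Puts one coefficient back after the substitution of the current variable. -/
def progInsert : Program :=
  .seq progLoadEntry
  (.seq (.setReal 6 (nvar 22) (.const 0) (.sub (.add (rvec 6 (nvar 22)) (.mul (rvec 4 (nvar 21))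
    (.sub (.mul (.add (.get 5 (nvar 22) (.sub (nvar 17) (nvec 6 (nvar 13))))
          (.mul (rvar 9) (rvec 7 (nvar 14))))
        (.add (.get 5 (nvar 22) (.sub (nvar 17) (nvec 6 (nvar 13))))
          (.mul (rvar 9) (rvec 7 (nvar 14)))))
      (.mul (.get 5 (nvar 22) (.sub (nvar 17) (nvec 6 (nvar 13))))
        (.get 5 (nvar 22) (.sub (nvar 17) (nvec 6 (nvar 13))))))))
    (.mul (rvec 4 (.add (nvar 21) (.const 1))) (.mul (rvec 7 (nvar 14)) (rvec 7 (nvar 14))))))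
  (.setReal 5 (nvar 22) (.sub (nvar 17) (nvec 6 (nvar 13)))
    (.add (.get 5 (nvar 22) (.sub (nvar 17) (nvec 6 (nvar 13))))
      (.mul (rvar 9) (rvec 7 (nvar 14))))))

/-- Takes the coefficients of all monomials containing the current variable out of the table. -/
def progExtractAll : Program :=
  .seq (.setReal 8 (.const 0) (.const 0) (.const 0)) (forTo 14 (nvec 18 (nvar 13)) progExtract)

/-- Puts the coefficients back after the substitution of the current variable. -/
def progInsertAll : Program := forTo 14 (nvec 18 (nvar 13)) progInsert

/-- Chooses the values of all variables. -/
def progEliminate : Program :=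
  forTo 13 (nvar 16) (.seq progExtractAll (.seq progChoose progInsertAll))

/-! ### Elimination of one variable from the table. -/

/-- The eliminations of the variable `u` are those of the monomials `Q a`. -/
structure Entries (I : Terms) (u : ℕ) (Q : ℕ → Finset ℕ) (s : Store) : Prop where
  row_lt : ∀ a < s.nats 18 u 0, s.nats 7 u a < I.m
  key : ∀ a < s.nats 18 u 0, s.nats 8 u a = setKey (Q a)
  mem : ∀ a < s.nats 18 u 0, u ∈ Q a
  subset : ∀ a < s.nats 18 u 0, Q a ⊆ Finset.range I.m
  card : ∀ a < s.nats 18 u 0, s.nats 9 u a = ((Q a).erase u).card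
  card_le : ∀ a < s.nats 18 u 0, (Q a).card ≤ I.k

lemma Scheduling.exists_entries {I : Terms} {s : Store} (h : Scheduling I s) (u : ℕ) :
    ∃ Q, Entries I u Q s := by
  choose! h1 Q h2 h3 h4 h5 h6 using h.valid u
  refine ⟨Q, h1, h2, h3, h4, fun a ha => ?_, h6⟩
  rw [Finset.card_erase_of_mem (h3 a ha), ← h5 a ha]
  rfl

lemma Entries.of_frame {I : Terms} {u : ℕ} {Q : ℕ → Finset ℕ} {s s' : Store} {N R : List ℕ}
    (h : Entries I u Q s) (hf : Frame N R s s') (hN : ∀ a ∈ [7, 8, 9, 18], a ∉ N) :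
    Entries I u Q s' := by
  have h7 := hf.nats 7 (hN _ (by simp))
  have h8 := hf.nats 8 (hN _ (by simp))
  have h9 := hf.nats 9 (hN _ (by simp))
  have h18 := hf.nats 18 (hN _ (by simp))
  constructor
  · rw [h7, h18]; exact h.row_lt
  · rw [h8, h18]; exact h.key
  · rw [h18]; exact h.mem
  · rw [h18]; exact h.subset
  · rw [h9, h18]; exact h.card
  · rw [h18]; exact h.card_le

lemma Scheduling.of_frame {I : Terms} {s s' : Store} {N R : List ℕ} (h : Scheduling I s)
    (hf : Frame N R s s') (hN : ∀ a ∈ [7, 8, 9, 18], a ∉ N) : Scheduling I s' := by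
  have h7 := hf.nats 7 (hN _ (by simp))
  have h8 := hf.nats 8 (hN _ (by simp))
  have h9 := hf.nats 9 (hN _ (by simp))
  have h18 := hf.nats 18 (hN _ (by simp))
  constructor
  · rw [h7, h8, h9, h18]; exact h.valid
  · rw [h7, h8, h18]; exact h.cover
  · rw [h18]; exact h.length_le

/-- The coefficient of a product of two coefficients of the row `v` in the gain. -/
def gainWeight (I : Terms) (c : ℕ → Finset ℕ → ℝ) (v : ℕ) (Q : Finset ℕ) : ℝ :=
  1 / √(I.infl v) * (1 / 16) ^ Q.card - 2 * (1 / 16) ^ I.k * (1 / √(I.infl v)) ^ 3 *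
    wnorm (5 * (1 / 16)) I.m (c v) * (5 * (1 / 16)) ^ Q.card

lemma gain_eq (I : Terms) (u : ℕ) (c : ℕ → Finset ℕ → ℝ) :
    gain (fun v => 1 / √(I.infl v)) ((1 / 16) ^ I.k) (1 / 16) I.m u c =
      ∑ v ∈ Finset.range I.m, ∑ Q ∈ ((Finset.range I.m).erase u).powerset,
        gainWeight I c v Q * c v Q * c v (insert u Q) := by
  refine Finset.sum_congr rfl fun v _ => ?_
  rw [cross, cross, Finset.mul_sum, Finset.mul_sum, ← Finset.sum_sub_distrib]
  refine Finset.sum_congr rfl fun Q _ => ?_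
  rw [gainWeight]
  ring

/-- The state of taking the coefficients of the monomials containing `u` out of the table `c`. -/
structure ExtractInv (I : Terms) (s₀ : Store) (u : ℕ) (Q : ℕ → Finset ℕ) (a : ℕ) (s : Store) :
    Prop where
  frame : Frame [14, 22, 17, 21] [5, 7, 8] s₀ s
  notMem : ∀ v R, u ∉ R → s.table v R = s₀.table v R
  mem : ∀ v R, u ∈ R → s.table v R + (∑ b ∈ Finset.range a,
    if s₀.nats 7 u b = v ∧ Q b = R then s.reals 7 b 0 else 0) = s₀.table v R
  zero : ∀ b < a, s.table (s₀.nats 7 u b) (Q b) = 0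
  zero_of : ∀ v R, s₀.table v R = 0 → s.table v R = 0
  norm : ∀ v, wnorm (5 * (1 / 16)) I.m (s.table v) + (∑ b ∈ Finset.range a,
    if s₀.nats 7 u b = v then (5 * (1 / 16)) ^ (Q b).card * s.reals 7 b 0 ^ 2 else 0) =
      wnorm (5 * (1 / 16)) I.m (s₀.table v)
  gain : s.reals 8 0 0 + ∑ v ∈ Finset.range I.m, ∑ R ∈ ((Finset.range I.m).erase u).powerset,
      gainWeight I s₀.table v R * s₀.table v R * s.table v (insert u R) =
    gain (fun v => 1 / √(I.infl v)) ((1 / 16) ^ I.k) (1 / 16) I.m u s₀.table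

/-- The memory contains all tables needed for the elimination. -/
structure Ready (I : Terms) (s : Store) : Prop extends Listed I s, Scheduling I s where
  inv : ∀ v < I.m, s.reals 19 v 0 = 1 / √(I.infl v)

lemma Ready.of_frame {I : Terms} {s s' : Store} {N R : List ℕ} (h : Ready I s)
    (hf : Frame N R s s') (hN : ∀ a ∈ [0, 1, 2, 3, 6, 16, 4, 19, 20, 7, 8, 9, 18], a ∉ N)
    (hR : ∀ a ∈ [0, 3, 4, 19], a ∉ R) : Ready I s' := by
  refine ⟨h.toListed.of_frame hf (fun a ha => hN a ?_) fun a ha => hR a ?_,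
    h.toScheduling.of_frame hf fun a ha => hN a ?_, ?_⟩
  · simp at ha ⊢; tauto
  · simp at ha ⊢; tauto
  · simp at ha ⊢; tauto
  · rw [hf.reals 19 (hR _ (by simp))]; exact h.inv

lemma setKey_sub_two_pow {u : ℕ} {Q : Finset ℕ} (hu : u ∈ Q) :
    setKey Q - 2 ^ u = setKey (Q.erase u) := by
  rw [setKey, ← Finset.add_sum_erase _ _ hu, setKey]
  omega

lemma sum_range_succ_congr {a : ℕ} {f g : ℕ → ℝ} (h : ∀ b < a, f b = g b) :
    ∑ b ∈ Finset.range (a + 1), f b = ∑ b ∈ Finset.range a, g b + f a := by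
  rw [Finset.sum_range_succ, Finset.sum_congr rfl fun b hb => h b (Finset.mem_range.1 hb)]

lemma ExtractInv.setVar {I : Terms} {s₀ s : Store} {u a : ℕ} {Q : ℕ → Finset ℕ}
    (h : ExtractInv I s₀ u Q a s) (i : ℕ) : ExtractInv I s₀ u Q a (s.setVar 14 i) :=
  ⟨h.frame.setVar (by decide) _, h.notMem, h.mem, h.zero, h.zero_of, h.norm, h.gain⟩

/-- The same entry of the table may be listed several times. It is set to zero once read, so later
occurrences save the value 0 and each coefficient counts once. The norms in real array 6 are
deliberately not updated here, since the gain refers to the table before the extraction. -/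
lemma ExtractInv.step {I : Terms} {s₀ s : Store} {u a : ℕ} {Q : ℕ → Finset ℕ}
    (h : ExtractInv I s₀ u Q a s) (h₀ : Ready I s₀) (hQ : Entries I u Q s₀)
    (hM : ∀ v, s₀.reals 6 v 0 = wnorm (5 * (1 / 16)) I.m (s₀.table v)) (hu : u < I.m)
    (h13 : s₀.nats 13 0 0 = u) (ha : a < s₀.nats 18 u 0) (h14 : s.nats 14 0 0 = a) :
    ExtractInv I s₀ u Q (a + 1) (progExtract.exec s) := by
  have hs : Ready I s := h₀.of_frame h.frame (by decide) (by decide)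
  have h13' : s.nats 13 0 0 = u := by rw [h.frame.nats 13 (by decide), h13]
  have h7 : s.nats 7 u a = s₀.nats 7 u a := by rw [h.frame.nats 7 (by decide)]
  have h8 : s.nats 8 u a = setKey (Q a) := by rw [h.frame.nats 8 (by decide), hQ.key a ha]
  have h9 : s.nats 9 u a = ((Q a).erase u).card := by
    rw [h.frame.nats 9 (by decide), hQ.card a ha]
  have hv := hQ.row_lt a ha
  have hmem := hQ.mem a ha
  have hsub := hQ.subset a ha
  have hcard : ((Q a).erase u).card ≤ I.k := Finset.card_erase_le.trans (hQ.card_le a ha)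
  have hp := hs.p _ hcard
  have hp' := hs.p' _ hcard
  have hpk := hs.p _ le_rfl
  have hkk := hs.k
  have hpow := hs.pow _ hu.le
  have hinv := hs.inv _ hv
  have hnorm : s.reals 6 (s₀.nats 7 u a) 0 =
      wnorm (5 * (1 / 16)) I.m (s₀.table (s₀.nats 7 u a)) := by
    rw [h.frame.reals 6 (by decide), hM]
  have hkey := setKey_sub_two_pow hmem
  set v := s₀.nats 7 u a with hvdef
  have htab : s.reals 5 v (setKey ((Q a).erase u)) = s₀.table v ((Q a).erase u) :=
    h.notMem v _ (Finset.notMem_erase _ _)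
  have hne : setKey ((Q a).erase u) ≠ setKey (Q a) := fun he =>
    Finset.notMem_erase u (Q a) (by rw [setKey_injective he]; exact hmem)
  have e5 : (progExtract.exec s).reals 5 = upd (s.reals 5) v (setKey (Q a)) 0 := by
    simp [progExtract, progLoadEntry, Program.exec, NatExp.eval, RealExp.eval, assign_self,
      assign_ne, upd_self, h13', h14, h7, h8]
  have e7 : (progExtract.exec s).reals 7 = upd (s.reals 7) a 0 (s.table v (Q a)) := by
    simp [progExtract, progLoadEntry, Program.exec, NatExp.eval, RealExp.eval, assign_self,
      assign_ne, upd_self, h13', h14, h7, h8, Store.table]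
  have e8 : (progExtract.exec s).reals 8 0 0 = s.reals 8 0 0 + s.table v (Q a) *
      (s₀.table v ((Q a).erase u) * gainWeight I s₀.table v ((Q a).erase u)) := by
    simp only [progExtract, progLoadEntry, Program.exec, NatExp.eval, RealExp.eval, assign_self,
      assign_ne, upd_self, h13', h14, h7, h8, h9, Store.table, ne_eq,
      Nat.reduceEqDiff, not_false_eq_true, hpow, hkey, hp, hp', hkk, hpk, hinv, hnorm,
      gainWeight]
    rw [htab]
    push_cast
    simp only [Store.table]
    ring
  have hold : ∀ b < a, (progExtract.exec s).reals 7 b 0 = s.reals 7 b 0 := by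
    intro b hb
    simp [e7, upd, hb.ne]
  have hnew : (progExtract.exec s).reals 7 a 0 = s.table v (Q a) := by simp [e7, upd]
  have etab : ∀ v', (progExtract.exec s).table v' =
      if v' = v then Function.update (s.table v) (Q a) 0 else s.table v' := by
    intro v'
    have := upd_setKey (s.reals 5) v v' (Q a) 0
    rw [← e5] at this
    exact this
  have etab' : ∀ v' R, (progExtract.exec s).table v' R =
      if v = v' ∧ Q a = R then 0 else s.table v' R := by
    intro v' R
    rw [etab]
    by_cases h1 : v' = v
    · subst h1
      by_cases h2 : R = Q a
      · subst h2; simp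
      · simp [h2, Ne.symm h2]
    · simp [h1, Ne.symm h1]
  refine ⟨h.frame.exec _ (by decide) (by decide), fun v' R hR => ?_, fun v' R hR => ?_,
    fun b hb => ?_, fun v' R hR => ?_, fun v' => ?_, ?_⟩
  · rw [etab', if_neg, h.notMem v' R hR]
    rintro ⟨-, rfl⟩
    exact hR hmem
  · rw [sum_range_succ_congr (g := fun b => if s₀.nats 7 u b = v' ∧ Q b = R then s.reals 7 b 0
      else 0) fun b hb => by rw [hold b hb], hnew, etab', ← h.mem v' R hR, ← hvdef]
    split_ifs with hc
    · rw [hc.1, hc.2]; ring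
    · ring
  · rw [etab']
    split_ifs with hc
    · rfl
    · rcases (Nat.lt_succ_iff.1 hb).lt_or_eq with hb' | rfl
      · exact h.zero b hb'
      · exact absurd ⟨rfl, rfl⟩ hc
  · rw [etab', h.zero_of v' R hR, ite_self]
  · rw [sum_range_succ_congr (g := fun b => if s₀.nats 7 u b = v' then
      (5 * (1 / 16)) ^ (Q b).card * s.reals 7 b 0 ^ 2 else 0) fun b hb => by rw [hold b hb], hnew,
      etab, ← h.norm v', ← hvdef]
    by_cases hc : v' = v
    · rw [if_pos hc, if_pos hc.symm, wnorm_update hsub, hc]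
      ring
    · rw [if_neg hc, if_neg (Ne.symm hc)]
      ring
  -- Clearing the entry `Q a` of row v changes only the summand for `(Q a).erase u` in that row, and
  -- that amount has moved into the accumulator.
  · have hins : ∀ v' ∈ Finset.range I.m, ∑ R ∈ ((Finset.range I.m).erase u).powerset,
        gainWeight I s₀.table v' R * s₀.table v' R * (progExtract.exec s).table v' (insert u R) =
        ∑ R ∈ ((Finset.range I.m).erase u).powerset,
          gainWeight I s₀.table v' R * s₀.table v' R * s.table v' (insert u R) -
        if v = v' then gainWeight I s₀.table v ((Q a).erase u) * s₀.table v ((Q a).erase u) *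
          s.table v (Q a) else 0 := by
      intro v' _
      rw [eq_sub_iff_add_eq]
      have hQm : (Q a).erase u ∈ ((Finset.range I.m).erase u).powerset :=
        Finset.mem_powerset.2 (Finset.erase_subset_erase _ hsub)
      by_cases hc : v = v'
      · subst hc
        rw [if_pos rfl, ← Finset.add_sum_erase _ _ hQm,
          ← Finset.add_sum_erase _ (fun R => _ * s.table v (insert u R)) hQm, etab',
          Finset.insert_erase hmem, if_pos ⟨rfl, rfl⟩]
        have : ∀ R ∈ (((Finset.range I.m).erase u).powerset).erase ((Q a).erase u),
            gainWeight I s₀.table v R * s₀.table v R * (progExtract.exec s).table v (insert u R) =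
            gainWeight I s₀.table v R * s₀.table v R * s.table v (insert u R) := by
          intro R hR
          rw [etab', if_neg]
          rintro ⟨-, h2⟩
          refine Finset.ne_of_mem_erase hR ?_
          rw [h2, Finset.erase_insert (notMem_of_mem_powerset_erase (Finset.mem_of_mem_erase hR))]
        rw [Finset.sum_congr rfl this]
        ring
      · rw [if_neg hc, add_zero]
        refine Finset.sum_congr rfl fun R _ => ?_
        rw [etab', if_neg fun h => hc h.1]
    rw [Finset.sum_congr rfl hins, Finset.sum_sub_distrib, Finset.sum_ite_eq,
      if_pos (Finset.mem_range.2 hv), e8, ← h.gain]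
    ring

/-- The state of putting the coefficients of the monomials containing `u` back into the table after
the substitution of `y` for `u`. -/
structure InsertInv (I : Terms) (s₀ s₁ : Store) (u : ℕ) (Q : ℕ → Finset ℕ) (y : ℝ) (a : ℕ)
    (s : Store) : Prop where
  frame : Frame [14, 22, 17, 21] [5, 6] s₁ s
  mem : ∀ v R, u ∈ R → s.table v R = 0
  notMem : ∀ v R, u ∉ R → s.table v R = s₀.table v R + y * ∑ b ∈ Finset.range a,
    if s₀.nats 7 u b = v ∧ Q b = insert u R then s₁.reals 7 b 0 else 0
  norm : ∀ v, s.reals 6 v 0 = wnorm (5 * (1 / 16)) I.m (s.table v) +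
    ∑ b ∈ Finset.Ico a (s₀.nats 18 u 0),
      if s₀.nats 7 u b = v then (5 * (1 / 16)) ^ (Q b).card * s₁.reals 7 b 0 ^ 2 else 0

lemma InsertInv.setVar {I : Terms} {s₀ s₁ s : Store} {u a : ℕ} {Q : ℕ → Finset ℕ} {y : ℝ}
    (h : InsertInv I s₀ s₁ u Q y a s) (i : ℕ) : InsertInv I s₀ s₁ u Q y a (s.setVar 14 i) :=
  ⟨h.frame.setVar (by decide) _, h.mem, h.notMem, h.norm⟩

/-- The saved coefficient of Q, times the chosen value, is added to the coefficient of Q without u.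
The stored norm follows by one update for the changed entry and by dropping the old contribution of
Q; values still waiting account for the sum in the invariant. A repeated entry carries the value 0
and does nothing. -/
lemma InsertInv.step {I : Terms} {s₀ s₁ s : Store} {u a : ℕ} {Q : ℕ → Finset ℕ} {y : ℝ}
    (h : InsertInv I s₀ s₁ u Q y a s) (h₁ : Ready I s₁) (hQ : Entries I u Q s₁)
    (h18 : s₀.nats 18 = s₁.nats 18) (h7 : s₀.nats 7 = s₁.nats 7) (hu : u < I.m)
    (h13 : s₁.nats 13 0 0 = u) (hy : s₁.reals 9 0 0 = y) (ha : a < s₁.nats 18 u 0)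
    (h14 : s.nats 14 0 0 = a) :
    InsertInv I s₀ s₁ u Q y (a + 1) (progInsert.exec s) := by
  have hs : Ready I s := h₁.of_frame h.frame (by decide) (by decide)
  have h13' : s.nats 13 0 0 = u := by rw [h.frame.nats 13 (by decide), h13]
  have h7' : s.nats 7 u a = s₀.nats 7 u a := by rw [h.frame.nats 7 (by decide), h7]
  have h8 : s.nats 8 u a = setKey (Q a) := by rw [h.frame.nats 8 (by decide), hQ.key a ha]
  have h9 : s.nats 9 u a = ((Q a).erase u).card := by
    rw [h.frame.nats 9 (by decide), hQ.card a ha]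
  have hy' : s.reals 9 0 0 = y := by rw [h.frame.reals 9 (by decide), hy]
  have ht : s.reals 7 a 0 = s₁.reals 7 a 0 := by rw [h.frame.reals 7 (by decide)]
  have hv := hQ.row_lt a ha
  have hmem := hQ.mem a ha
  have hsub := hQ.subset a ha
  have hcard1 : ((Q a).erase u).card + 1 = (Q a).card := Finset.card_erase_add_one hmem
  have hcard : ((Q a).erase u).card ≤ I.k := Finset.card_erase_le.trans (hQ.card_le a ha)
  have hp' := hs.p' _ hcard
  have hp1 := hs.p' _ (hQ.card_le a ha)
  have hpow := hs.pow _ hu.le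
  have hkey := setKey_sub_two_pow hmem
  set v := s₀.nats 7 u a with hvdef
  have hR := Finset.notMem_erase u (Q a)
  have hinsR := Finset.insert_erase hmem
  have hsubR : (Q a).erase u ⊆ Finset.range I.m := (Finset.erase_subset _ _).trans hsub
  set R₀ := (Q a).erase u with hR₀
  clear_value R₀
  have e5 : (progInsert.exec s).reals 5 =
      upd (s.reals 5) v (setKey R₀) (s.table v R₀ + y * s₁.reals 7 a 0) := by
    simp [progInsert, progLoadEntry, Program.exec, NatExp.eval, RealExp.eval, assign_self,
      assign_ne, upd_self, h13', h14, h7', h8, hpow, hkey, hy', ht, Store.table]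
  have e6 : (progInsert.exec s).reals 6 = upd (s.reals 6) v 0 (s.reals 6 v 0 +
      (5 * (1 / 16)) ^ R₀.card * ((s.table v R₀ + y * s₁.reals 7 a 0) *
        (s.table v R₀ + y * s₁.reals 7 a 0) - s.table v R₀ * s.table v R₀) -
      (5 * (1 / 16)) ^ (Q a).card * (s₁.reals 7 a 0 * s₁.reals 7 a 0)) := by
    simp [progInsert, progLoadEntry, Program.exec, NatExp.eval, RealExp.eval, assign_self,
      assign_ne, upd_self, h13', h14, h7', h8, h9, hpow, hkey, hy', ht, hp', hcard1, hp1,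
      Store.table]
  have etab : ∀ v', (progInsert.exec s).table v' = if v' = v then
      Function.update (s.table v) R₀ (s.table v R₀ + y * s₁.reals 7 a 0) else s.table v' := by
    intro v'
    have := upd_setKey (s.reals 5) v v' R₀ (s.table v R₀ + y * s₁.reals 7 a 0)
    rw [← e5] at this
    exact this
  have etab' : ∀ v' R, (progInsert.exec s).table v' R = s.table v' R +
      y * if v = v' ∧ R₀ = R then s₁.reals 7 a 0 else 0 := by
    intro v' R
    rw [etab]
    by_cases h1 : v' = v
    · subst h1
      by_cases h2 : R = R₀
      · subst h2; simp
      · simp [h2, Ne.symm h2]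
    · simp [h1, Ne.symm h1]
  have hiff : ∀ R, u ∉ R → (Q a = insert u R ↔ R₀ = R) := by
    intro R huR
    rw [← hinsR]
    constructor
    · intro he
      rw [← Finset.erase_insert hR, he, Finset.erase_insert huR]
    · rintro rfl
      rfl
  refine ⟨h.frame.exec _ (by decide) (by decide), fun v' R huR => ?_, fun v' R huR => ?_,
    fun v' => ?_⟩
  · rw [etab', if_neg, h.mem v' R huR, mul_zero, add_zero]
    rintro ⟨-, rfl⟩
    exact hR huR
  · rw [etab', h.notMem v' R huR, Finset.sum_range_succ, ← hvdef]
    simp only [hiff R huR]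
    ring
  · have hlt : a < s₀.nats 18 u 0 := by rw [h18]; exact ha
    have hn := h.norm v'
    rw [Finset.sum_eq_sum_Ico_succ_bot hlt, ← hvdef] at hn
    rw [etab, e6]
    by_cases hc : v' = v
    · subst hc
      rw [if_pos rfl] at hn
      rw [if_pos rfl, upd_self, hn, wnorm_update hsubR]
      ring
    · rw [if_neg (Ne.symm hc)] at hn
      rw [if_neg hc]
      simp only [upd, hc, false_and, if_false]
      rw [hn]
      ring

/-- The values of the variables below `u` have been chosen. -/
structure EliminateInv (I : Terms) (s₀ : Store) (u : ℕ) (s : Store) : Prop where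
  frame : Frame [13, 14, 22, 17, 21] [5, 6, 7, 8, 9, 10] s₀ s
  stage : ∃ y, Stage I (fun v => 1 / √(I.infl v)) ((1 / 16) ^ I.k) u y s.table ∧
    ∀ i < u, s.reals 10 i 0 = y i
  norm : ∀ v, s.reals 6 v 0 = wnorm (5 * (1 / 16)) I.m (s.table v)

lemma EliminateInv.setVar {I : Terms} {s₀ s : Store} {u : ℕ} (h : EliminateInv I s₀ u s) (i : ℕ) :
    EliminateInv I s₀ u (s.setVar 13 i) :=
  ⟨h.frame.setVar (by decide) _, h.stage, h.norm⟩

/-- Every nonzero coefficient with u in its monomial belongs to a tail of a term, hence is scheduled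
and has been cleared. The uncollected part of the gain then vanishes and the accumulator holds all
of it. -/
lemma ExtractInv.finish {I : Terms} {s₀ s : Store} {u : ℕ} {Q : ℕ → Finset ℕ}
    (h : ExtractInv I s₀ u Q (s₀.nats 18 u 0) s) (h₀ : Ready I s₀) (hQ : Entries I u Q s₀)
    {y : ℕ → ℝ} {f : ℕ → ℝ} {β : ℝ} (hst : Stage I f β u y s₀.table) :
    (∀ v R, u ∈ R → s.table v R = 0) ∧
    s.reals 8 0 0 = ProductStates.gain (fun v => 1 / √(I.infl v)) ((1 / 16) ^ I.k) (1 / 16) I.m u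
      s₀.table := by
  have hz : ∀ v R, u ∈ R → s.table v R = 0 := by
    intro v R hR
    by_cases hc : s₀.table v R = 0
    · exact h.zero_of v R hc
    · obtain ⟨t, ht, hv, rfl⟩ := hst.support v R hc
      have huR := (Finset.mem_filter.1 hR).1
      obtain ⟨a, ha, h7, h8⟩ := h₀.cover t ht v hv u (Finset.mem_of_mem_erase huR)
        (Finset.ne_of_mem_erase huR)
      rw [hQ.key a ha] at h8
      rw [← setKey_injective h8, ← h7]
      exact h.zero a ha
  refine ⟨hz, ?_⟩
  rw [← h.gain, Finset.sum_eq_zero, add_zero]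
  intro v _
  refine Finset.sum_eq_zero fun R _ => ?_
  rw [hz v _ (Finset.mem_insert_self _ _), mul_zero]

lemma progExtractAll_does {I : Terms} {s : Store} {u : ℕ} {Q : ℕ → Finset ℕ} (hs : Ready I s)
    (hQ : Entries I u Q s) (hM : ∀ v, s.reals 6 v 0 = wnorm (5 * (1 / 16)) I.m (s.table v))
    (hu : u < I.m) (h13 : s.nats 13 0 0 = u) :
    Does progExtractAll s (400 * (s.nats 18 u 0 + 1)) (ExtractInv I s u Q (s.nats 18 u 0)) := by
  refine Does.le (T := 10 + (∑ a ∈ Finset.range (s.nats 18 u 0), 300 + (s.nats 18 u 0 + 1) * 23))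
    (Does.seq (Q := ExtractInv I s u Q 0) (Does.exec (by decide) (by decide) ?_)
      fun s₁ h₁ => Does.forTo (s.nats 18 u 0) (fun a s' => ExtractInv I s u Q a s') (fun _ => 300)
        (h₁.setVar 0) ?_ ?_) ?_
  · refine ⟨(Frame.refl _ _ _).exec _ (by decide) (by decide), fun _ _ _ => rfl,
      fun v R _ => by simp; rfl, by simp, fun _ _ h => h, fun v => by simp; rfl, ?_⟩
    rw [gain_eq]
    simp only [Program.exec, assign_self, NatExp.eval, RealExp.eval, upd_self, Rat.cast_zero,
      zero_add]
    rfl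
  · intro a s' _ hI
    simp [NatExp.eval, hI.frame.nats 13, hI.frame.nats 18, h13]
  · intro a ha s' h14 hI
    refine Does.exec (by decide) (by decide)
      ⟨?_, (hI.step hs hQ hM hu h13 ha h14).setVar _⟩
    rw [(progExtract.frame_exec s').nats 14 (by decide)]
    exact h14
  · simp only [Finset.sum_const, Finset.card_range, smul_eq_mul]
    omega

lemma progChoose_does {s : Store} {u : ℕ} (h13 : s.nats 13 0 0 = u) :
    Does progChoose s 50 fun s' => Frame [] [9, 10] s s' ∧
      s'.reals 9 0 0 = (if 0 ≤ s.reals 8 0 0 then 1 / 4 else -1 / 4) ∧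
      s'.reals 10 = upd (s.reals 10) u 0 (if 0 ≤ s.reals 8 0 0 then 1 / 4 else -1 / 4) := by
  refine Does.exec (by decide) (by decide) ⟨(Frame.refl _ _ _).exec _ (by decide) (by decide), ?_, ?_⟩
  · simp only [progChoose, Program.exec, Test.Holds, NatExp.eval, RealExp.eval, Rat.cast_zero]
    split_ifs <;> simp [assign_self, assign_ne, upd_self]
  · simp only [progChoose, Program.exec, Test.Holds, NatExp.eval, RealExp.eval, Rat.cast_zero]
    split_ifs <;> simp [assign_self, assign_ne, upd_self, h13]

lemma progInsertAll_does {I : Terms} {s₀ s : Store} {u : ℕ} {Q : ℕ → Finset ℕ} {y : ℝ}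
    (hs : Ready I s) (hQ : Entries I u Q s) (h18 : s₀.nats 18 = s.nats 18)
    (h7 : s₀.nats 7 = s.nats 7) (hu : u < I.m) (h13 : s.nats 13 0 0 = u)
    (hy : s.reals 9 0 0 = y) (hI : InsertInv I s₀ s u Q y 0 s) :
    Does progInsertAll s (400 * (s.nats 18 u 0 + 1))
      (InsertInv I s₀ s u Q y (s.nats 18 u 0)) := by
  refine Does.le (T := ∑ a ∈ Finset.range (s.nats 18 u 0), 300 + (s.nats 18 u 0 + 1) * 23)
    (Does.forTo (s.nats 18 u 0) (fun a s' => InsertInv I s₀ s u Q y a s') (fun _ => 300)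
      (hI.setVar 0) ?_ ?_) ?_
  · intro a s' _ hI
    simp [NatExp.eval, hI.frame.nats 13, hI.frame.nats 18, h13]
  · intro a ha s' h14 hI
    refine Does.exec (by decide) (by decide)
      ⟨?_, (hI.step hs hQ h18 h7 hu h13 hy ha h14).setVar _⟩
    rw [(progInsert.frame_exec s').nats 14 (by decide)]
    exact h14
  · simp only [Finset.sum_const, Finset.card_range, smul_eq_mul]
    omega

/-- Extraction, choice and insertion together realize `subst` in every row, with the sign dictated
by the gain, so `Stage.step` applies. -/
lemma EliminateInv.does {I : Terms} {s₀ s : Store} {u : ℕ} (h : EliminateInv I s₀ u s)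
    (h₀ : Ready I s₀) (hu : u < I.m) (h13 : s.nats 13 0 0 = u) :
    Does (.seq progExtractAll (.seq progChoose progInsertAll)) s
      (1000 * (s₀.nats 18 u 0 + 1)) fun s' => s'.nats 13 0 0 = u ∧ EliminateInv I s₀ (u + 1) s' := by
  have hs : Ready I s := h₀.of_frame h.frame (by decide) (by decide)
  obtain ⟨y, hst, hy⟩ := h.stage
  obtain ⟨Q, hQ⟩ := hs.exists_entries u
  have hdeg : s.nats 18 u 0 = s₀.nats 18 u 0 := by rw [h.frame.nats 18 (by decide)]
  have extract := progExtractAll_does hs hQ h.norm hu h13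
  rw [hdeg] at extract
  refine (extract.seq (T' := 50 + 400 * (s₀.nats 18 u 0 + 1)) fun s₁ h₁ => ?_).le (by omega)
  have h13' : s₁.nats 13 0 0 = u := by rw [h₁.frame.nats 13 (by decide), h13]
  rw [← hdeg] at h₁
  obtain ⟨hz, hg⟩ := h₁.finish hs hQ hst
  refine (progChoose_does h13').seq fun s₂ ⟨hf₂, h9, h10⟩ => ?_
  rw [hg] at h9 h10
  rw [h₁.frame.reals 10 (by decide)] at h10
  obtain ⟨r, hr⟩ : ∃ r : ℝ, r = if 0 ≤ gain (fun v => 1 / √(I.infl v)) ((1 / 16) ^ I.k) (1 / 16)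
    I.m u s.table then 1 / 4 else -1 / 4 := ⟨_, rfl⟩
  rw [← hr] at h9 h10
  have h12 : Ready I s₂ := (hs.of_frame h₁.frame (by decide) (by decide)).of_frame hf₂ (by decide)
    (by decide)
  have hE : Entries I u Q s₂ := (hQ.of_frame h₁.frame (by decide)).of_frame hf₂ (by decide)
  have n18 : s.nats 18 = s₂.nats 18 := by
    rw [hf₂.nats 18 (by decide), h₁.frame.nats 18 (by decide)]
  have n7 : s.nats 7 = s₂.nats 7 := by
    rw [hf₂.nats 7 (by decide), h₁.frame.nats 7 (by decide)]
  have n13 : s₂.nats 13 0 0 = u := by rw [hf₂.nats 13 (by decide), h13']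
  -- The stored norms still belong to the table before the extraction: they are the norms of the
  -- cleared table plus all waiting contributions.
  have start : InsertInv I s s₂ u Q r 0 s₂ := by
    have htab : s₂.table = s₁.table := by
      funext v R
      rw [Store.table, hf₂.reals 5 (by decide)]
      rfl
    refine ⟨.refl _ _ _, by rw [htab]; exact hz, fun v R hR => ?_, fun v => ?_⟩
    · rw [htab]
      simpa using h₁.notMem v R hR
    · rw [htab, hf₂.reals 6 (by decide), hf₂.reals 7 (by decide), h₁.frame.reals 6 (by decide),
        h.norm, ← h₁.norm v, ← Finset.range_eq_Ico]
  have hdeg' : s₂.nats 18 u 0 = s₀.nats 18 u 0 := by rw [← n18, hdeg]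
  have insert := progInsertAll_does h12 hE n18 n7 hu n13 h9 start
  refine insert.mono (by rw [hdeg']) fun s' hI => ?_
  rw [← n18] at hI
  have htab : s'.table = fun v => subst u r (s.table v) := by
    funext v R
    by_cases hR : u ∈ R
    · rw [hI.mem v R hR]
      simp [subst, hR]
    -- The entry is now zero, so the values saved for it add up to its former coefficient.
    · have h1 := h₁.mem v (Insert.insert u R) (Finset.mem_insert_self _ _)
      rw [hz _ _ (Finset.mem_insert_self _ _), zero_add] at h1
      rw [hI.notMem v R hR, hf₂.reals 7 (by decide), h1]
      simp only [subst, hR, if_false]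
  have hF : Frame [13, 14, 22, 17, 21] [5, 6, 7, 8, 9, 10] s s' :=
    ((h₁.frame.mono (by decide) (by decide)).trans (hf₂.mono (by decide) (by decide))).trans
      (hI.frame.mono (by decide) (by decide))
  refine ⟨?_, h.frame.trans hF, ⟨Function.update y u r, ?_, fun i hi => ?_⟩, fun v => ?_⟩
  · rw [hI.frame.nats 13 (by decide), n13]
  · rw [htab]
    exact hst.step (fun v => by positivity) (by positivity) hu hr
  · rw [hI.frame.reals 10 (by decide), h10]
    by_cases hiu : i = u
    · simp [upd, hiu]
    · simp [upd, hiu, hy i (by omega)]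
  · rw [hI.norm v, Finset.Ico_self, Finset.sum_empty, add_zero]

lemma progEliminate_does {I : Terms} {s : Store} (h : Ready I s) (ht : ∀ v, s.table v = I.coef v)
    (hM : ∀ v, s.reals 6 v 0 = wnorm (5 * (1 / 16)) I.m (s.table v)) :
    Does progEliminate s (2000 * (I.m + I.T * I.k ^ 2 + 1)) fun s' =>
      Frame [13, 14, 22, 17, 21] [5, 6, 7, 8, 9, 10] s s' ∧
      (∀ i < I.m, |s'.reals 10 i 0| = 1 / 4) ∧
      (∀ v, s'.reals 5 v 0 = I.deriv v fun i => s'.reals 10 i 0) ∧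
      (1 / 16) ^ (2 * I.k) * ∑ v ∈ Finset.range I.m, √(I.infl v) ≤
        ∑ v ∈ Finset.range I.m, |I.deriv v fun i => s'.reals 10 i 0| := by
  have ht' : s.table = I.coef := funext ht
  refine (Does.forTo I.m (fun u s' => EliminateInv I s u s')
    (fun u => 1000 * (s.nats 18 u 0 + 1)) ?_ ?_ ?_).mono ?_ ?_
  · exact EliminateInv.setVar ⟨.refl _ _ _, ⟨fun _ => 0, by rw [ht']; exact Stage.zero _ _ _ _,
      by simp⟩, hM⟩ 0
  · intro u s' _ hI
    exact (h.of_frame hI.frame (by decide) (by decide)).m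
  · intro u hu s' h13 hI
    exact (hI.does h hu h13).mono le_rfl fun s'' ⟨h1, h2⟩ => ⟨h1, h2.setVar _⟩
  · have := h.toScheduling.length_le
    simp only [← Finset.mul_sum, Finset.sum_add_distrib, Finset.sum_const, Finset.card_range,
      smul_eq_mul, NatExp.cost]
    omega
  · intro s' hI
    obtain ⟨y, hst, hy⟩ := hI.stage
    have hcongr : ∀ v, I.deriv v (fun i => s'.reals 10 i 0) = I.deriv v y := by
      intro v
      refine Finset.sum_congr rfl fun t ht => ?_
      rw [Finset.prod_congr rfl fun i hi => hy i (Finset.mem_range.1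
        (Terms.supp_subset (Finset.mem_range.1 ht) (Finset.mem_of_mem_erase hi)))]
    obtain ⟨hG, hsum⟩ := hst.sum_abs_deriv
    refine ⟨hI.frame, fun i hi => by rw [hy i hi]; exact hst.abs_eq i hi, fun v => ?_, ?_⟩
    -- The empty monomial has key 0, so column 0 of the table now holds the derivatives at the base
    -- point.
    · rw [hcongr, ← hG]
      simp [Store.table, setKey]
    · simpa only [hcongr] using hsum

/-! ### The algorithm: the search on a segment -/

/-- Computes the direction of the search. -/
def progDirection : Program :=
  forTo 13 (nvar 16) (.ite (.realLe (.const 0) (rvec 5 (nvar 13)))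
    (.setReal 11 (nvar 13) (.const 0) (.const (1 / 8)))
    (.setReal 11 (nvar 13) (.const 0) (.const (-1 / 8))))

/-- Steps of size 1/8 from ±1/4 keep the whole segment away from 0, so that variables can be
rescaled, and below 1/√3 in absolute value, so that rounding only stretches. -/
lemma progDirection_does {I : Terms} {s : Store} (h : Loaded I s) :
    Does progDirection s (100 * (I.m + 1)) fun s' => Frame [13] [11] s s' ∧
      ∀ v < I.m, |s'.reals 11 v 0| = 1 / 8 ∧
        s'.reals 11 v 0 * s.reals 5 v 0 = 1 / 8 * |s.reals 5 v 0| := by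
  refine (Does.forTo I.m (fun i s' => Frame [13] [11] s s' ∧
    ∀ v < i, |s'.reals 11 v 0| = 1 / 8 ∧
      s'.reals 11 v 0 * s.reals 5 v 0 = 1 / 8 * |s.reals 5 v 0|) (fun _ => 50) ?_ ?_ ?_).le ?_
  · exact ⟨(Frame.refl _ _ _).setVar (by decide) _, by simp⟩
  · intro i s' _ hI
    exact (h.of_frame hI.1 (by decide) (by decide)).m
  · intro i hi s' hc ⟨hf, hv⟩
    refine Does.exec (by decide) (by decide)
      ⟨?_, (hf.exec _ (by decide) (by decide)).setVar (by decide) _, fun v hlt => ?_⟩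
    · simp only [Program.exec]
      split_ifs <;> exact hc
    · have h5 : s'.reals 5 = s.reals 5 := hf.reals 5 (by decide)
      simp only [Store.setVar_reals, Program.exec, Test.Holds, NatExp.eval, RealExp.eval, hc, h5,
        Rat.cast_zero]
      by_cases hvi : v = i
      · subst hvi
        split_ifs with h0
        · simp only [assign_self, upd_self, abs_of_nonneg h0]
          norm_num
        · simp only [assign_self, upd_self, abs_of_neg (not_le.1 h0)]
          norm_num
      · split_ifs <;> simpa [assign_self, upd, hvi] using hv v (by omega)
  · simp [NatExp.cost]; omega

/-- Computes the current point of the segment at the variable `v`. -/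
abbrev pointExp (v : NatExp) : RealExp := .add (rvec 10 v) (.mul (rvar 13) (rvec 11 v))

/-- The current point of the segment. -/
def Store.point (s : Store) (ε : ℝ) (v : ℕ) : ℝ := s.reals 10 v 0 + ε * s.reals 11 v 0

/-- Computes the value of one term. -/
def progEvalTerm : Program :=
  .seq (.setReal 14 (.const 0) (.const 0) (rvec 0 (nvar 10)))
  (.seq (forTo 11 (nvec 1 (nvar 10)) (.setReal 14 (.const 0) (.const 0)
    (.mul (rvar 14) (pointExp (.get 4 (nvar 10) (nvar 11))))))
  (.seq (.setReal 18 (nvar 10) (.const 0) (rvar 14))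
  (.ite (.natLe (.const 1) (nvec 1 (nvar 10)))
    (.setReal 15 (.const 0) (.const 0) (.add (rvar 15) (rvar 14))) .skip)))

/-- Computes the values of the polynomial and its terms at the current point of the segment. -/
def progEval : Program :=
  .seq (.setReal 15 (.const 0) (.const 0) (.const 0))
    (forTo 10 (.get 0 (.const 0) (.const 2)) progEvalTerm)

/-- A term of weight zero is stored in real array 18 like the others but left out of the sum, since
the constant coefficient is the Haar average. -/
lemma progEvalTerm_does {I : Terms} {s : Store} (h : Listed I s) {t : ℕ} (ht : t < I.T)
    (h10 : s.nats 10 0 0 = t) :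
    Does progEvalTerm s (200 * (I.k + 1)) fun s' => Frame [11] [14, 15, 18] s s' ∧
      s'.reals 18 = upd (s.reals 18) t 0 (I.term (s.point (s.reals 13 0 0)) t) ∧
      s'.reals 15 0 0 = s.reals 15 0 0 +
        if I.w t ≠ 0 then I.term (s.point (s.reals 13 0 0)) t else 0 := by
  set x := s.point (s.reals 13 0 0) with hx
  let Inv : ℕ → Store → Prop := fun j s' => Frame [11] [14] s s' ∧
    s'.reals 14 0 0 = I.a t * ∏ i ∈ Finset.range j, x (I.var t i)
  refine Does.le (T := 10 + ((∑ j ∈ Finset.range (I.w t), 50 + (I.w t + 1) * 23) + 50))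
    (Does.seq (Q := Inv 0) (Does.exec (by decide) (by decide) ?_) fun s₁ h₁ =>
      Does.seq (Does.forTo (I.w t) Inv (fun _ => 50) ⟨h₁.1.setVar (by decide) _, h₁.2⟩ ?_ ?_)
        fun s₂ h₂ => Does.exec (by decide) (by decide) ?_) ?_
  · refine ⟨(Frame.refl _ _ _).exec _ (by decide) (by decide), ?_⟩
    simp [Program.exec, NatExp.eval, RealExp.eval, assign_self, upd_self, h10, h.a t ht]
  · intro j s' _ hI
    simp [NatExp.eval, hI.1.nats, h10, h.w t ht]
  · intro j hj s' h11 hI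
    refine Does.exec (by decide) (by decide)
      ⟨h11, (hI.1.exec _ (by decide) (by decide)).setVar (by decide) _, ?_⟩
    simp only [Store.setVar_reals, Program.exec, NatExp.eval, RealExp.eval, assign_self, upd_self,
      hI.2, h11, hI.1.nats 10 (by decide), hI.1.nats 4 (by decide), h10, h.vars t ht j hj,
      hI.1.reals 10 (by decide), hI.1.reals 11 (by decide), hI.1.reals 13 (by decide)]
    rw [Finset.prod_range_succ, mul_assoc]
    rfl
  · obtain ⟨hf, h14⟩ := h₂
    have hterm : I.a t * ∏ i ∈ Finset.range (I.w t), x (I.var t i) = I.term x t := by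
      rw [Terms.term, Terms.prod_supp ht]
    rw [hterm] at h14
    refine ⟨(hf.mono (by decide) (by decide)).exec _ (by decide) (by decide), ?_, ?_⟩
    · simp only [Program.exec, Test.Holds, NatExp.eval, RealExp.eval, h14,
        hf.nats 10 (by decide), h10]
      rw [← hf.reals 18 (by decide)]
      split_ifs <;> simp [assign_self, assign_ne]
    · have h15 : s₂.reals 15 = s.reals 15 := hf.reals 15 (by decide)
      have hcond : (1 ≤ I.w t) ↔ I.w t ≠ 0 := Nat.one_le_iff_ne_zero
      simp only [Program.exec, Test.Holds, NatExp.eval, RealExp.eval, h14, hf.nats 10 (by decide),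
        h10, hf.nats 1 (by decide), h.w t ht, hcond]
      split_ifs <;> simp [assign_self, assign_ne, upd_self, h15, h14]
  · have := I.w_le t ht
    simp only [Finset.sum_const, Finset.card_range, smul_eq_mul]
    omega

lemma progEval_does {I : Terms} {s : Store} (h : Listed I s) :
    Does progEval s (300 * (I.T * (I.k + 1) + 1)) fun s' =>
      Frame [10, 11] [14, 15, 18] s s' ∧
      (∀ t < I.T, s'.reals 18 t 0 = I.term (s.point (s.reals 13 0 0)) t) ∧
      s'.reals 15 0 0 = I.value (s.point (s.reals 13 0 0)) := by
  set x := s.point (s.reals 13 0 0) with hx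
  let Inv : ℕ → Store → Prop := fun i s' => Frame [10, 11] [14, 15, 18] s s' ∧
    (∀ t < i, s'.reals 18 t 0 = I.term x t) ∧
    s'.reals 15 0 0 = ∑ t ∈ Finset.range i, if I.w t ≠ 0 then I.term x t else 0
  refine (Does.seq (T := 10) (Q := Inv 0) (Does.exec (by decide) (by decide) ?_) fun s₁ h₁ =>
    Does.forTo I.T Inv (fun _ => 200 * (I.k + 1))
      ⟨h₁.1.setVar (by decide) _, h₁.2⟩ ?_ ?_).mono ?_ ?_
  · refine ⟨(Frame.refl _ _ _).exec _ (by decide) (by decide), by simp, ?_⟩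
    simp [Program.exec, NatExp.eval, RealExp.eval, assign_self, upd_self]
  · intro i s' _ hI
    exact (h.of_frame hI.1 (by decide) (by decide)).T
  · intro t ht s' h10 ⟨hf, h18, h15⟩
    refine (progEvalTerm_does (h.of_frame hf (by decide) (by decide)) ht h10).mono le_rfl ?_
    rintro s'' ⟨hf', h18', h15'⟩
    have hx' : s'.point (s'.reals 13 0 0) = x := by
      funext v
      rw [Store.point, hf.reals 10 (by decide), hf.reals 11 (by decide), hf.reals 13 (by decide)]
      rfl
    rw [hx'] at h18' h15'
    refine ⟨by rw [hf'.nats 10 (by decide)]; exact h10,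
      (hf.trans (hf'.mono (by decide) (by decide))).setVar (by decide) _, fun t' ht' => ?_, ?_⟩
    · rw [Store.setVar_reals, h18']
      by_cases htt : t' = t
      · rw [htt, upd_self]
      · simpa [upd, htt] using h18 t' (by omega)
    · rw [Store.setVar_reals, h15', h15, Finset.sum_range_succ]
  · have : I.T ≤ I.T * (I.k + 1) := Nat.le_mul_of_pos_right _ (by omega)
    simp only [Finset.sum_const, Finset.card_range, smul_eq_mul, NatExp.cost]
    rw [show I.T * (200 * (I.k + 1)) = 200 * (I.T * (I.k + 1)) by ring]
    omega
  · exact fun s' hI => hI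

/-- Evaluates the polynomial at one point of the segment and keeps the best point. -/
def progTry : Program :=
  .seq (.setReal 13 (.const 0) (.const 0)
    (.div (.ofNat (nvar 15)) (.ofNat (.get 0 (.const 0) (.const 1)))))
  (.seq progEval (.ite (.realLe (rvar 16) (.mul (rvar 15) (rvar 15)))
    (.seq (.setReal 16 (.const 0) (.const 0) (.mul (rvar 15) (rvar 15)))
      (.setReal 17 (.const 0) (.const 0) (rvar 13))) .skip))

/-- Finds the best point of the segment and evaluates the polynomial there. -/
def progSearch : Program :=
  .seq (.seq (.setReal 16 (.const 0) (.const 0) (.const 0))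
    (.setReal 17 (.const 0) (.const 0) (.const 0)))
  (.seq (forTo 15 (.add (.get 0 (.const 0) (.const 1)) (.const 1)) progTry)
  (.seq (.setReal 13 (.const 0) (.const 0) (rvar 17)) progEval))

/-- Squares of values are compared, which avoids absolute values. The best parameter is evaluated
once more at the end because rounding needs the values of the single terms there. -/
lemma progSearch_does {I : Terms} {s : Store} (h : Listed I s) :
    Does progSearch s (1000 * (I.T * (I.k + 1) ^ 2 + I.k + 1)) fun s' =>
      Frame [10, 11, 15] [13, 14, 15, 16, 17, 18] s s' ∧
      0 ≤ s'.reals 13 0 0 ∧ s'.reals 13 0 0 ≤ 1 ∧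
      (∀ t < I.T, s'.reals 18 t 0 = I.term (s.point (s'.reals 13 0 0)) t) ∧
      s'.reals 15 0 0 = I.value (s.point (s'.reals 13 0 0)) ∧
      ∀ e ≤ I.k, |I.value (s.point ((e : ℝ) / I.k))| ≤ |s'.reals 15 0 0| := by
  let Inv : ℕ → Store → Prop := fun i s' => Frame [10, 11, 15] [13, 14, 15, 16, 17, 18] s s' ∧
    0 ≤ s'.reals 17 0 0 ∧ s'.reals 17 0 0 ≤ 1 ∧
    -- Only an inequality: the record starts at 0 with parameter 0, before any evaluation.
    s'.reals 16 0 0 ≤ I.value (s.point (s'.reals 17 0 0)) ^ 2 ∧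
    ∀ e < i, I.value (s.point ((e : ℝ) / I.k)) ^ 2 ≤ s'.reals 16 0 0
  have hpoint : ∀ s', Frame [10, 11, 15] [13, 14, 15, 16, 17, 18] s s' → s'.point = s.point := by
    intro s' hf
    funext ε v
    rw [Store.point, hf.reals 10 (by decide), hf.reals 11 (by decide)]
    rfl
  refine (Does.seq (T := 20) (Q := Inv 0) (Does.exec (by decide) (by decide) ?_) fun s₁ h₁ =>
    Does.seq (Q := Inv (I.k + 1)) (Does.forTo (I.k + 1) Inv
      (fun _ => 20 + (300 * (I.T * (I.k + 1) + 1) + 100))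
      ⟨h₁.1.setVar (by decide) _, h₁.2⟩ ?_ ?_)
    fun s₂ h₂ => Does.seq (T := 20) (Q := fun s₃ => Frame [] [13] s₂ s₃ ∧
      s₃.reals 13 0 0 = s₂.reals 17 0 0) (Does.exec (by decide) (by decide) ?_)
    fun s₃ h₃ => ((progEval_does (I := I) ?_).mono le_rfl ?_)).le ?_
  · refine ⟨(Frame.refl _ _ _).exec _ (by decide) (by decide), ?_⟩
    simp [Program.exec, NatExp.eval, RealExp.eval, assign_self, assign_ne, upd_self]
    positivity
  · intro i s' _ hI
    have := (h.of_frame hI.1 (by decide) (by decide)).k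
    simp [NatExp.eval, this]
  · intro e he s' h15 ⟨hf, h0, h1, h16, hbest⟩
    have hk := (h.of_frame hf (by decide) (by decide)).k
    refine Does.seq (Q := fun s₂ => Frame [] [13] s' s₂ ∧ s₂.reals 13 0 0 = (e : ℝ) / I.k)
      (Does.exec (by decide) (by decide) ⟨(Frame.refl _ _ _).exec _ (by decide) (by decide), ?_⟩) fun s₂ ⟨hf₂, h13⟩ =>
      Does.seq (progEval_does (I := I) ?_) fun s₃ ⟨hf₃, _, hval⟩ =>
        Does.exec (by decide) (by decide) ?_
    · simp [Program.exec, NatExp.eval, RealExp.eval, assign_self, upd_self, h15, hk]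
    · exact (h.of_frame hf (by decide) (by decide)).of_frame hf₂ (by decide) (by decide)
    · have hfs₂ := hf.trans (hf₂.mono (by decide) (by decide))
      have hfs₃ : Frame [10, 11, 15] [13, 14, 15, 16, 17, 18] s s₃ :=
        hfs₂.trans (hf₃.mono (by decide) (by decide))
      rw [hpoint s₂ hfs₂, h13] at hval
      have h13' : s₃.reals 13 0 0 = (e : ℝ) / I.k := by rw [hf₃.reals 13 (by decide), h13]
      have h16' : s₃.reals 16 = s'.reals 16 := by
        rw [hf₃.reals 16 (by decide), hf₂.reals 16 (by decide)]
      have h17' : s₃.reals 17 = s'.reals 17 := by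
        rw [hf₃.reals 17 (by decide), hf₂.reals 17 (by decide)]
      have h15' : s₃.nats 15 0 0 = e := by
        rw [hf₃.nats 15 (by decide), hf₂.nats 15 (by decide), h15]
      refine ⟨?_, (hfs₃.exec _ (by decide) (by decide)).setVar (by decide) _, ?_⟩
      · simp only [Program.exec]
        split_ifs <;> exact h15'
      · simp only [Store.setVar_reals, Program.exec, Test.Holds, NatExp.eval, RealExp.eval, hval,
          h16']
        split_ifs with hle
        · simp only [assign_self, assign_ne, upd_self, ne_eq, Nat.reduceEqDiff, not_false_eq_true,
            h13']
          refine ⟨by positivity, ?_, by rw [sq], fun e' he' => ?_⟩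
          · exact div_le_one_of_le₀ (by exact_mod_cast Nat.lt_succ_iff.1 he) (by positivity)
          · rw [← sq] at hle ⊢
            rcases (Nat.lt_succ_iff.1 he').lt_or_eq with h' | rfl
            · exact (hbest e' h').trans hle
            · exact le_rfl
        · rw [h16', h17']
          refine ⟨h0, h1, h16, fun e' he' => ?_⟩
          rcases (Nat.lt_succ_iff.1 he').lt_or_eq with h' | rfl
          · exact hbest e' h'
          · rw [sq]; exact (not_le.1 hle).le
  · refine ⟨(Frame.refl _ _ _).exec _ (by decide) (by decide), ?_⟩
    simp [Program.exec, NatExp.eval, RealExp.eval, assign_self, upd_self]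
  · exact (h.of_frame h₂.1 (by decide) (by decide)).of_frame h₃.1 (by decide) (by decide)
  · rintro s₄ ⟨hf₄, h18, h15⟩
    obtain ⟨hf, h0, h1, h16, hbest⟩ := h₂
    have hfs₃ := hf.trans (h₃.1.mono (by decide) (by decide))
    have h13 : s₄.reals 13 0 0 = s₂.reals 17 0 0 := by rw [hf₄.reals 13 (by decide), h₃.2]
    rw [hpoint s₃ hfs₃, h₃.2] at h18 h15
    rw [h13]
    refine ⟨hfs₃.trans (hf₄.mono (by decide) (by decide)), h0, h1, h18, h15, fun e he => ?_⟩
    rw [h15]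
    exact sq_le_sq.1 ((hbest e (Nat.lt_succ_iff.2 he)).trans h16)
  · simp only [Finset.sum_const, Finset.card_range, smul_eq_mul, NatExp.cost]
    have hT : I.T * (I.k + 1) ≤ I.T * (I.k + 1) ^ 2 := by
      rw [sq, ← mul_assoc]
      exact Nat.le_mul_of_pos_right _ (by omega)
    rw [show (I.k + 1) * (20 + (300 * (I.T * (I.k + 1) + 1) + 100)) =
      300 * (I.T * (I.k + 1) ^ 2) + 420 * (I.k + 1) by ring]
    omega

/-! ### The algorithm: rounding and output -/

/-- Stores the best point and the sign of its value. -/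
def progPoint : Program :=
  .seq (.ite (.realLe (.const 0) (rvar 15)) (.setReal 9 (.const 0) (.const 0) (.const 1))
      (.setReal 9 (.const 0) (.const 0) (.const (-1))))
    (forTo 13 (nvar 16) (.setReal 12 (nvar 13) (.const 0) (pointExp (nvar 13))))

lemma progPoint_does {I : Terms} {s : Store} (h : Loaded I s) :
    Does progPoint s (100 * (I.m + 1)) fun s' => Frame [13] [9, 12] s s' ∧
      (∀ v < I.m, s'.reals 12 v 0 = s.point (s.reals 13 0 0) v) ∧
      |s'.reals 9 0 0| = 1 ∧ s'.reals 9 0 0 * s.reals 15 0 0 = |s.reals 15 0 0| := by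
  let Inv : ℕ → Store → Prop := fun i s' => Frame [13] [9, 12] s s' ∧
    (∀ v < i, s'.reals 12 v 0 = s.point (s.reals 13 0 0) v) ∧
    |s'.reals 9 0 0| = 1 ∧ s'.reals 9 0 0 * s.reals 15 0 0 = |s.reals 15 0 0|
  refine Does.le (T := 20 + (∑ i ∈ Finset.range I.m, 50 + (I.m + 1) * 21)) (Does.seq (Q := Inv 0)
    (Does.exec (by decide) (by decide) ⟨?_, by simp, ?_⟩) fun s₁ h₁ => Does.forTo I.m Inv
      (fun _ => 50) ⟨h₁.1.setVar (by decide) _, h₁.2⟩ ?_ ?_) ?_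
  · exact (Frame.refl _ _ _).exec _ (by decide) (by decide)
  · simp only [Program.exec, Test.Holds, NatExp.eval, RealExp.eval, Rat.cast_zero]
    split_ifs with h0
    · simp [assign_self, upd_self, abs_of_nonneg h0]
    · simp [assign_self, upd_self, abs_of_neg (not_le.1 h0)]
  · intro i s' _ hI
    exact (h.of_frame hI.1 (by decide) (by decide)).m
  · intro i hi s' hc ⟨hf, hv, h9⟩
    refine Does.exec (by decide) (by decide)
      ⟨hc, (hf.exec _ (by decide) (by decide)).setVar (by decide) _, fun v hlt => ?_, ?_⟩
    · simp only [Store.setVar_reals, Program.exec, NatExp.eval, RealExp.eval, hc, assign_self,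
        hf.reals 10 (by decide), hf.reals 11 (by decide), hf.reals 13 (by decide)]
      by_cases hvi : v = i
      · rw [hvi, upd_self]; rfl
      · simpa [upd, hvi] using hv v (by omega)
    · simpa [Program.exec, assign_ne] using h9
  · simp; omega

/-- Sums up the values of the terms containing the current variable and computes the factor by
which the variable is multiplied. -/
def progFactor : Program :=
  .seq (.setReal 8 (.const 0) (.const 0) (.const 0))
  (.seq (forTo 14 (nvec 20 (nvar 13)) (.setReal 8 (.const 0) (.const 0)
    (.add (rvar 8) (rvec 18 (.get 19 (nvar 13) (nvar 14))))))
  (.ite (.realLe (.const 0) (.mul (rvar 9) (rvar 8)))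
    (.setReal 14 (.const 0) (.const 0) (.div (.sqrt (.const (1 / 3)))
      (.sqrt (.mul (rvec 12 (nvar 13)) (rvec 12 (nvar 13))))))
    (.setReal 14 (.const 0) (.const 0) (.sub (.const 0) (.div (.sqrt (.const (1 / 3)))
      (.sqrt (.mul (rvec 12 (nvar 13)) (rvec 12 (nvar 13)))))))))

/-- Multiplies the current variable and the terms containing it by the factor. -/
def progScale : Program :=
  .seq (forTo 14 (nvec 20 (nvar 13)) (.setReal 18 (.get 19 (nvar 13) (nvar 14)) (.const 0)
    (.mul (rvar 14) (rvec 18 (.get 19 (nvar 13) (nvar 14))))))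
  (.setReal 12 (nvar 13) (.const 0) (.mul (rvar 14) (rvec 12 (nvar 13))))

/-- Moves all variables to the boundary. -/
def progRound : Program := forTo 13 (nvar 16) (.seq progFactor progScale)

lemma Listed.sum_adj {I : Terms} {s : Store} (h : Listed I s) (u : ℕ) (F : ℕ → ℝ) :
    ∑ a ∈ Finset.range (s.nats 20 u 0), F (s.nats 19 u a) =
      ∑ t ∈ Finset.range I.T, if u ∈ I.supp t then F t else 0 := by
  rw [← Finset.sum_filter]
  refine Finset.sum_bij (fun a _ => s.nats 19 u a) (fun a ha => ?_) (fun a ha a' ha' he => ?_)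
    (fun t ht => ?_) fun a _ => rfl
  · have := h.mem u a (Finset.mem_range.1 ha)
    simpa using this
  · rw [Finset.mem_range] at ha ha'
    rcases lt_trichotomy a a' with hlt | heq | hlt
    · exact absurd he (h.inj u a a' hlt ha')
    · exact heq
    · exact absurd he.symm (h.inj u a' a hlt ha)
  · rw [Finset.mem_filter, Finset.mem_range] at ht
    obtain ⟨a, ha, hat⟩ := h.surj u t ht.1 ht.2
    exact ⟨a, Finset.mem_range.2 ha, hat⟩

/-- The factor brings the variable to absolute value √(1/3); its sign is that of the sum of the
terms containing the variable, times the sign of the value at the best point. The absolute value is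
computed as √(x · x). -/
lemma progFactor_does {I : Terms} {s : Store} (h : Listed I s) {u : ℕ}
    (h13 : s.nats 13 0 0 = u) :
    Does progFactor s (200 * (s.nats 20 u 0 + 1)) fun s' => Frame [14] [8, 14] s s' ∧
      s'.reals 14 0 0 = if 0 ≤ s.reals 9 0 0 *
          (∑ t ∈ Finset.range I.T, if u ∈ I.supp t then s.reals 18 t 0 else 0)
        then √(1 / 3) / |s.reals 12 u 0| else -(√(1 / 3) / |s.reals 12 u 0|) := by
  set d := s.nats 20 u 0 with hd
  let Inv : ℕ → Store → Prop := fun a s' => Frame [14] [8] s s' ∧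
    s'.reals 8 0 0 = ∑ b ∈ Finset.range a, s.reals 18 (s.nats 19 u b) 0
  refine Does.le (T := 10 + ((∑ a ∈ Finset.range d, 50 + (d + 1) * 23) + 100))
    (Does.seq (Q := Inv 0) (Does.exec (by decide) (by decide) ⟨?_, ?_⟩) fun s₁ h₁ =>
      Does.seq (Does.forTo d Inv (fun _ => 50) ⟨h₁.1.setVar (by decide) _, h₁.2⟩ ?_ ?_)
        fun s₂ h₂ => Does.exec (by decide) (by decide) ⟨?_, ?_⟩) ?_
  · exact (Frame.refl _ _ _).exec _ (by decide) (by decide)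
  · simp [Program.exec, NatExp.eval, RealExp.eval, assign_self, upd_self]
  · intro a s' _ hI
    simp [NatExp.eval, hI.1.nats, h13, hd]
  · intro a ha s' h14 ⟨hf, h8⟩
    refine Does.exec (by decide) (by decide)
      ⟨h14, (hf.exec _ (by decide) (by decide)).setVar (by decide) _, ?_⟩
    simp only [Store.setVar_reals, Program.exec, NatExp.eval, RealExp.eval, assign_self, upd_self,
      h8, h14, hf.nats 13 (by decide), hf.nats 19 (by decide), h13, hf.reals 18 (by decide)]
    rw [Finset.sum_range_succ]
  · exact (h₂.1.mono (by decide) (by decide)).exec _ (by decide) (by decide)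
  · obtain ⟨hf, h8⟩ := h₂
    rw [h.sum_adj u fun t => s.reals 18 t 0] at h8
    simp only [Program.exec, Test.Holds, NatExp.eval, RealExp.eval, h8, hf.nats 13 (by decide), h13,
      hf.reals 9 (by decide), hf.reals 12 (by decide), Rat.cast_zero, Real.sqrt_mul_self_eq_abs]
    split_ifs <;> simp [assign_self, upd_self]
  · simp only [Finset.sum_const, Finset.card_range, smul_eq_mul]
    omega

/-- The list of terms containing a variable has no repetitions, so no term is scaled twice. -/
lemma progScale_does {I : Terms} {s : Store} (h : Listed I s) {u : ℕ}
    (h13 : s.nats 13 0 0 = u) :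
    Does progScale s (200 * (s.nats 20 u 0 + 1)) fun s' => Frame [14] [12, 18] s s' ∧
      (∀ t < I.T, s'.reals 18 t 0 =
        if u ∈ I.supp t then s.reals 14 0 0 * s.reals 18 t 0 else s.reals 18 t 0) ∧
      s'.reals 12 = upd (s.reals 12) u 0 (s.reals 14 0 0 * s.reals 12 u 0) := by
  classical
  set d := s.nats 20 u 0 with hd
  let Inv : ℕ → Store → Prop := fun a s' => Frame [14] [18] s s' ∧
    ∀ t, s'.reals 18 t 0 = if ∃ b < a, s.nats 19 u b = t then s.reals 14 0 0 * s.reals 18 t 0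
      else s.reals 18 t 0
  refine Does.le (T := (∑ a ∈ Finset.range d, 50 + (d + 1) * 23) + 50)
    (Does.seq (Does.forTo d Inv (fun _ => 50) ⟨(Frame.refl _ _ _).setVar (by decide) _, by simp⟩
      ?_ ?_) fun s₂ h₂ => Does.exec (by decide) (by decide) ⟨?_, fun t ht => ?_, ?_⟩) ?_
  · intro a s' _ hI
    simp [NatExp.eval, hI.1.nats, h13, hd]
  · intro a ha s' h14 ⟨hf, h18⟩
    refine Does.exec (by decide) (by decide)
      ⟨h14, (hf.exec _ (by decide) (by decide)).setVar (by decide) _, fun t => ?_⟩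
    simp only [Store.setVar_reals, Program.exec, NatExp.eval, RealExp.eval, assign_self,
      h14, hf.nats 13 (by decide), hf.nats 19 (by decide), h13, hf.reals 14 (by decide)]
    by_cases hta : t = s.nats 19 u a
    · subst hta
      have : ¬ ∃ b < a, s.nats 19 u b = s.nats 19 u a := by
        rintro ⟨b, hb, he⟩
        exact h.inj u b a hb ha he
      rw [upd_self, h18, if_neg this, if_pos ⟨a, Nat.lt_succ_self a, rfl⟩]
    · have hiff : (∃ b < a + 1, s.nats 19 u b = t) ↔ ∃ b < a, s.nats 19 u b = t := by
        constructor
        · rintro ⟨b, hb, he⟩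
          rcases (Nat.lt_succ_iff.1 hb).lt_or_eq with h' | rfl
          · exact ⟨b, h', he⟩
          · exact absurd he.symm hta
        · rintro ⟨b, hb, he⟩
          exact ⟨b, by omega, he⟩
      simp only [upd, hta, false_and, if_false, h18, hiff]
  · exact (h₂.1.mono (by decide) (by decide)).exec _ (by decide) (by decide)
  · have hiff : (∃ b < d, s.nats 19 u b = t) ↔ u ∈ I.supp t := by
      constructor
      · rintro ⟨b, hb, rfl⟩
        exact (h.mem u b hb).2
      · exact h.surj u t ht
    have := h₂.2 t
    simp only [hiff] at this
    simpa [Program.exec, assign_ne] using this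
  · simp [Program.exec, NatExp.eval, RealExp.eval, assign_self, h13, h₂.1.nats, h₂.1.reals]
  · simp only [Finset.sum_const, Finset.card_range, smul_eq_mul]
    omega

/-! ### Rounding all variables to the boundary. -/

/-- The point stored in the memory. -/
def Store.xs (s : Store) (v : ℕ) : ℝ := s.reals 12 v 0

/-- The state of rounding: the variables below `u` are on the boundary. -/
structure RoundInv (I : Terms) (s₀ : Store) (u : ℕ) (s : Store) : Prop where
  frame : Frame [13, 14] [8, 14, 12, 18] s₀ s
  sq_eq : ∀ i < u, s.xs i ^ 2 = 1 / 3
  bound : ∀ i < I.m, u ≤ i → 0 < |s.xs i| ∧ |s.xs i| < √(1 / 3)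
  term : ∀ t < I.T, s.reals 18 t 0 = I.term s.xs t
  le : s₀.reals 9 0 0 * I.value s₀.xs ≤ s₀.reals 9 0 0 * I.value s.xs

/-- The signed value changes by φ - 1 times the signed sum of the terms containing u, and the factor
φ is chosen so that this product is nonnegative. -/
lemma RoundInv.does {I : Terms} {s₀ s : Store} {u : ℕ} (h : RoundInv I s₀ u s)
    (h₀ : Listed I s₀) (hu : u < I.m) (h13 : s.nats 13 0 0 = u) :
    Does (.seq progFactor progScale) s (400 * (s₀.nats 20 u 0 + 1)) fun s' =>
      s'.nats 13 0 0 = u ∧ RoundInv I s₀ (u + 1) s' := by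
  have hs : Listed I s := h₀.of_frame h.frame (by decide) (by decide)
  have h20 : s.nats 20 = s₀.nats 20 := h.frame.nats 20 (by decide)
  refine ((progFactor_does hs h13).seq (T' := 200 * (s₀.nats 20 u 0 + 1)) fun s₁ ⟨hf₁, h14⟩ =>
    ((progScale_does (s := s₁) (hs.of_frame hf₁ (by decide) (by decide))
      (by rw [hf₁.nats 13 (by decide), h13])).mono ?_ ?_)).le (by rw [h20]; omega)
  · rw [hf₁.nats 20 (by decide), h20]
  · rintro s₂ ⟨hf₂, h18, h12⟩
    have hfs : Frame [13, 14] [8, 14, 12, 18] s₀ s₂ :=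
      h.frame.trans ((hf₁.mono (by decide) (by decide)).trans (hf₂.mono (by decide) (by decide)))
    rw [hf₁.reals 18 (by decide)] at h18
    rw [hf₁.reals 12 (by decide)] at h12
    set φ := s₁.reals 14 0 0 with hφ
    have hx : s₂.xs = Function.update s.xs u (φ * s.xs u) := by
      funext v
      rw [Store.xs, h12]
      by_cases hv : v = u
      · subst hv; simp [upd, Store.xs]
      · simp [upd, Store.xs, hv]
    obtain ⟨hpos, hlt⟩ := h.bound u hu le_rfl
    have h3 : √(1 / 3 : ℝ) ^ 2 = 1 / 3 := Real.sq_sqrt (by norm_num)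
    -- Stretching makes φ - 1 positive for a positive factor; for a negative factor it is negative
    -- anyway.
    have hratio : 1 < √(1 / 3) / |s.xs u| := (one_lt_div hpos).2 hlt
    have hφ' : φ = √(1 / 3) / |s.xs u| ∨ φ = -(√(1 / 3) / |s.xs u|) := by
      rw [h14]
      split_ifs
      · exact Or.inl rfl
      · exact Or.inr rfl
    refine ⟨by rw [hf₂.nats 13 (by decide), hf₁.nats 13 (by decide), h13], hfs, fun i hi => ?_,
      fun i him hi => ?_, fun t ht => ?_, ?_⟩
    · rw [hx]
      by_cases hiu : i = u
      · subst hiu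
        have hsq : φ ^ 2 = (√(1 / 3) / |s.xs i|) ^ 2 := by
          rcases hφ' with h' | h'
          · rw [h']
          · rw [h', neg_sq]
        rw [Function.update_self, mul_pow, hsq, div_pow, h3, sq_abs]
        have : s.xs i ≠ 0 := abs_pos.1 hpos
        field_simp
      · rw [Function.update_of_ne hiu]
        exact h.sq_eq i (by omega)
    · rw [hx, Function.update_of_ne (by omega)]
      exact h.bound i him (by omega)
    · rw [h18 t ht, hx, Terms.term_update, h.term t ht]
    · refine h.le.trans ?_
      have hsum : (∑ t ∈ Finset.range I.T, if u ∈ I.supp t then s.reals 18 t 0 else 0) =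
          ∑ t ∈ Finset.range I.T, if u ∈ I.supp t then I.term s.xs t else 0 :=
        Finset.sum_congr rfl fun t ht => by rw [h.term t (Finset.mem_range.1 ht)]
      rw [hsum, h.frame.reals 9 (by decide)] at h14
      rw [hx, Terms.value_update, mul_add]
      refine le_add_of_nonneg_right ?_
      rw [mul_left_comm]
      split_ifs at h14 with hc
      · refine mul_nonneg ?_ hc
        rw [h14]
        change 0 ≤ √(1 / 3) / |s.xs u| - 1
        linarith
      · refine mul_nonneg_of_nonpos_of_nonpos ?_ (not_le.1 hc).le
        rw [h14]
        change -(√(1 / 3) / |s.xs u|) - 1 ≤ 0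
        linarith

lemma progRound_does {I : Terms} {s : Store} (h : Listed I s)
    (hb : ∀ i < I.m, 0 < |s.xs i| ∧ |s.xs i| < √(1 / 3))
    (ht : ∀ t < I.T, s.reals 18 t 0 = I.term s.xs t) :
    Does progRound s (1000 * (I.m + I.T * I.k + 1)) fun s' =>
      Frame [13, 14] [8, 14, 12, 18] s s' ∧ (∀ i < I.m, s'.xs i ^ 2 = 1 / 3) ∧
      s.reals 9 0 0 * I.value s.xs ≤ s.reals 9 0 0 * I.value s'.xs := by
  have setVar : ∀ {u s'} i, RoundInv I s u s' → RoundInv I s u (s'.setVar 13 i) :=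
    fun i hI => ⟨hI.frame.setVar (by decide) _, hI.sq_eq, hI.bound, hI.term, hI.le⟩
  refine (Does.forTo I.m (RoundInv I s) (fun u => 400 * (s.nats 20 u 0 + 1))
    (setVar 0 ⟨.refl _ _ _, by simp, fun i hi _ => hb i hi, ht, le_rfl⟩) ?_ ?_).mono ?_
    fun s' hI => ⟨hI.frame, hI.sq_eq, hI.le⟩
  · intro u s' _ hI
    exact (h.of_frame hI.frame (by decide) (by decide)).m
  · intro u hu s' h13 hI
    exact (hI.does h hu h13).mono le_rfl fun s'' ⟨h1, h2⟩ => ⟨h1, setVar _ h2⟩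
  · have h1 := h.deg
    have h2 := sum_w_le I
    simp only [← Finset.mul_sum, Finset.sum_add_distrib, Finset.sum_const, Finset.card_range,
      smul_eq_mul, NatExp.cost]
    omega

/-- Three times the current qubit. -/
abbrev tripleExp : NatExp := .add (nvar 10) (.add (nvar 10) (nvar 10))

/-- Computes the amplitudes of the qubits with the given Bloch vectors. -/
def progOutput : Program :=
  forTo 10 (nvar 0)
    (.seq (.setReal 1 (nvar 10) (.const 0) (.sqrt (.div (.add (.const 1)
      (rvec 12 (.add tripleExp (.const 2)))) (.const 2))))
    (.seq (.setReal 1 (nvar 10) (.const 1) (.const 0))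
    (.seq (.setReal 1 (nvar 10) (.const 2) (.div (rvec 12 tripleExp)
      (.mul (.const 2) (rvec 1 (nvar 10)))))
    (.setReal 1 (nvar 10) (.const 3) (.div (rvec 12 (.add tripleExp (.const 1)))
      (.mul (.const 2) (rvec 1 (nvar 10))))))))

lemma progOutput_does {I : Terms} {s : Store} (h : HasInput I s) :
    Does progOutput s (300 * (I.m + 1)) fun s' => ∀ i < s.nats 0 0 0,
      s'.reals 1 i 0 = √((1 + s.xs (3 * i + 2)) / 2) ∧ s'.reals 1 i 1 = 0 ∧
      s'.reals 1 i 2 = s.xs (3 * i) / (2 * √((1 + s.xs (3 * i + 2)) / 2)) ∧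
      s'.reals 1 i 3 = s.xs (3 * i + 1) / (2 * √((1 + s.xs (3 * i + 2)) / 2)) := by
  have hm := h.size
  set n := s.nats 0 0 0 with hn
  refine (Does.forTo n (fun j s' => Frame [10] [1] s s' ∧ ∀ i < j,
      s'.reals 1 i 0 = √((1 + s.xs (3 * i + 2)) / 2) ∧ s'.reals 1 i 1 = 0 ∧
      s'.reals 1 i 2 = s.xs (3 * i) / (2 * √((1 + s.xs (3 * i + 2)) / 2)) ∧
      s'.reals 1 i 3 = s.xs (3 * i + 1) / (2 * √((1 + s.xs (3 * i + 2)) / 2)))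
    (fun _ => 200) ?_ ?_ ?_).mono ?_ fun s' hI => hI.2
  · exact ⟨(Frame.refl _ _ _).setVar (by decide) _, by simp⟩
  · intro j s' _ hI
    simp [NatExp.eval, hI.1.nats, hn]
  · intro j hj s' h10 ⟨hf, hI⟩
    refine Does.exec (by decide) (by decide)
      ⟨h10, (hf.exec _ (by decide) (by decide)).setVar (by decide) _, fun i hi => ?_⟩
    have e3 : j + (j + j) = 3 * j := by ring
    by_cases hij : i = j
    · subst hij
      simp [Program.exec, NatExp.eval, RealExp.eval, assign_self, assign_ne, upd, h10,
        hf.reals 12, e3, Store.xs]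
    · simpa [Program.exec, NatExp.eval, RealExp.eval, assign_self, upd, h10, hij] using
        hI i (by omega)
  · simp only [Finset.sum_const, Finset.card_range, smul_eq_mul, NatExp.cost]
    omega

/-! ### The algorithm -/

/-- Chooses the signs of a base point at which many derivatives are large. -/
def progBase : Program :=
  .seq progSize (.seq progPowers (.seq progRead (.seq progInverse
    (.seq progSchedule progEliminate))))

/-- Searches a line through the base point and rounds the best point. -/
def progImprove : Program :=
  .seq progDirection (.seq progSearch (.seq progPoint (.seq progRound progOutput)))

/-- The optimization algorithm. -/
def algorithm : Program := .seq progBase progImprove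

lemma progBase_does {I : Terms} {s : Store} (h : HasInput I s)
    (hN : ∀ a ∈ [5, 18, 20], s.nats a = fun _ _ => 0)
    (hR : ∀ a ∈ [2, 5, 6], s.reals a = fun _ _ => 0) :
    Does progBase s (4000 * (I.m + I.k + I.T * (I.k + 1) ^ 2 + 1)) fun s' => Listed I s' ∧
      (∀ i < I.m, |s'.reals 10 i 0| = 1 / 4) ∧
      (∀ v, s'.reals 5 v 0 = I.deriv v fun i => s'.reals 10 i 0) ∧
      (1 / 16) ^ (2 * I.k) * ∑ v ∈ Finset.range I.m, √(I.infl v) ≤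
        ∑ v ∈ Finset.range I.m, |I.deriv v fun i => s'.reals 10 i 0| := by
  refine Does.le (Does.seq (progSize_does h) fun s₁ ⟨hf₁, hm, hpow⟩ =>
    have h₁ := h.of_frame hf₁ (by decide) (by decide)
    Does.seq (progPowers_does h₁) fun s₂ ⟨hf₂, hp, hp'⟩ =>
    have h₂ : Loaded I s₂ := ⟨h₁.of_frame hf₂ (by decide) (by decide),
      by rw [hf₂.nats 16 (by decide)]; exact hm, by rw [hf₂.nats 6 (by decide)]; exact hpow,
      hp, hp'⟩
    Does.seq (progRead_does h₂
        (by rw [hf₂.nats 5 (by decide), hf₁.nats 5 (by decide), hN 5 (by simp)])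
        (by rw [hf₂.nats 20 (by decide), hf₁.nats 20 (by decide), hN 20 (by simp)])
        (by rw [hf₂.reals 2 (by decide), hf₁.reals 2 (by decide), hR 2 (by simp)]))
      fun s₃ ⟨hf₃, h₃, hkey, hinfl⟩ =>
    Does.seq (progInverse_does h₃.toLoaded hinfl) fun s₄ ⟨hf₄, hinv⟩ =>
    have h₄ := h₃.of_frame hf₄ (by decide) (by decide)
    Does.seq (progSchedule_does h₄ (by rw [hf₄.nats 5 (by decide)]; exact hkey)
        (by rw [hf₄.nats 18 (by decide), hf₃.nats 18 (by decide), hf₂.nats 18 (by decide),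
          hf₁.nats 18 (by decide), hN 18 (by simp)])
        (by rw [hf₄.reals 5 (by decide), hf₃.reals 5 (by decide), hf₂.reals 5 (by decide),
          hf₁.reals 5 (by decide), hR 5 (by simp)])
        (by rw [hf₄.reals 6 (by decide), hf₃.reals 6 (by decide), hf₂.reals 6 (by decide),
          hf₁.reals 6 (by decide), hR 6 (by simp)]))
      fun s₅ ⟨hf₅, hS, ht, hM⟩ =>
    have h₅ : Ready I s₅ := ⟨h₄.of_frame hf₅ (by decide) (by decide), hS,
      by rw [hf₅.reals 19 (by decide)]; exact hinv⟩
    (progEliminate_does h₅ ht hM).mono le_rfl fun s₆ ⟨hf₆, h10, h5, hsum⟩ =>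
      ⟨(h₅.of_frame hf₆ (by decide) (by decide)).toListed, h10, h5, hsum⟩) ?_
  have h1 : I.T * (I.k + 1) ≤ I.T * (I.k + 1) ^ 2 :=
    Nat.mul_le_mul_left _ (Nat.le_self_pow two_ne_zero _)
  have h2 : I.T * I.k ^ 2 ≤ I.T * (I.k + 1) ^ 2 :=
    Nat.mul_le_mul_left _ (Nat.pow_le_pow_left (Nat.le_succ _) 2)
  linarith

lemma Terms.value_congr {I : Terms} {x y : ℕ → ℝ} (h : ∀ v < I.m, x v = y v) :
    I.value x = I.value y := by
  refine Finset.sum_congr rfl fun t ht => ?_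
  rw [Finset.prod_congr rfl fun u hu =>
    h u (Finset.mem_range.1 (Terms.supp_subset (Finset.mem_range.1 ht) hu))]

lemma Terms.term_congr {I : Terms} {x y : ℕ → ℝ} (h : ∀ v < I.m, x v = y v) {t : ℕ}
    (ht : t < I.T) : I.term x t = I.term y t := by
  rw [term, term, Finset.prod_congr rfl fun u hu =>
    h u (Finset.mem_range.1 (Terms.supp_subset ht hu))]

/-- The amplitudes in the output memory belong to the Bloch vectors `x`. -/
def HasOutput (n : ℕ) (x : ℕ → ℝ) (s : Store) : Prop := ∀ i < n,
  s.reals 1 i 0 = √((1 + x (3 * i + 2)) / 2) ∧ s.reals 1 i 1 = 0 ∧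
    s.reals 1 i 2 = x (3 * i) / (2 * √((1 + x (3 * i + 2)) / 2)) ∧
    s.reals 1 i 3 = x (3 * i + 1) / (2 * √((1 + x (3 * i + 2)) / 2))

/-- The interpolation constant turns the sum of the absolute derivatives into a lower bound for |f|
at the best point of the segment, and rounding preserves it. -/
lemma progImprove_does {I : Terms} {s : Store} (h : Listed I s) {n : ℕ} (hn : I.m = 3 * n)
    (h10 : ∀ i < I.m, |s.reals 10 i 0| = 1 / 4)
    (h5 : ∀ v, s.reals 5 v 0 = I.deriv v fun i => s.reals 10 i 0) {c : ℝ} (hc : 0 < c)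
    (hpoly : ∀ p : Polynomial ℝ, p.natDegree ≤ I.k →
      ∃ e ≤ I.k, c * |p.coeff 1| ≤ |p.eval ((e : ℝ) / I.k)|) :
    Does progImprove s (3000 * (I.m + I.k + I.T * (I.k + 1) ^ 2 + 1)) fun s' => ∃ x : ℕ → ℝ,
      (∀ i < I.m, x i ^ 2 = 1 / 3) ∧ HasOutput n x s' ∧
      c * (1 / 8 * ∑ v ∈ Finset.range I.m, |I.deriv v fun i => s.reals 10 i 0|) ≤
        |I.value x| := by
  refine Does.le (Does.seq (progDirection_does h.toLoaded) fun s₁ ⟨hf₁, h11⟩ =>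
    have h₁ := h.of_frame hf₁ (by decide) (by decide)
    Does.seq (progSearch_does h₁) fun s₂ ⟨hf₂, he0, he1, hterm, hval, hmax⟩ =>
    have h₂ := h₁.of_frame hf₂ (by decide) (by decide)
    Does.seq (progPoint_does h₂.toLoaded) fun s₃ ⟨hf₃, hx, hs1, hs⟩ =>
    have h₃ := h₂.of_frame hf₃ (by decide) (by decide)
    have hpt : ∀ v < I.m, s₃.xs v = s₁.point (s₂.reals 13 0 0) v := fun v hv => by
      rw [Store.xs, hx v hv, Store.point, hf₂.reals 10 (by decide), hf₂.reals 11 (by decide),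
        Store.point]
    Does.seq (progRound_does h₃ ?_ ?_) fun s₄ ⟨hf₄, hsq, hle⟩ =>
    have h₄ := h₃.of_frame hf₄ (by decide) (by decide)
    (progOutput_does h₄.toHasInput).mono le_rfl fun s₅ ho =>
      ⟨s₄.xs, hsq, fun i hi => ho i (by have := h₄.size; omega), ?_⟩) ?_
  · intro i hi
    have ha := h10 i hi
    have hb := (h11 i hi).1
    have hc' : |s₂.reals 13 0 0 * s₁.reals 11 i 0| ≤ 1 / 8 := by
      rw [abs_mul, hb, abs_of_nonneg he0]; linarith
    -- The largest possible coordinate is 1/4 + 1/8.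
    have h38 : (3 / 8 : ℝ) < √(1 / 3) := by
      rw [Real.lt_sqrt (by norm_num)]; norm_num
    rw [hpt i hi, Store.point, hf₁.reals 10 (by decide)]
    have h1 := abs_add_le (s.reals 10 i 0) (s₂.reals 13 0 0 * s₁.reals 11 i 0)
    have h2 := abs_sub_abs_le_abs_sub (s.reals 10 i 0) (-(s₂.reals 13 0 0 * s₁.reals 11 i 0))
    rw [abs_neg, sub_neg_eq_add] at h2
    constructor <;> linarith
  · intro t ht
    rw [hf₃.reals 18 (by decide), hterm t ht]
    exact Terms.term_congr (fun v hv => (hpt v hv).symm) ht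
  · obtain ⟨p, hp, hev, hc1⟩ := Terms.exists_polynomial_value I (fun i => s.reals 10 i 0)
      fun i => s₁.reals 11 i 0
    obtain ⟨e, he, hce⟩ := hpoly p hp
    -- Along the chosen direction every partial derivative contributes its absolute value.
    have hcoeff : p.coeff 1 =
        1 / 8 * ∑ v ∈ Finset.range I.m, |I.deriv v fun i => s.reals 10 i 0| := by
      rw [hc1, Finset.mul_sum]
      refine Finset.sum_congr rfl fun v hv => ?_
      rw [← h5, ← (h11 v (Finset.mem_range.1 hv)).2]
    have hpoint : (fun v => s.reals 10 v 0 + (e : ℝ) / I.k * s₁.reals 11 v 0) =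
        s₁.point ((e : ℝ) / I.k) := by
      funext v
      rw [Store.point, hf₁.reals 10 (by decide)]
    calc c * (1 / 8 * ∑ v ∈ Finset.range I.m, |I.deriv v fun i => s.reals 10 i 0|)
        ≤ c * |p.coeff 1| := by rw [hcoeff]; exact mul_le_mul_of_nonneg_left (le_abs_self _) hc.le
      _ ≤ |I.value (s₁.point ((e : ℝ) / I.k))| := by rw [← hpoint, ← hev]; exact hce
      _ ≤ |s₂.reals 15 0 0| := hmax e he
      _ = s₃.reals 9 0 0 * I.value s₃.xs := by rw [Terms.value_congr hpt, ← hval, hs]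
      _ ≤ s₃.reals 9 0 0 * I.value s₄.xs := hle
      _ ≤ |s₃.reals 9 0 0 * I.value s₄.xs| := le_abs_self _
      _ = |I.value s₄.xs| := by rw [abs_mul, hs1, one_mul]
  · have h1 : I.T * I.k ≤ I.T * (I.k + 1) ^ 2 := Nat.mul_le_mul_left _ (by nlinarith)
    lia

theorem algorithm_does {I : Terms} {s : Store} (h : HasInput I s)
    (hN : ∀ a ∈ [5, 18, 20], s.nats a = fun _ _ => 0)
    (hR : ∀ a ∈ [2, 5, 6], s.reals a = fun _ _ => 0) {n : ℕ} (hn : I.m = 3 * n)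
    {c : ℝ} (hc : 0 < c)
    (hpoly : ∀ p : Polynomial ℝ, p.natDegree ≤ I.k →
      ∃ e ≤ I.k, c * |p.coeff 1| ≤ |p.eval ((e : ℝ) / I.k)|) :
    Does algorithm s (7000 * (I.m + I.k + I.T * (I.k + 1) ^ 2 + 1)) fun s' => ∃ x : ℕ → ℝ,
      (∀ i < I.m, x i ^ 2 = 1 / 3) ∧ HasOutput n x s' ∧
      c * (1 / 8 * (1 / 16) ^ (2 * I.k)) * ∑ v ∈ Finset.range I.m, √(I.infl v) ≤
        |I.value x| := by
  refine (Does.seq (progBase_does h hN hR) fun s₁ ⟨h₁, h10, h5, hsum⟩ =>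
    (progImprove_does h₁ hn h10 h5 hc hpoly).mono le_rfl fun s₂ ⟨x, hx, ho, hv⟩ =>
      ⟨x, hx, ho, le_trans ?_ hv⟩).le (by ring_nf; rfl)
  rw [mul_assoc, mul_assoc]
  gcongr

/-! ### Hamiltonians as polynomials -/

namespace PauliString

variable {n : ℕ}

/-- The index of the Bloch coordinate in which the qubit `i` enters the energy of `P`. -/
def coord (P : PauliString n) (i : Fin n) : ℕ := 3 * i + (P i).code - 1

/-- The Bloch coordinates entering the energy of `P`. -/
def coords (P : PauliString n) : Finset ℕ := P.dom.image P.coord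

lemma mem_dom {P : PauliString n} {i : Fin n} : i ∈ P.dom ↔ P i ≠ Pauli.I := by simp [dom]

lemma mem_domList {P : PauliString n} {i : Fin n} : i ∈ P.domList ↔ P i ≠ Pauli.I := by
  simp [domList]

lemma pairwise_domList (P : PauliString n) : P.domList.Pairwise (· < ·) :=
  (List.pairwise_lt_finRange n).filter _

lemma toFinset_domList (P : PauliString n) : P.domList.toFinset = P.dom := by
  ext i
  rw [List.mem_toFinset, mem_domList, mem_dom]

lemma length_domList (P : PauliString n) : P.domList.length = P.weight := by
  rw [weight, ← toFinset_domList, List.toFinset_card_of_nodup]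
  exact P.pairwise_domList.imp ne_of_lt

end PauliString

lemma Pauli.code_bounds {p : Pauli} (h : p ≠ Pauli.I) : 1 ≤ p.code ∧ p.code ≤ 3 := by
  cases p <;> simp_all [Pauli.code]

lemma Pauli.code_injective : Function.Injective Pauli.code := by
  intro p q h
  cases p <;> cases q <;> simp_all [Pauli.code]

namespace PauliString

variable {n : ℕ}

/-- Nontrivial codes run from 1 to 3, so the qubit i owns the indices 3i, 3i + 1, 3i + 2, and an
index determines both the qubit and the Pauli matrix. -/
lemma mem_coords {P : PauliString n} {i : Fin n} {p : Pauli} (hp : p ≠ Pauli.I) :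
    3 * (i : ℕ) + p.code - 1 ∈ P.coords ↔ P i = p := by
  simp only [coords, coord, Finset.mem_image, mem_dom]
  constructor
  · rintro ⟨j, hj, h⟩
    have h1 := Pauli.code_bounds hj
    have h2 := Pauli.code_bounds hp
    obtain rfl : j = i := Fin.ext (by omega)
    exact Pauli.code_injective (by omega)
  · rintro rfl
    exact ⟨i, hp, rfl⟩

/-- Each Pauli string is recovered from its monomial; this is what makes the supports of the terms
distinct. -/
lemma coords_injective : Function.Injective (coords (n := n)) := by
  intro P Q h
  funext i
  by_cases hP : P i = Pauli.I
  · by_contra hne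
    have hQ : Q i ≠ Pauli.I := fun h' => hne (hP.trans h'.symm)
    exact hne ((mem_coords hQ).1 (h ▸ (mem_coords hQ).2 rfl))
  · exact ((mem_coords hP).1 (h ▸ (mem_coords hP).2 rfl)).symm

lemma coord_injOn (P : PauliString n) : Set.InjOn P.coord P.dom := by
  intro i hi j hj h
  have h1 := Pauli.code_bounds (mem_dom.1 hi)
  have h2 := Pauli.code_bounds (mem_dom.1 hj)
  simp only [coord] at h
  exact Fin.ext (by omega)

/-- The coordinates entering the energy of `P`, in increasing order. -/
def coordAt (P : PauliString n) (j : ℕ) : ℕ := (P.domList.map P.coord).getD j 0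

lemma coordAt_eq (P : PauliString n) {j : ℕ} (hj : j < P.weight) :
    P.coordAt j = P.coord (P.domList[j]'(by rwa [length_domList])) := by
  simp [coordAt, length_domList, hj]

lemma image_coordAt (P : PauliString n) : (Finset.range P.weight).image P.coordAt = P.coords := by
  ext v
  simp only [Finset.mem_image, Finset.mem_range, coords, ← toFinset_domList, List.mem_toFinset,
    List.mem_iff_getElem]
  constructor
  · rintro ⟨j, hj, rfl⟩
    exact ⟨_, ⟨j, by rwa [length_domList], rfl⟩, (P.coordAt_eq hj).symm⟩
  · rintro ⟨_, ⟨j, hj, rfl⟩, rfl⟩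
    rw [length_domList] at hj
    exact ⟨j, hj, P.coordAt_eq hj⟩

lemma coordAt_lt (P : PauliString n) {j : ℕ} (hj : j < P.weight) : P.coordAt j < 3 * n := by
  have h : P.domList[j]'(by rwa [length_domList]) ∈ P.domList := List.getElem_mem _
  have h1 := Pauli.code_bounds (mem_domList.1 h)
  rw [P.coordAt_eq hj, coord]
  omega

lemma coordAt_mono (P : PauliString n) {j j' : ℕ} (h : j < j') (hj' : j' < P.weight) :
    P.coordAt j < P.coordAt j' := by
  have hl : ∀ {i}, i < P.weight → i < P.domList.length := fun hi => by rwa [length_domList]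
  have h0 := List.pairwise_iff_getElem.1 P.pairwise_domList j j' (hl (h.trans hj')) (hl hj') h
  have h1 := Pauli.code_bounds (mem_domList.1 (List.getElem_mem (hl (h.trans hj'))))
  have h2 := Pauli.code_bounds (mem_domList.1 (List.getElem_mem (hl hj')))
  rw [P.coordAt_eq hj', P.coordAt_eq (h.trans hj'), coord, coord]
  rw [Fin.lt_def] at h0
  omega

/-- The energy of `P` in the product state with Bloch vectors `x`. -/
def blochProd (P : PauliString n) (x : ℕ → ℝ) : ℝ := ∏ u ∈ P.coords, x u

lemma blochProd_eq (P : PauliString n) (x : ℕ → ℝ) :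
    P.blochProd x = ∏ i, if P i = Pauli.I then 1 else x (P.coord i) := by
  rw [blochProd, coords, Finset.prod_image P.coord_injOn, dom, Finset.prod_filter]
  refine Finset.prod_congr rfl fun i _ => ?_
  split_ifs <;> simp_all

lemma weight_eq_zero {P : PauliString n} : P.weight = 0 ↔ P = fun _ => Pauli.I := by
  simp [weight, dom, Finset.filter_eq_empty_iff, funext_iff]

end PauliString

/-! ### The listed Hamiltonian as a sparse multilinear polynomial. -/

section Listing

variable {n : ℕ} {α : PauliString n → ℝ} (e : Fin (nnz α) ≃ {P : PauliString n // α P ≠ 0})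

/-- The Pauli string of the term `t`. -/
def stringAt (t : ℕ) : PauliString n :=
  if h : t < nnz α then (e ⟨t, h⟩).1 else fun _ => Pauli.I

lemma stringAt_eq {t : ℕ} (h : t < nnz α) : stringAt e t = (e ⟨t, h⟩).1 := dif_pos h

lemma sum_stringAt (F : PauliString n → ℝ) (hF : ∀ P, α P = 0 → F P = 0) :
    ∑ t ∈ Finset.range (nnz α), F (stringAt e t) = ∑ P, F P := by
  classical
  rw [Finset.sum_range]
  simp only [stringAt_eq e (Fin.is_lt _)]
  rw [e.sum_comp fun P => F P.1, ← Finset.sum_subtype (Finset.univ.filter fun P => α P ≠ 0)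
    (by simp) F, Finset.sum_filter]
  refine Finset.sum_congr rfl fun P _ => ?_
  split_ifs with h
  · rfl
  · exact (hF P (not_not.1 h)).symm

/-- The energy of product states as a polynomial in the Bloch coordinates. -/
def blochTerms (k : ℕ) (hα : IsLocal k α) : Terms where
  m := 3 * n
  k := k
  T := nnz α
  w t := (stringAt e t).weight
  var t := (stringAt e t).coordAt
  a t := α (stringAt e t)
  w_le t ht := by
    rw [stringAt_eq e ht]
    exact not_lt.1 fun h => (e ⟨t, ht⟩).2 (hα _ h)
  var_mono _ _ _ _ h h' := PauliString.coordAt_mono _ h h'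
  var_lt _ _ _ hj := PauliString.coordAt_lt _ hj
  supp_inj t ht t' ht' h := by
    rw [PauliString.image_coordAt, PauliString.image_coordAt] at h
    have := PauliString.coords_injective h
    rw [stringAt_eq e ht, stringAt_eq e ht'] at this
    simpa using e.injective (Subtype.ext this)

variable {k : ℕ} (hα : IsLocal k α)

lemma blochTerms_supp (t : ℕ) : (blochTerms e k hα).supp t = (stringAt e t).coords :=
  PauliString.image_coordAt _

lemma blochTerms_infl (i : Fin n) {p : Pauli} (hp : p ≠ Pauli.I) :
    (blochTerms e k hα).infl (3 * i + p.code - 1) = influence α i p := by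
  rw [Terms.infl, influence, Finset.sum_filter]
  simp only [blochTerms_supp, PauliString.mem_coords hp]
  exact sum_stringAt e (fun P => if P i = p then α P ^ 2 else 0) fun P h => by simp [h]

lemma sum_range_three_mul (n : ℕ) (f : ℕ → ℝ) : ∑ v ∈ Finset.range (3 * n), f v =
    ∑ i ∈ Finset.range n, (f (3 * i) + f (3 * i + 1) + f (3 * i + 2)) := by
  induction n with
  | zero => simp
  | succ n ih =>
    rw [Finset.sum_range_succ, ← ih, Nat.mul_succ, Finset.sum_range_succ, Finset.sum_range_succ,
      Finset.sum_range_succ]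
    ring

lemma sum_sqrt_infl : ∑ v ∈ Finset.range (3 * n), √((blochTerms e k hα).infl v) =
    ∑ i : Fin n, ∑ p ∈ ({Pauli.X, Pauli.Y, Pauli.Z} : Finset Pauli), √(influence α i p) := by
  rw [sum_range_three_mul, Finset.sum_range]
  refine Finset.sum_congr rfl fun i _ => ?_
  rw [Finset.sum_insert (by decide), Finset.sum_insert (by decide), Finset.sum_singleton,
    ← blochTerms_infl e hα i (p := .X) (by decide), ← blochTerms_infl e hα i (p := .Y) (by decide),
    ← blochTerms_infl e hα i (p := .Z) (by decide), ← add_assoc]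
  rfl

/-- The identity is the only string of weight zero, so the omitted constant term is its coefficient.
-/
lemma blochTerms_value (x : ℕ → ℝ) :
    (blochTerms e k hα).value x + α (fun _ => Pauli.I) = ∑ P, α P * P.blochProd x := by
  have h : (blochTerms e k hα).value x =
      ∑ P : PauliString n, if P ≠ (fun _ => Pauli.I) then α P * P.blochProd x else 0 := by
    rw [← sum_stringAt e _ fun P h => by simp [h], Terms.value]
    refine Finset.sum_congr rfl fun t _ => ?_
    rw [blochTerms_supp]
    refine if_congr ?_ rfl rfl
    exact not_congr PauliString.weight_eq_zero
  have h1 : PauliString.blochProd (fun _ : Fin n => Pauli.I) x = 1 := by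
    simp [PauliString.blochProd_eq]
  rw [h, ← Finset.add_sum_erase _ (fun P : PauliString n => α P * P.blochProd x)
    (Finset.mem_univ fun _ => Pauli.I), h1, mul_one, add_comm, ← Finset.sum_filter]
  congr 2
  ext P
  simp

lemma hasInput_inputStore : HasInput (blochTerms e k hα) (inputStore k α e) where
  size := by simp [inputStore, blochTerms]
  k := by simp [inputStore, blochTerms]
  T := by simp [inputStore, blochTerms]
  w t ht := by
    have ht' : t < nnz α := ht
    simp [inputStore, blochTerms, ht', stringAt_eq e ht']
  a t ht := by
    have ht' : t < nnz α := ht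
    simp [inputStore, blochTerms, ht', stringAt_eq e ht']
  var t ht j hj := by
    have ht' : t < nnz α := ht
    have hj' : j < (e ⟨t, ht'⟩).1.weight := by rw [← stringAt_eq e ht']; exact hj
    have hv : (blochTerms e k hα).var t j = (e ⟨t, ht'⟩).1.coordAt j := by
      rw [← stringAt_eq e ht']; rfl
    rw [hv, PauliString.coordAt_eq _ hj', PauliString.coord]
    have hl : j < (e ⟨t, ht'⟩).1.domList.length := by rwa [PauliString.length_domList]
    have h2 : (inputStore k α e).nats 2 t j = (e ⟨t, ht'⟩).1.domList[j] := by
      simp only [inputStore, ht', ↓reduceDIte, if_true, if_false, OfNat.ofNat_ne_zero,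
        OfNat.ofNat_ne_one]
      rw [List.getD_eq_getElem _ _ (by simpa using hl), List.getElem_map]
      simp only [bind_pure_comp, List.map_eq_map, List.getElem_map]
    have h3 : (inputStore k α e).nats 3 t j =
        ((e ⟨t, ht'⟩).1 ((e ⟨t, ht'⟩).1.domList[j])).code := by
      simp only [inputStore, ht', ↓reduceDIte, if_true, if_false, OfNat.ofNat_ne_zero,
        OfNat.ofNat_ne_one]
      rw [if_neg (by decide), List.getD_eq_getElem _ _ (by simpa using hl), List.getElem_map]
    rw [h2, h3]
    omega

end Listing

/-! ### The output state -/

section Bloch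

variable {x y z : ℝ}

/-- The qubit with the Bloch vector `(x, y, z)`. -/
def blochQubit (x y z : ℝ) : EuclideanSpace ℂ (Fin 2) :=
  !₂[(⟨√((1 + z) / 2), 0⟩ : ℂ), (⟨x / (2 * √((1 + z) / 2)), y / (2 * √((1 + z) / 2))⟩ : ℂ)]

lemma norm_blochQubit (hz : -1 < z) (h : x ^ 2 + y ^ 2 + z ^ 2 = 1) :
    ‖blochQubit x y z‖ = 1 := by
  have hc : 0 < (1 + z) / 2 := by linarith
  have hs := Real.sq_sqrt hc.le
  have hs0 := Real.sqrt_pos.2 hc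
  rw [← pow_eq_one_iff_of_nonneg (norm_nonneg _) two_ne_zero, EuclideanSpace.norm_sq_eq]
  simp only [blochQubit, Fin.sum_univ_two, ← Complex.normSq_eq_norm_sq]
  simp only [Matrix.cons_val_zero, Matrix.cons_val_one, Complex.normSq_mk]
  generalize √((1 + z) / 2) = c at *
  field_simp
  -- In terms of the first amplitude c, the unit vector condition becomes x² + y² = 4c²(1 - c²).
  obtain rfl : z = 2 * c ^ 2 - 1 := by linarith
  nlinarith

/-- The assumption on z keeps the first amplitude nonzero, so the division in the second one is
genuine and the expectations are the Bloch coordinates. -/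
lemma quadForm_blochQubit (hz : -1 < z) (h : x ^ 2 + y ^ 2 + z ^ 2 = 1) (p : Pauli) :
    quadForm p.mat (blochQubit x y z).ofLp =
      ((match p with | .I => 1 | .X => x | .Y => y | .Z => z : ℝ) : ℂ) := by
  have hc : 0 < (1 + z) / 2 := by linarith
  have hs := Real.sq_sqrt hc.le
  have hs0 := Real.sqrt_pos.2 hc
  simp only [blochQubit, quadForm, Fin.sum_univ_two]
  generalize √((1 + z) / 2) = c at *
  obtain rfl : z = 2 * c ^ 2 - 1 := by linarith
  cases p <;> apply Complex.ext <;>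
    simp [Pauli.mat, -Complex.ofReal_pow] <;> field_simp <;> nlinarith

end Bloch

lemma neg_one_lt_of_sq_eq {z : ℝ} (h : z ^ 2 = 1 / 3) : -1 < z := by nlinarith

/-- Three squares equal to 1/3 add up to 1, so every choice of signs gives a pure state, and its
expectations factor over the qubits. -/
lemma energy_productState_blochQubit {n : ℕ} (α : PauliString n → ℝ) {x : ℕ → ℝ}
    (hx : ∀ i < 3 * n, x i ^ 2 = 1 / 3) :
    energy (hamiltonian α) (productState fun i : Fin n =>
      blochQubit (x (3 * i)) (x (3 * i + 1)) (x (3 * i + 2))) = ∑ P, α P * P.blochProd x := by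
  rw [energy_hamiltonian]
  refine Finset.sum_congr rfl fun P _ => ?_
  rw [energy_eq_quadForm, quadForm_productState, PauliString.blochProd_eq]
  congr 1
  rw [← Complex.ofReal_re (∏ i, if P i = Pauli.I then 1 else x (P.coord i)), Complex.ofReal_prod]
  congr 1
  refine Finset.prod_congr rfl fun i _ => ?_
  have h0 := hx (3 * i) (by omega)
  have h1 := hx (3 * i + 1) (by omega)
  have h2 := hx (3 * i + 2) (by omega)
  rw [quadForm_blochQubit (neg_one_lt_of_sq_eq h2) (by linarith)]
  cases h : P i <;> simp [PauliString.coord, Pauli.code, h]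

lemma HasOutput.outputState_eq {n : ℕ} {x : ℕ → ℝ} {s : Store} (h : HasOutput n x s) :
    outputState n s = fun i : Fin n =>
      blochQubit (x (3 * i)) (x (3 * i + 1)) (x (3 * i + 2)) := by
  funext i
  obtain ⟨h0, h1, h2, h3⟩ := h i i.2
  rw [outputState, blochQubit, h0, h1, h2, h3]

/-- The left side dominates (k+1)² and, unlike that square, at most doubles from k to k + 1 for
every k, so the induction closes. -/
lemma sq_add_le_two_pow (k : ℕ) : k ^ 2 + 4 * k + 6 ≤ 8 * 2 ^ k := by
  induction k with
  | zero => norm_num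
  | succ k ih => rw [pow_succ 2]; nlinarith

lemma cost_le {n k T : ℕ} (hn : 1 ≤ n) (hk : 1 ≤ k) :
    7000 * (3 * n + k + T * (k + 1) ^ 2 + 1) ≤ 56000 * (n * k + T * 2 ^ k) := by
  have h1 : T * (k + 1) ^ 2 ≤ T * (8 * 2 ^ k) :=
    Nat.mul_le_mul_left _ (by have := sq_add_le_two_pow k; nlinarith)
  have h2 : n ≤ n * k := Nat.le_mul_of_pos_right _ hk
  have h3 : k ≤ n * k := Nat.le_mul_of_pos_left _ hn
  linarith

end

end ProductStates

theorem mainTheorem11 :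
    ∃ (prog : Program) (C : ℕ) (D : ℕ → ℝ), (∀ k, 0 < D k) ∧
      ∀ (n k : ℕ), 1 ≤ n → 1 ≤ k →
      ∀ (α : PauliString n → ℝ), IsLocal k α →
      ∀ e : Fin (nnz α) ≃ {P : PauliString n // α P ≠ 0},
      ∃ ψ : (ℕ → ℝ) → Fin n → EuclideanSpace ℂ (Fin 2),
        (∀ ω, ∃ (s : Store) (t : ℕ),
          Runs ω prog (inputStore k α e) s t ∧
          t ≤ C * (n * k + nnz α * 2 ^ k) ∧
          outputState n s = ψ ω) ∧
        Measurable ψ ∧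
        (∀ ω i, ‖ψ ω i‖ = 1) ∧
        MeasureTheory.Integrable
          (fun ω => energy (hamiltonian α) (productState (ψ ω))) tapeLaw ∧
        haarEnergy (hamiltonian α) = α (fun _ => Pauli.I) ∧
        D k * ∑ i : Fin n, ∑ p ∈ ({Pauli.X, Pauli.Y, Pauli.Z} : Finset Pauli),
            Real.sqrt (influence α i p) ≤
          |(∫ ω, energy (hamiltonian α) (productState (ψ ω)) ∂tapeLaw) -
            haarEnergy (hamiltonian α)| := by
  choose c hc hpoly using exists_abs_coeff_one_le
  refine ⟨algorithm, 56000, fun k => c k * (1 / 8 * (1 / 16) ^ (2 * k)),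
    fun k => mul_pos (hc k) (by positivity), fun n k hn hk α hα e => ?_⟩
  obtain ⟨s, t, hrun, ht, x, hx, ho, hv⟩ := algorithm_does (hasInput_inputStore e hα)
    (fun a ha => by
      have : a ≠ 0 ∧ a ≠ 1 ∧ a ≠ 2 ∧ a ≠ 3 := by simp at ha; omega
      funext t j
      simp [inputStore, this])
    (fun a ha => by
      have : a ≠ 0 := by simp at ha; omega
      funext t j
      simp [inputStore, this]) rfl (hc k) (hpoly k)
  have hE : energy (hamiltonian α) (productState (outputState n s)) =
      (blochTerms e k hα).value x + α (fun _ => Pauli.I) := by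
    rw [ho.outputState_eq, energy_productState_blochQubit α hx, blochTerms_value]
  have : IsProbabilityMeasure tapeLaw := by unfold tapeLaw; infer_instance
  -- The run does not depend on the random tape, so the output is a constant and its expected energy
  -- is its energy.
  refine ⟨fun _ => outputState n s, fun ω => ⟨s, t, hrun ω, ht.trans (cost_le hn hk), rfl⟩,
    measurable_const, fun _ i => ?_, integrable_const _, haarEnergy_hamiltonian α, ?_⟩
  · have h0 := hx (3 * i) (by change _ < 3 * n; omega)
    have h1 := hx (3 * i + 1) (by change _ < 3 * n; omega)
    have h2 := hx (3 * i + 2) (by change _ < 3 * n; omega)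
    rw [ho.outputState_eq]
    exact norm_blochQubit (neg_one_lt_of_sq_eq h2) (by linarith)
  · rw [integral_const, probReal_univ, one_smul, hE, haarEnergy_hamiltonian, add_sub_cancel_right,
      ← sum_sqrt_infl e hα]
    exact hv
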